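/- **Setting.** Let $\alpha$ be a positive rational number. $G_\alpha$ denotes the connected and simply connected nilpotent Lie group whose left-invariant 1-forms have a basis $e^1,\dots,e^8$ with $$de^1=de^2=de^3=de^4=0,\quad de^5=e^{12},\quad de^6=e^{15}+(1-\alpha)e^{24},$$ $$de^7=-(1+\alpha)e^{14}-e^{23}+(1+\alpha)e^{25},\qquad de^8=e^{16}+e^{27}+e^{34}-2e^{45},$$ where $e^{ij}=e^i\wedge e^j$. For a lattice (discrete cocompact subgroup) $\Gamma\subset G_\alpha$ let $N_\alpha=\Gamma\backslash G_\alpha$ be the corresponding compact 8-dimensional nilmanifold. A structure on $N_\alpha$ is *invariant* if its pull-back to $G_\alpha$ is left-invariant; in particular $e^1,\dots,e^8$ descend to a global frame of invariant 1-forms on $N_\alpha$. A *generalized complex structure* on a manifold $M$ of dimension $2n$ is a smooth endomorphism $\mathcal J$ of $TM\oplus T^*M$, orthogonal for $\langle X+\xi\mid Y+\eta\rangle=\frac12(\xi(Y)+\eta(X))$, with $\mathcal J^2=-1$, whose $i$-eigenbundle $L\subset(TM\oplus T^*M)\otimes\mathbb C$ is involutive for the Courant bracket. Let $TM\oplus T^*M$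 act on forms by $(X+\xi)\cdot\rho=\iota_X\rho+\xi\wedge\rho$. We say that $\mathcal J$ is *given by the closed pure form* $\rho=e^{B+i\omega}\,\Omega$ *of type* $k$ if $B,\omega$ are smooth real 2-forms, $\Omega=\theta^1\wedge\dots\wedge\theta^k$ with smooth complex 1-forms $\theta^j$, and $$\omega^{n-k}\wedge\Omega\wedge\overline\Omega\neq0 \text{ everywhere},\qquad d\rho=0,\qquad L=\mathrm{Ann}(\rho).$$ **Proposition.** For each $\alpha\in\mathbb Q^+$ the group $G_\alpha$ has a lattice, and for every lattice $\Gamma$ the nilmanifold $N_\alpha=\Gamma\backslash G_\alpha$ has invariant generalized complex structures of every type $k$, $0\le k\le4$, given by closed pure forms $\rho=e^{B+i\omega}\Omega$ with $B,\omega$ and the factors of $\Omega$ invariant. Explicitly, put $$\theta^1=\tfrac12\Big(\tfrac{e^1}{\sqrt{3+\alpha}}-e^2\Big)+\tfrac i2\Big(\tfrac{e^1}{\sqrt{3+\alpha}}+e^2\Big),\qquad \theta^2=-\alpha e^4-\tfrac{i}{\sqrt{3+\alpha}}\Big(\tfrac12e^3+e^5\Big),$$ $$\theta^3=\tfrac{\alpha}{(1+\alpha)^2}\Big(e^6-\tfrac{e^7}{\sqrt{3+\alpha}}\Big)+\tfrac{i\alpha}{(1+\alpha)^2}\Big(e^6+\tfrac{e^7}{\sqrt{3+\alpha}}\Big),$$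 $$\theta^4=\tfrac1{\sqrt{3+\alpha}}\Big(e^5+\tfrac{1-\alpha}{2(1+\alpha)^2}e^3\Big)-i\alpha\Big(e^4+\tfrac{2}{(1+\alpha)^2\sqrt{3+\alpha}}e^8\Big),$$ and, for real numbers $x_{12},\dots,x_{37}$, $$\begin{aligned}\omega_x={}&x_{12}e^{12}+x_{13}e^{13}+x_{14}e^{14}+x_{15}e^{15}+x_{16}e^{16}+x_{17}e^{17}-(1+\alpha)x_{37}e^{18}+x_{23}e^{23}+x_{24}e^{24}+x_{25}e^{25}\\&+(1+\alpha)x_{17}e^{26}+x_{27}e^{27}+x_{34}e^{34}+x_{17}e^{35}+x_{37}e^{37}-\big((1-\alpha)x_{16}+(1+\alpha)x_{27}\big)e^{45}\\&+(1+\alpha)(3+\alpha)x_{37}e^{46}-(1+\alpha)x_{37}e^{57}.\end{aligned}$$ Then each of the following forms $\rho=e^{B+i\omega}\Omega$ gives an invariant generalized complex structure on $N_\alpha$ of the stated type: * type 4: $B=\omega=0$, $\Omega=\theta^1\wedge\theta^2\wedge\theta^3\wedge\theta^4$; here $\mathcal J=\begin{pmatrix}-J&0\\0&J^*\end{pmatrix}$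 for the (integrable) complex structure $J$ for which the $\theta^j$ are of bidegree $(1,0)$; * type 3: $B=0$, $\omega=i\,\theta^4\wedge\overline{\theta^4}$, $\Omega=\theta^1\wedge\theta^2\wedge\theta^3$; * type 2: $B=\frac12(\theta^3\wedge\theta^4+\overline{\theta^3}\wedge\overline{\theta^4})$, $\omega=-\frac i2(\theta^3\wedge\theta^4-\overline{\theta^3}\wedge\overline{\theta^4})$, $\Omega=\theta^1\wedge\theta^2$, that is, $\rho=e^{\theta^3\wedge\theta^4}\,\theta^1\wedge\theta^2$; * type 1: $B=0$, $\omega=\omega_x$ with $x_{17}\ne0$ and $x_{37}\neq0$, $\Omega=e^3+i\,e^4$; * type 0: $B=0$, $\omega=\omega_x$ with $x_{17}=x_{23}=0$, $x_{25}\neq0$ and $x_{37}\ne0$, $\Omega=1$; here $\omega$ is a symplectic form and $\mathcal J=\begin{pmatrix}0&-\omega^{-1}\\\omega&0\end{pmatrix}$. -/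

import Mathlib

open scoped Manifold ContDiff Topology

noncomputable section

/-! ## Generalized complex geometry on manifolds

`M` is a manifold modelled on a finite-dimensional real vector space `E`; the tangent space at `x`
is `TangentSpace 𝓘(ℝ, E) x`.  As for Mathlib's Lie bracket of vector fields, differential operators
at `x` are computed in the preferred chart at `x`, after pulling the tensor fields back to `E` along
the inverse of that chart. -/

namespace GCGeom

section Linear

variable {V W : Type*} [AddCommGroup V] [Module ℝ V] [TopologicalSpace V]
  [AddCommGroup W] [Module ℝ W] [TopologicalSpace W]

/-- `⋀• V* ⊗ ℂ`: the exterior algebra of the complex vector space of complex-valued covectors. -/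
abbrev CForms (V : Type*) [AddCommGroup V] [Module ℝ V] [TopologicalSpace V] : Type _ :=
  ExteriorAlgebra ℂ (V →L[ℝ] ℂ)

/-- `⋀• V*`, real coefficients. -/
abbrev RForms (V : Type*) [AddCommGroup V] [Module ℝ V] [TopologicalSpace V] : Type _ :=
  ExteriorAlgebra ℝ (V →L[ℝ] ℝ)

/-- A real covector seen as a complex one. -/
def toComplex (ξ : V →L[ℝ] ℝ) : V →L[ℝ] ℂ := Complex.ofRealCLM.comp ξ

/-- The complex conjugate of a complex covector. -/
def conj (θ : V →L[ℝ] ℂ) : V →L[ℝ] ℂ := Complex.conjCLE.toContinuousLinearMap.comp θ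

/-- A complex covector as a complex form of degree one. -/
abbrev oneForm (θ : V →L[ℝ] ℂ) : CForms V := ExteriorAlgebra.ι ℂ θ

/-- The inclusion `⋀• V* → ⋀• V* ⊗ ℂ`. -/
def complexify : RForms V →ₐ[ℝ] CForms V :=
  ExteriorAlgebra.lift ℝ
    ⟨{ toFun := fun ξ => oneForm (toComplex ξ)
       map_add' := fun ξ η => by
         rw [← map_add]; congr 1; ext v; simp [toComplex]
       map_smul' := fun r ξ => by
         have h : toComplex (r • ξ) = (r : ℂ) • toComplex ξ := by ext v; simp [toComplex]
         simp only [oneForm, h, map_smul, RingHom.id_apply, Complex.coe_smul] },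
     fun ξ => by simp⟩

/-- Pull-back of complex forms along a linear map. -/
def pullForm (D : V →L[ℝ] W) : CForms W →ₐ[ℂ] CForms V :=
  ExteriorAlgebra.map
    { toFun := fun θ => θ.comp D
      map_add' := fun _ _ => rfl
      map_smul' := fun _ _ => rfl }

/-- `V ⊕ V*`. -/
abbrev Gen (V : Type*) [AddCommGroup V] [Module ℝ V] [TopologicalSpace V] : Type _ :=
  V × (V →L[ℝ] ℝ)

/-- The pairing `⟨X + ξ | Y + η⟩ = (ξ(Y) + η(X)) / 2`. -/
def pairing (a b : Gen V) : ℝ := (a.2 b.1 + b.2 a.1) / 2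

/-- The pull-back of `X + ξ` along an invertible `D : V → W`, namely `D⁻¹ X + ξ ∘ D`. -/
def pullGen (D : V →L[ℝ] W) (a : Gen W) : Gen V := (D.inverse a.1, a.2.comp D)

/-- The interior product of a complex form with a real vector. -/
def interior (X : V) (ρ : CForms V) : CForms V :=
  CliffordAlgebra.contractLeft
    ({ toFun := fun θ => θ X, map_add' := fun _ _ => rfl, map_smul' := fun _ _ => rfl } :
      Module.Dual ℂ (V →L[ℝ] ℂ)) ρ

/-- The action `(X + ξ) · ρ = ι_X ρ + ξ ∧ ρ`. -/
def act (a : Gen V) (ρ : CForms V) : CForms V :=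
  interior a.1 ρ + oneForm (toComplex a.2) * ρ

/-- The action of `a + i b ∈ (V ⊕ V*) ⊗ ℂ` on complex forms. -/
def actC (a b : Gen V) (ρ : CForms V) : CForms V := act a ρ + Complex.I • act b ρ

/-- `e^C = ∑ C^j / j!` for a form `C` of degree two: on a space of dimension `m` the powers `C^j`
with `j > m` vanish. -/
def expForm (C : CForms V) : CForms V :=
  ∑ j ∈ Finset.range (Module.finrank ℝ V + 1), ((j.factorial : ℂ)⁻¹) • C ^ j

end Linear

section VectorSpace

variable {E : Type*} [NormedAddCommGroup E] [NormedSpace ℝ E] [FiniteDimensional ℝ E]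

instance finite_covectors : Module.Finite ℂ (E →L[ℝ] ℂ) :=
  Module.Finite.of_restrictScalars_finite ℝ ℂ _

instance finite_cforms : Module.Finite ℂ (CForms E) :=
  Module.Finite.of_basis (Module.finBasis ℂ (E →L[ℝ] ℂ)).ExteriorAlgebra

/-- The derivative at `y` in the direction `v` of a map `ρ` with values in the finite-dimensional
space `⋀• E* ⊗ ℂ`, taken coefficient by coefficient. -/
def dirDeriv (ρ : E → CForms E) (y v : E) : CForms E :=
  ∑ j, fderiv ℝ (fun z => (Module.finBasis ℂ (CForms E)).repr (ρ z) j) y v •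
    Module.finBasis ℂ (CForms E) j

/-- The exterior derivative of a complex form (of mixed degree) on `E`:
`dρ = ∑ dxⁱ ∧ ∂ρ/∂xⁱ` in linear coordinates `xⁱ`. -/
def extDerivE (ρ : E → CForms E) (y : E) : CForms E :=
  ∑ i, oneForm (toComplex (LinearMap.toContinuousLinearMap ((Module.finBasis ℝ E).coord i))) *
    dirDeriv ρ y (Module.finBasis ℝ E i)

/-- The Lie derivative of a one-form along a vector field on `E`. -/
def lieDerivE (X : E → E) (η : E → E →L[ℝ] ℝ) (y : E) : E →L[ℝ] ℝ :=
  fderiv ℝ η y (X y) + (η y).comp (fderiv ℝ X y)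

/-- The Courant bracket on `E`:
`[X + ξ, Y + η] = [X, Y] + L_X η - L_Y ξ - d(ι_X η - ι_Y ξ) / 2`. -/
def courantE (u v : E → Gen E) (y : E) : Gen E :=
  (VectorField.lieBracket ℝ (fun z => (u z).1) (fun z => (v z).1) y,
    lieDerivE (fun z => (u z).1) (fun z => (v z).2) y
      - lieDerivE (fun z => (v z).1) (fun z => (u z).2) y
      - (1 / 2 : ℝ) • fderiv ℝ (fun z => (v z).2 (u z).1 - (u z).2 (v z).1) y)

end VectorSpace

section Manifold

variable (E : Type*) [NormedAddCommGroup E] [NormedSpace ℝ E] [FiniteDimensional ℝ E]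
  (M : Type*) [TopologicalSpace M] [ChartedSpace E M]

/-- Sections of `TM ⊕ T*M`. -/
abbrev GenField : Type _ := ∀ x : M, Gen (TangentSpace 𝓘(ℝ, E) x)

/-- Complex differential forms of mixed degree. -/
abbrev FormField : Type _ := ∀ x : M, CForms (TangentSpace 𝓘(ℝ, E) x)

variable {E M}

/-- The derivative at `y ∈ E` of the inverse of the preferred chart at `x`. -/
abbrev chartDeriv (x : M) (y : E) : E →L[ℝ] TangentSpace 𝓘(ℝ, E) ((chartAt E x).symm y) :=
  mfderiv 𝓘(ℝ, E) 𝓘(ℝ, E) (chartAt E x).symm y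

/-- The expression of a section of `TM ⊕ T*M` in the chart at `x`. -/
def genRep (u : GenField E M) (x : M) (y : E) : Gen E :=
  pullGen (chartDeriv x y) (u ((chartAt E x).symm y))

/-- The expression of a differential form in the chart at `x`. -/
def formRep (ρ : FormField E M) (x : M) (y : E) : CForms E :=
  pullForm (chartDeriv x y) (ρ ((chartAt E x).symm y))

/-- A section of `TM ⊕ T*M` is smooth near `x`. -/
def SmoothGenAt (u : GenField E M) (x : M) : Prop :=
  ContDiffAt ℝ ∞ (genRep u x) (chartAt E x x)

/-- A differential form is smooth: its coefficients in charts are. -/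
def SmoothForm (ρ : FormField E M) : Prop :=
  ∀ (x : M) (l : CForms E →ₗ[ℂ] ℂ), ContDiffAt ℝ ∞ (fun y => l (formRep ρ x y)) (chartAt E x x)

/-- The exterior derivative. -/
def extDerivM (ρ : FormField E M) : FormField E M := fun x =>
  pullForm (V := TangentSpace 𝓘(ℝ, E) x) (W := E) (mfderiv 𝓘(ℝ, E) 𝓘(ℝ, E) (chartAt E x) x)
    (extDerivE (formRep ρ x) (chartAt E x x))

/-- The Courant bracket. -/
def courant (u v : GenField E M) : GenField E M := fun x =>
  pullGen (V := TangentSpace 𝓘(ℝ, E) x) (W := E) (mfderiv 𝓘(ℝ, E) 𝓘(ℝ, E) (chartAt E x) x)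
    (courantE (genRep u x) (genRep v x) (chartAt E x x))

variable (E M)

/-- A generalized complex structure: a smooth orthogonal endomorphism `𝒥` of `TM ⊕ T*M` with
`𝒥² = -1` whose `i`-eigenbundle `L ⊂ (TM ⊕ T*M) ⊗ ℂ` is involutive for the (complex bilinear)
Courant bracket.  A complex section is written `a + i b` with real `a`, `b`; it lies in `L` exactly
when `𝒥 a = -b`. -/
structure GCStructure where
  /-- the endomorphism of `TM ⊕ T*M` -/
  J : ∀ x : M, Gen (TangentSpace 𝓘(ℝ, E) x) →ₗ[ℝ] Gen (TangentSpace 𝓘(ℝ, E) x)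
  smooth : ∀ (u : GenField E M) (x : M), SmoothGenAt u x → SmoothGenAt (fun y => J y (u y)) x
  sq : ∀ (x : M) (a : Gen (TangentSpace 𝓘(ℝ, E) x)), J x (J x a) = -a
  orthogonal : ∀ (x : M) (a b : Gen (TangentSpace 𝓘(ℝ, E) x)),
    pairing (J x a) (J x b) = pairing a b
  involutive : ∀ (a b c d : GenField E M) (x : M),
    SmoothGenAt a x → SmoothGenAt b x → SmoothGenAt c x → SmoothGenAt d x →
    (∀ᶠ y in 𝓝 x, J y (a y) = -b y) → (∀ᶠ y in 𝓝 x, J y (c y) = -d y) →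
    J x (courant a c x - courant b d x) = -(courant a d x + courant b c x)

/-- The data of a form `ρ = e^{B + i ω} Ω`, with `B`, `ω` real two-forms and
`Ω = θ¹ ∧ ⋯ ∧ θᵏ` a product of complex one-forms. -/
structure PureForm (k : ℕ) where
  B : ∀ x : M, ⋀[ℝ]^2 (TangentSpace 𝓘(ℝ, E) x →L[ℝ] ℝ)
  omega : ∀ x : M, ⋀[ℝ]^2 (TangentSpace 𝓘(ℝ, E) x →L[ℝ] ℝ)
  θ : Fin k → ∀ x : M, TangentSpace 𝓘(ℝ, E) x →L[ℝ] ℂ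

variable {E M}

namespace PureForm

variable {k : ℕ} (D : PureForm E M k)

/-- `B` as a complex form. -/
def BForm : FormField E M := fun x => complexify (D.B x : RForms (TangentSpace 𝓘(ℝ, E) x))

/-- `ω` as a complex form. -/
def omegaForm : FormField E M := fun x => complexify (D.omega x : RForms (TangentSpace 𝓘(ℝ, E) x))

/-- `Ω = θ¹ ∧ ⋯ ∧ θᵏ`. -/
def Ω : FormField E M := fun x => ExteriorAlgebra.ιMulti ℂ k (fun i => D.θ i x)

/-- The complex conjugate of `Ω`. -/
def Ωbar : FormField E M := fun x => ExteriorAlgebra.ιMulti ℂ k (fun i => conj (D.θ i x))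

/-- `ρ = e^{B + i ω} Ω`. -/
def ρ : FormField E M := fun x => expForm (D.BForm x + Complex.I • D.omegaForm x) * D.Ω x

/-- The forms `B`, `ω`, `θ¹, …, θᵏ` are smooth. -/
def Smooth : Prop :=
  SmoothForm D.BForm ∧ SmoothForm D.omegaForm ∧ ∀ i, SmoothForm (fun x => oneForm (D.θ i x))

/-- `dρ = 0`. -/
def Closed : Prop := ∀ x : M, extDerivM D.ρ x = 0

/-- `ω^{n-k} ∧ Ω ∧ Ω̄ ≠ 0` everywhere, where `2 n` is the dimension and `k ≤ n`. -/
def Nondegenerate : Prop :=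
  ∃ n : ℕ, Module.finrank ℝ E = 2 * n ∧ k ≤ n ∧
    ∀ x : M, D.omegaForm x ^ (n - k) * D.Ω x * D.Ωbar x ≠ 0

end PureForm

/-- The form `ρ` trivializes the canonical line bundle of the generalized complex structure: it
vanishes nowhere and the `i`-eigenbundle is its annihilator, `L = Ann(ρ)`. -/
def GCStructure.Canonical (𝒥 : GCStructure E M) (ρ : FormField E M) : Prop :=
  ∀ x : M, ρ x ≠ 0 ∧ ∀ a b : Gen (TangentSpace 𝓘(ℝ, E) x),
    actC a b (ρ x) = 0 ↔ 𝒥.J x a = -b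

/-- `𝒥` is the generalized Calabi-Yau structure of type `k` given by `ρ = e^{B + i ω} Ω`,
`Ω = θ¹ ∧ ⋯ ∧ θᵏ`: the form is smooth, closed and non-degenerate, and trivializes the canonical bundle. -/
def GCStructure.GivenBy {k : ℕ} (𝒥 : GCStructure E M) (D : PureForm E M k) : Prop :=
  D.Smooth ∧ D.Closed ∧ D.Nondegenerate ∧ 𝒥.Canonical D.ρ

/-- `J` is an (integrable) complex structure: smooth, `J² = -1`, vanishing Nijenhuis tensor. -/
def IsComplexStructure
    (J : ∀ x : M, TangentSpace 𝓘(ℝ, E) x →L[ℝ] TangentSpace 𝓘(ℝ, E) x) : Prop :=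
  (∀ (X : ∀ x : M, TangentSpace 𝓘(ℝ, E) x) (x : M),
    SmoothGenAt (fun y => (X y, 0)) x → SmoothGenAt (fun y => (J y (X y), 0)) x) ∧
  (∀ (x : M) (v : TangentSpace 𝓘(ℝ, E) x), J x (J x v) = -v) ∧
  (∀ (X Y : ∀ x : M, TangentSpace 𝓘(ℝ, E) x) (x : M),
    SmoothGenAt (fun y => (X y, 0)) x → SmoothGenAt (fun y => (Y y, 0)) x →
    VectorField.mlieBracket 𝓘(ℝ, E) (fun y => J y (X y)) (fun y => J y (Y y)) x
      - J x (VectorField.mlieBracket 𝓘(ℝ, E) (fun y => J y (X y)) Y x)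
      - J x (VectorField.mlieBracket 𝓘(ℝ, E) X (fun y => J y (Y y)) x)
      - VectorField.mlieBracket 𝓘(ℝ, E) X Y x = 0)

/-- `𝒥` is the generalized complex structure `(-J, 0; 0, J*)` of a complex structure `J`. -/
def GCStructure.IsOfComplex (𝒥 : GCStructure E M)
    (J : ∀ x : M, TangentSpace 𝓘(ℝ, E) x →L[ℝ] TangentSpace 𝓘(ℝ, E) x) : Prop :=
  IsComplexStructure J ∧
    ∀ (x : M) (a : Gen (TangentSpace 𝓘(ℝ, E) x)), 𝒥.J x a = (-(J x a.1), a.2.comp (J x))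

/-- `𝒥` is the generalized complex structure `(0, -w⁻¹; w, 0)` of a symplectic form `w`, where
`w : TM → T*M` is `X ↦ ι_X w`.  (The upper blocks are determined by the lower ones and `𝒥² = -1`.) -/
def GCStructure.IsOfSymplectic (𝒥 : GCStructure E M)
    (w : ∀ x : M, ⋀[ℝ]^2 (TangentSpace 𝓘(ℝ, E) x →L[ℝ] ℝ)) : Prop :=
  SmoothForm (fun x => complexify (w x : RForms (TangentSpace 𝓘(ℝ, E) x))) ∧
  (∀ x : M, extDerivM (fun y => complexify (w y : RForms (TangentSpace 𝓘(ℝ, E) y))) x = 0) ∧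
  (∀ (x : M) (X : TangentSpace 𝓘(ℝ, E) x),
    interior X (complexify (w x : RForms (TangentSpace 𝓘(ℝ, E) x))) = 0 → X = 0) ∧
  ∀ (x : M) (X : TangentSpace 𝓘(ℝ, E) x), (𝒥.J x (X, 0)).1 = 0 ∧
    oneForm (toComplex (𝒥.J x (X, 0)).2) =
      interior X (complexify (w x : RForms (TangentSpace 𝓘(ℝ, E) x)))

end Manifold

end GCGeom

/-! ## The groups and the nilmanifolds -/

/-- The simply connected nilpotent Lie group `G_α`, whose underlying manifold is `ℝ⁸`. -/
def NilGroup (_α : ℝ) : Type := Fin 8 → ℝ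

namespace NilGroup

variable {α : ℝ}

/-- The group law of `G_α` in global coordinates. -/
def mulVec (α : ℝ) (g y : Fin 8 → ℝ) : Fin 8 → ℝ :=
  ![g 0 + y 0,
    g 1 + y 1,
    g 2 + y 2,
    g 3 + y 3,
    g 4 + y 4 - g 0 * y 1,
    g 5 + y 5 - g 0 * y 4 + g 0 ^ 2 / 2 * y 1 - (1 - α) * g 1 * y 3,
    g 6 + y 6 + (1 + α) * g 0 * y 3 + g 1 * y 2 - (1 + α) * g 1 * y 4
      + (1 + α) * g 0 * (g 1 * y 1 + y 1 ^ 2 / 2),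
    g 7 + y 7 - g 0 * y 5 - g 1 * y 6 + (g 0 ^ 2 / 2 + (1 + α) * g 1 ^ 2 / 2 + 2 * g 3) * y 4
      - g 1 ^ 2 / 2 * y 2 - (g 2 + (1 + α) * g 0 * g 1) * y 3 - 2 * g 0 * y 1 * y 3
      - g 0 ^ 3 / 6 * y 1 - 2 * g 0 * g 3 * y 1
      - (1 + α) / 6 * g 0 * (3 * g 1 ^ 2 * y 1 + 3 * g 1 * y 1 ^ 2 + y 1 ^ 3)]

/-- Inversion in `G_α`. -/
def invVec (α : ℝ) (g : Fin 8 → ℝ) : Fin 8 → ℝ :=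
  ![-g 0, -g 1, -g 2, -g 3,
    -g 4 - g 0 * g 1,
    -g 5 - g 0 * g 4 - g 0 ^ 2 * g 1 / 2 - (1 - α) * g 1 * g 3,
    -g 6 + (1 + α) * g 0 * g 3 + g 1 * g 2 - (1 + α) * g 1 * g 4 - (1 + α) * g 0 * g 1 ^ 2 / 2,
    -g 7 - g 0 * g 5 - g 1 * g 6 - g 0 ^ 2 * g 4 / 2 - (1 + α) * g 1 ^ 2 * g 4 / 2
      + 2 * g 3 * g 4 - g 2 * g 3 + g 1 ^ 2 * g 2 / 2
      + (1 + α) * g 0 * g 1 * g 3 - g 0 ^ 3 * g 1 / 6 - (1 + α) * g 0 * g 1 ^ 3 / 6]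

instance : TopologicalSpace (NilGroup α) := inferInstanceAs (TopologicalSpace (Fin 8 → ℝ))
instance : T2Space (NilGroup α) := inferInstanceAs (T2Space (Fin 8 → ℝ))
instance : LocallyCompactSpace (NilGroup α) := inferInstanceAs (LocallyCompactSpace (Fin 8 → ℝ))
instance : ChartedSpace (Fin 8 → ℝ) (NilGroup α) :=
  inferInstanceAs (ChartedSpace (Fin 8 → ℝ) (Fin 8 → ℝ))
instance : IsManifold 𝓘(ℝ, Fin 8 → ℝ) ∞ (NilGroup α) :=
  inferInstanceAs (IsManifold 𝓘(ℝ, Fin 8 → ℝ) ∞ (Fin 8 → ℝ))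

/-- `G_α` is contractible, hence connected and simply connected. -/
instance : ContractibleSpace (NilGroup α) := inferInstanceAs (ContractibleSpace (Fin 8 → ℝ))

instance : Mul (NilGroup α) := ⟨mulVec α⟩
instance : One (NilGroup α) := ⟨fun _ => 0⟩
instance : Inv (NilGroup α) := ⟨invVec α⟩

instance : Group (NilGroup α) :=
  Group.ofLeftAxioms
    (fun a b c => by
      change mulVec α (mulVec α a b) c = mulVec α a (mulVec α b c)
      ext i; fin_cases i <;> simp [mulVec] <;> ring)
    (fun a => by
      change mulVec α (fun _ => 0) a = a
      ext i; fin_cases i <;> simp [mulVec])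
    (fun a => by
      change mulVec α (invVec α a) a = fun _ => 0
      ext i; fin_cases i <;> simp [mulVec, invVec] <;> ring)

lemma contDiff_mulVec : ContDiff ℝ ∞ (fun p : (Fin 8 → ℝ) × (Fin 8 → ℝ) => mulVec α p.1 p.2) := by
  rw [contDiff_pi]
  intro i
  fin_cases i <;> simp [mulVec] <;> fun_prop

lemma contDiff_invVec : ContDiff ℝ ∞ (invVec α) := by
  rw [contDiff_pi]
  intro i
  fin_cases i <;> simp [invVec] <;> fun_prop

instance : LieGroup 𝓘(ℝ, Fin 8 → ℝ) ∞ (NilGroup α) where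
  contMDiff_mul := by
    have h := (contDiff_mulVec (α := α)).contMDiff
    rw [modelWithCornersSelf_prod, ← chartedSpaceSelf_prod] at h
    exact h
  contMDiff_inv := (contDiff_invVec (α := α)).contMDiff

instance : IsTopologicalGroup (NilGroup α) :=
  topologicalGroup_of_lieGroup 𝓘(ℝ, Fin 8 → ℝ) ∞

/-- A vector of coordinates seen as an element of `G_α`. -/
def ofVec (y : Fin 8 → ℝ) : NilGroup α := y

lemma mul_def (a b : NilGroup α) : a * b = mulVec α a b := rfl
lemma inv_def (a : NilGroup α) : a⁻¹ = invVec α a := rfl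

lemma mulVec_comm_of_zero (x g : Fin 8 → ℝ) (j : Fin 8) (h : ∀ k, k < j → x k = 0) :
    mulVec α x g j = mulVec α g x j := by
  fin_cases j <;> simp [Fin.forall_fin_succ] at h <;> simp [mulVec, *] <;> ring

lemma mulVec_congr_left (p q y : Fin 8 → ℝ) (i : Fin 8) (h : ∀ j, j ≤ i → p j = q j) :
    mulVec α p y i = mulVec α q y i := by
  fin_cases i <;> simp [Fin.forall_fin_succ] at h <;> simp [mulVec, *]

/-- `G_α` is nilpotent. -/
instance : Group.IsNilpotent (NilGroup α) := by
  let c : ℕ → ℕ := fun n => 8 - n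
  let H : ℕ → Subgroup (NilGroup α) := fun n =>
    { carrier := {g | ∀ i : Fin 8, i.val < c n → (g : Fin 8 → ℝ) i = 0}
      one_mem' := fun i _ => rfl
      mul_mem' := by
        intro a b ha hb i hi
        have ha' : ∀ j : Fin 8, j ≤ i → (a : Fin 8 → ℝ) j = 0 := fun j hj =>
          ha j (lt_of_le_of_lt (by exact_mod_cast hj) hi)
        have hb' : ∀ j : Fin 8, j ≤ i → (b : Fin 8 → ℝ) j = 0 := fun j hj =>
          hb j (lt_of_le_of_lt (by exact_mod_cast hj) hi)
        rw [mul_def]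
        clear ha hb hi
        fin_cases i <;> simp [Fin.forall_fin_succ] at ha' hb' <;> simp [mulVec, *]
      inv_mem' := by
        intro a ha i hi
        have ha' : ∀ j : Fin 8, j ≤ i → (a : Fin 8 → ℝ) j = 0 := fun j hj =>
          ha j (lt_of_le_of_lt (by exact_mod_cast hj) hi)
        rw [inv_def]
        clear ha hi
        fin_cases i <;> simp [Fin.forall_fin_succ] at ha' <;> simp [invVec, *] }
  refine (Subgroup.nilpotent_iff_finite_ascending_central_series (NilGroup α)).2
    ⟨8, H, ⟨?_, ?_⟩, ?_⟩
  · ext g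
    constructor
    · intro h
      exact Subgroup.mem_bot.2 (funext fun i => h i i.2)
    · intro h i _
      rw [Subgroup.mem_bot.1 h]; rfl
  · intro x n hx g i hi
    have hx' : ∀ j : Fin 8, j < i → (x : Fin 8 → ℝ) j = 0 := fun j hj => by
      refine hx j ?_
      have : j.val < i.val := hj
      simp only [c] at hi ⊢
      omega
    have hcomm : ∀ j : Fin 8, j ≤ i → mulVec α x g j = mulVec α g x j := fun j hj =>
      mulVec_comm_of_zero x g j fun k hk => hx' k (lt_of_lt_of_le hk hj)
    have hdep := mulVec_congr_left (α := α) _ _ (invVec α (mulVec α g x)) i hcomm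
    have hone : mulVec α (mulVec α g x) (invVec α (mulVec α g x)) i = 0 := by
      change ((g * x) * (g * x)⁻¹ : NilGroup α) i = 0
      rw [mul_inv_cancel]; rfl
    have hc : x * g * x⁻¹ * g⁻¹ = (x * g) * (g * x)⁻¹ := by group
    rw [commutatorElement_def, hc]
    exact hdep.trans hone
  · ext g
    simp [H, c]

instance properlyDiscontinuous (Γ : Subgroup (NilGroup α)) [DiscreteTopology Γ] :
    ProperlyDiscontinuousSMul Γ (NilGroup α) := by
  exact Γ.properlyDiscontinuousSMul_of_tendsto_cofinite
    (Γ.tendsto_coe_cofinite_of_discrete (isDiscrete_iff_discreteTopology.mpr inferInstance))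

end NilGroup

/-- The quotient `Γ \ G_α` by the left translations of a subgroup `Γ`. -/
abbrev Nilmanifold (α : ℝ) (Γ : Subgroup (NilGroup α)) : Type :=
  MulAction.orbitRel.Quotient Γ (NilGroup α)

namespace Nilmanifold

variable {α : ℝ} {Γ : Subgroup (NilGroup α)}

/-- The projection `G_α → Γ \ G_α`. -/
def proj (Γ : Subgroup (NilGroup α)) (g : NilGroup α) : Nilmanifold α Γ := Quotient.mk _ g

lemma proj_smul (γ : Γ) (g : NilGroup α) : proj Γ (γ • g) = proj Γ g :=
  Quotient.sound ⟨γ, rfl⟩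

lemma proj_eq_iff {g h : NilGroup α} : proj Γ g = proj Γ h ↔ ∃ γ : Γ, γ • h = g := by
  constructor
  · intro e; exact Quotient.exact e
  · rintro ⟨γ, rfl⟩; exact proj_smul γ h

variable [DiscreteTopology Γ]

lemma isLocalHomeomorph_proj : IsLocalHomeomorph (proj Γ) :=
  (isQuotientCoveringMap_quotientMk_of_properlyDiscontinuousSMul
    (G := Γ) (E := NilGroup α)).isCoveringMap.isLocalHomeomorph

lemma symm_of_mem_atlas (e : OpenPartialHomeomorph (Nilmanifold α Γ) (Fin 8 → ℝ))
    (he : e ∈ atlas (Fin 8 → ℝ) (Nilmanifold α Γ)) (y : Fin 8 → ℝ) :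
    e.symm y = proj Γ (NilGroup.ofVec y) := by
  obtain ⟨q, rfl⟩ := he
  exact congrFun ((isLocalHomeomorph_proj (Γ := Γ)).localInverseAt_symm _) _

/-- The quotient by a discrete subgroup is a smooth manifold: the changes of charts are locally left
translations by elements of `Γ`. -/
instance : IsManifold 𝓘(ℝ, Fin 8 → ℝ) ∞ (Nilmanifold α Γ) := by
  refine isManifold_of_contDiffOn 𝓘(ℝ, Fin 8 → ℝ) ∞ _ ?_
  intro e e' he he'
  simp only [modelWithCornersSelf_coe, modelWithCornersSelf_coe_symm, Set.range_id,
    Set.preimage_id, Set.inter_univ, Function.comp_id, Function.id_comp]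
  intro y hy
  have hy2 : e.symm y ∈ e'.source := hy.2
  have h1 : proj Γ (NilGroup.ofVec (e' (e.symm y))) = proj Γ (NilGroup.ofVec y) := by
    rw [← symm_of_mem_atlas e' he', ← symm_of_mem_atlas e he]
    exact e'.left_inv hy2
  obtain ⟨γ, hγ⟩ := proj_eq_iff.1 h1
  have hγ' : NilGroup.mulVec α (γ : NilGroup α) y = e' (e.symm y) := hγ
  have hsm : ContDiff ℝ ∞ (fun z => NilGroup.mulVec α (γ : NilGroup α) z) :=
    (NilGroup.contDiff_mulVec (α := α)).comp (contDiff_const.prodMk contDiff_id)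
  have hmem : NilGroup.mulVec α (γ : NilGroup α) y ∈ e'.target := by
    rw [hγ']; exact e'.map_source hy2
  have hnear : ∀ᶠ z in 𝓝 y, NilGroup.mulVec α (γ : NilGroup α) z ∈ e'.target :=
    hsm.continuous.continuousAt.eventually (e'.open_target.mem_nhds hmem)
  have heq : (fun z => e' (e.symm z)) =ᶠ[𝓝 y]
      fun z => NilGroup.mulVec α (γ : NilGroup α) z := by
    filter_upwards [hnear] with z hz
    have h4 : e.symm z = e'.symm (NilGroup.mulVec α (γ : NilGroup α) z) := by
      rw [symm_of_mem_atlas e he, symm_of_mem_atlas e' he']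
      exact (proj_smul γ (NilGroup.ofVec z)).symm
    rw [h4]
    exact e'.right_inv hz
  exact (hsm.contDiffAt.congr_of_eventuallyEq heq).contDiffWithinAt

section Invariant

open GCGeom

/-- A one-form on `Γ \ G_α` is invariant: its pull-back to `G_α` is left-invariant. -/
def InvariantOneForm (η : ∀ x : Nilmanifold α Γ, TangentSpace 𝓘(ℝ, Fin 8 → ℝ) x →L[ℝ] ℝ) : Prop :=
  ∀ g h : NilGroup α,
    (η (proj Γ (g * h))).comp
        (mfderiv 𝓘(ℝ, Fin 8 → ℝ) 𝓘(ℝ, Fin 8 → ℝ) (fun k : NilGroup α => proj Γ (g * k)) h) =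
      (η (proj Γ h)).comp (mfderiv 𝓘(ℝ, Fin 8 → ℝ) 𝓘(ℝ, Fin 8 → ℝ) (proj Γ) h)

/-- A differential form on `Γ \ G_α` is invariant: its pull-back to `G_α` is left-invariant. -/
def InvariantForm (ρ : FormField (Fin 8 → ℝ) (Nilmanifold α Γ)) : Prop :=
  ∀ g h : NilGroup α,
    pullForm (mfderiv 𝓘(ℝ, Fin 8 → ℝ) 𝓘(ℝ, Fin 8 → ℝ) (fun k : NilGroup α => proj Γ (g * k)) h)
        (ρ (proj Γ (g * h))) =
      pullForm (mfderiv 𝓘(ℝ, Fin 8 → ℝ) 𝓘(ℝ, Fin 8 → ℝ) (proj Γ) h) (ρ (proj Γ h))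

/-- A generalized complex structure on `Γ \ G_α` is invariant: its pull-back to `G_α` commutes with
left translations. -/
def InvariantGC (𝒥 : GCStructure (Fin 8 → ℝ) (Nilmanifold α Γ)) : Prop :=
  ∀ (g h : NilGroup α) (a : Gen (TangentSpace 𝓘(ℝ, Fin 8 → ℝ) (proj Γ (g * h))))
    (b : Gen (TangentSpace 𝓘(ℝ, Fin 8 → ℝ) (proj Γ h))),
    pullGen (mfderiv 𝓘(ℝ, Fin 8 → ℝ) 𝓘(ℝ, Fin 8 → ℝ) (fun k : NilGroup α => proj Γ (g * k)) h) a =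
      pullGen (mfderiv 𝓘(ℝ, Fin 8 → ℝ) 𝓘(ℝ, Fin 8 → ℝ) (proj Γ) h) b →
    pullGen (mfderiv 𝓘(ℝ, Fin 8 → ℝ) 𝓘(ℝ, Fin 8 → ℝ) (fun k : NilGroup α => proj Γ (g * k)) h)
        (𝒥.J _ a) =
      pullGen (mfderiv 𝓘(ℝ, Fin 8 → ℝ) 𝓘(ℝ, Fin 8 → ℝ) (proj Γ) h) (𝒥.J _ b)

/-- `𝒥` is an invariant generalized complex structure of type `k` on `Γ \ G_α`, given by the closed
pure form `ρ = e^{B + i ω} Ω` with `B`, `ω` and the factors of `Ω` invariant. -/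
def InvariantGivenBy {k : ℕ} (𝒥 : GCStructure (Fin 8 → ℝ) (Nilmanifold α Γ))
    (D : PureForm (Fin 8 → ℝ) (Nilmanifold α Γ) k) : Prop :=
  InvariantGC 𝒥 ∧ InvariantForm D.BForm ∧ InvariantForm D.omegaForm ∧
    (∀ i, InvariantForm (fun x => oneForm (D.θ i x))) ∧ 𝒥.GivenBy D

/-- `e` (indexed from zero) is the global frame of invariant one-forms on `Γ \ G_α` which, pulled
back to the identity of `G_α = ℝ⁸`, gives the eight coordinates. -/
def IsInvariantCoframe
    (e : Fin 8 → ∀ x : Nilmanifold α Γ, TangentSpace 𝓘(ℝ, Fin 8 → ℝ) x →L[ℝ] ℝ) : Prop :=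
  (∀ i, InvariantOneForm (e i)) ∧
  ∀ (i : Fin 8) (v : Fin 8 → ℝ),
    e i (proj Γ 1) (mfderiv 𝓘(ℝ, Fin 8 → ℝ) 𝓘(ℝ, Fin 8 → ℝ) (proj Γ) (1 : NilGroup α) v) = v i

/-- The structure equations of `G_α`, for the forms `e¹, …, e⁸` (that is `e 0, …, e 7`). -/
def StructureEquations
    (e : Fin 8 → ∀ x : Nilmanifold α Γ, TangentSpace 𝓘(ℝ, Fin 8 → ℝ) x →L[ℝ] ℝ) : Prop :=
  let c : Fin 8 → FormField (Fin 8 → ℝ) (Nilmanifold α Γ) :=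
    fun i x => oneForm (toComplex (e i x))
  let d : Fin 8 → FormField (Fin 8 → ℝ) (Nilmanifold α Γ) := fun i => extDerivM (c i)
  let β : ℂ := ((1 + α : ℝ) : ℂ)
  ∀ x, d 0 x = 0 ∧ d 1 x = 0 ∧ d 2 x = 0 ∧ d 3 x = 0 ∧
    d 4 x = c 0 x * c 1 x ∧
    d 5 x = c 0 x * c 4 x + ((1 - α : ℝ) : ℂ) • (c 1 x * c 3 x) ∧
    d 6 x = -(β • (c 0 x * c 3 x)) - c 1 x * c 2 x + β • (c 1 x * c 4 x) ∧
    d 7 x = c 0 x * c 5 x + c 1 x * c 6 x + c 2 x * c 3 x - (2 : ℂ) • (c 3 x * c 4 x)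

end Invariant

end Nilmanifold

section ExplicitForms

open GCGeom

variable {V : Type*} [AddCommGroup V] [Module ℝ V] [TopologicalSpace V]

/-- The complex one-forms `θ¹, θ², θ³, θ⁴` in terms of the coframe `e¹, …, e⁸` (that is
`e 0, …, e 7`). -/
def theta (α : ℝ) (e : Fin 8 → V →L[ℝ] ℝ) : Fin 4 → V →L[ℝ] ℂ :=
  let c : Fin 8 → V →L[ℝ] ℂ := fun i => toComplex (e i)
  let s : ℂ := ((1 / √(3 + α) : ℝ) : ℂ)
  let A : ℂ := (α : ℂ)
  ![(1 / 2 : ℂ) • (s • c 0 - c 1) + (Complex.I / 2) • (s • c 0 + c 1),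
    -(A • c 3) - (Complex.I * s) • ((1 / 2 : ℂ) • c 2 + c 4),
    (A / (1 + A) ^ 2) • (c 5 - s • c 6) + (Complex.I * A / (1 + A) ^ 2) • (c 5 + s • c 6),
    s • (c 4 + ((1 - A) / (2 * (1 + A) ^ 2)) • c 2)
      - (Complex.I * A) • (c 3 + (2 / (1 + A) ^ 2 * s) • c 7)]

/-- The real two-form with twelve coefficients, in terms of the coframe `e¹, …, e⁸` (that is
`e 0, …, e 7`). -/
def twoForm (α : ℝ) (e : Fin 8 → V →L[ℝ] ℝ)
    (x12 x13 x14 x15 x16 x17 x23 x24 x25 x27 x34 x37 : ℝ) : RForms V :=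
  let w : Fin 8 → Fin 8 → RForms V :=
    fun i j => ExteriorAlgebra.ι ℝ (e i) * ExteriorAlgebra.ι ℝ (e j)
  x12 • w 0 1 + x13 • w 0 2 + x14 • w 0 3 + x15 • w 0 4 + x16 • w 0 5 + x17 • w 0 6
    - ((1 + α) * x37) • w 0 7 + x23 • w 1 2 + x24 • w 1 3 + x25 • w 1 4
    + ((1 + α) * x17) • w 1 5 + x27 • w 1 6 + x34 • w 2 3 + x17 • w 2 4 + x37 • w 2 6
    - ((1 - α) * x16 + (1 + α) * x27) • w 3 4 + ((1 + α) * (3 + α) * x37) • w 3 5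
    - ((1 + α) * x37) • w 4 6

end ExplicitForms

end

/-! Everything invariant is determined by its value at the identity. The left-invariant coframe is a
matrix polynomial in the coordinates of ℝ⁸; its left-invariance (`coframe_mulVec`) makes it descend
to a trivialization `frame` of the tangent bundle of Γ\G_α (`frame_comp_dproj`). The inverse of
every chart is the projection, so in each chart an invariant form is a fixed element of ⋀•(ℝ⁸)*
pulled back along the coframe. Smoothness is then that of a polynomial matrix, and the exterior
derivative becomes the Lie algebra differential, recorded by `HasInvDeriv`; `hasInvDeriv_ε` is the
verification of the structure equations.

The passage from a form to a generalized complex structure has a linear and a differential part.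
Linearly, if ω^{n-k} ∧ Ω ∧ Ω̄ ≠ 0, no nonzero real generalized vector kills ρ = e^{B+iω}Ω, while the
complex annihilator of ρ has real dimension at least 4n. Hence it is the graph of an endomorphism,
which squares to -1 because the annihilator is a complex subspace and is orthogonal because the
Clifford relations make the annihilator isotropic (`NondegenerateAt.exists_structure`).
Differentially, the Dorfman bracket is the derived bracket of d under the Clifford action
(`actL_dorfman`). It differs from the Courant bracket by an exact term which disappears on isotropic
sections, so dρ = 0 makes Ann(ρ) involutive (`actC_courantE`). Together, `exists_invariantGivenBy`
reduces each type to two statements at the identity: non-degeneracy and closedness.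

For types 4, 3 and 2 the reason is triangularity: dθ^j lies in the ideal generated by θ¹, …,
θ^{j-1}, and the differential of the conjugate of θ⁴ lies in the ideal of θ¹, θ², θ³. Since d(e^C Ω)
= 0 as soon as dΩ = 0 and dC ∧ Ω = 0, every term to be killed contains a repeated factor.
Non-degeneracy follows from the independence of the θ^j and their conjugates. For types 1 and 0, ω_x
is closed, and the relevant power of ω_x is shown to be nonzero by contracting with well-chosen
basis vectors one at a time (`pow_mul_interior_eq_zero`), each contraction leaving a single term
with nonzero coefficient.

The lattice consists of the points whose coordinates are multiples of 6d, where d clears the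
denominator of α: the factor 6 absorbs the denominators in the group law, and triangularity of the
group law gives a compact fundamental cube. -/

noncomputable section

set_option linter.unusedSectionVars false
set_option linter.unusedSimpArgs false

/-! ### The Clifford action of V ⊕ V* on complex forms -/

namespace GCGeom

section Algebra

variable {V W : Type*} [AddCommGroup V] [Module ℝ V] [TopologicalSpace V]
  [AddCommGroup W] [Module ℝ W] [TopologicalSpace W]

/-- Evaluation of complex covectors at a real vector. -/
def evalC (X : V) : Module.Dual ℂ (V →L[ℝ] ℂ) where
  toFun θ := θ X
  map_add' _ _ := rfl
  map_smul' _ _ := rfl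

/-- Precomposition of complex covectors with a linear map. -/
def precompC (D : V →L[ℝ] W) : (W →L[ℝ] ℂ) →ₗ[ℂ] (V →L[ℝ] ℂ) where
  toFun θ := θ.comp D
  map_add' _ _ := rfl
  map_smul' _ _ := rfl

lemma interior_eq (X : V) (ρ : CForms V) :
    interior X ρ = CliffordAlgebra.contractLeft (evalC X) ρ := rfl

lemma pullForm_eq (D : V →L[ℝ] W) : pullForm D = ExteriorAlgebra.map (precompC D) := rfl

@[simp] lemma pullForm_oneForm (D : V →L[ℝ] W) (θ : W →L[ℝ] ℂ) :
    pullForm D (oneForm θ) = oneForm (θ.comp D) :=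
  ExteriorAlgebra.map_apply_ι _ _

lemma pullForm_ιMulti (D : V →L[ℝ] W) {k : ℕ} (θ : Fin k → W →L[ℝ] ℂ) :
    pullForm D (ExteriorAlgebra.ιMulti ℂ k θ) =
      ExteriorAlgebra.ιMulti ℂ k (fun i => (θ i).comp D) :=
  ExteriorAlgebra.map_apply_ιMulti _ _

lemma pullForm_id (ρ : CForms V) : pullForm (ContinuousLinearMap.id ℝ V) ρ = ρ := by
  have : precompC (ContinuousLinearMap.id ℝ V) = LinearMap.id := rfl
  rw [pullForm_eq, this, ExteriorAlgebra.map_id]; rfl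

lemma pullForm_comp {U : Type*} [AddCommGroup U] [Module ℝ U] [TopologicalSpace U]
    (D : V →L[ℝ] W) (D' : U →L[ℝ] V) (ρ : CForms W) :
    pullForm (D.comp D') ρ = pullForm D' (pullForm D ρ) := by
  rw [pullForm_eq, pullForm_eq, pullForm_eq, ← AlgHom.comp_apply, ExteriorAlgebra.map_comp_map]
  rfl

lemma interior_add (X : V) (ρ σ : CForms V) : interior X (ρ + σ) = interior X ρ + interior X σ :=
  map_add _ _ _

lemma interior_sub (X : V) (ρ σ : CForms V) : interior X (ρ - σ) = interior X ρ - interior X σ :=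
  map_sub _ _ _

@[simp] lemma interior_zero (X : V) : interior X (0 : CForms V) = 0 := map_zero _

lemma interior_smul (X : V) (c : ℂ) (ρ : CForms V) : interior X (c • ρ) = c • interior X ρ :=
  map_smul _ _ _

lemma evalC_add (X Y : V) : evalC (X + Y) = evalC X + evalC Y := by
  ext θ; exact map_add θ X Y

lemma evalC_smul (r : ℝ) (X : V) : evalC (r • X) = (r : ℂ) • evalC X := by
  ext θ
  change θ (r • X) = (r : ℂ) • θ X
  rw [map_smul]; rfl

lemma interior_smul_left (r : ℝ) (X : V) (ρ : CForms V) :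
    interior (r • X) ρ = (r : ℂ) • interior X ρ := by
  simp only [interior_eq, evalC_smul, map_smul, LinearMap.smul_apply]

lemma interior_oneForm_mul (X : V) (θ : V →L[ℝ] ℂ) (ρ : CForms V) :
    interior X (oneForm θ * ρ) = θ X • ρ - oneForm θ * interior X ρ :=
  CliffordAlgebra.contractLeft_ι_mul (d := evalC X) θ ρ

@[simp] lemma interior_oneForm (X : V) (θ : V →L[ℝ] ℂ) :
    interior X (oneForm θ) = algebraMap ℂ _ (θ X) :=
  CliffordAlgebra.contractLeft_ι _ (evalC X) θ

@[simp] lemma interior_algebraMap (X : V) (c : ℂ) :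
    interior X (algebraMap ℂ (CForms V) c) = 0 :=
  CliffordAlgebra.contractLeft_algebraMap _ (evalC X) c

@[simp] lemma interior_one (X : V) : interior X (1 : CForms V) = 0 :=
  CliffordAlgebra.contractLeft_one _ (evalC X)

/-- The grade involution. -/
abbrev invo : CForms V →ₐ[ℂ] CForms V :=
  CliffordAlgebra.involute (Q := (0 : QuadraticForm ℂ (V →L[ℝ] ℂ)))

@[simp] lemma invo_oneForm (θ : V →L[ℝ] ℂ) : invo (oneForm θ) = -oneForm θ :=
  CliffordAlgebra.involute_ι _

/-- Contraction is an antiderivation. The second factor stays general in the induction because the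
product case applies the hypothesis for `a` to `b * σ`. -/
lemma contractLeft_mul (d : Module.Dual ℂ (V →L[ℝ] ℂ)) (ρ σ : CForms V) :
    CliffordAlgebra.contractLeft d (ρ * σ) =
      CliffordAlgebra.contractLeft d ρ * σ + invo ρ * CliffordAlgebra.contractLeft d σ := by
  induction ρ using ExteriorAlgebra.induction generalizing σ with
  | algebraMap c =>
    have h := CliffordAlgebra.contractLeft_algebraMap (0 : QuadraticForm ℂ (V →L[ℝ] ℂ)) d c
    have h' : CliffordAlgebra.contractLeft d (algebraMap ℂ (CForms V) c) = 0 := h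
    rw [h', AlgHom.commutes, zero_mul, zero_add, ← Algebra.smul_def,
      ← Algebra.smul_def, map_smul]
  | ι θ =>
    have h1 : CliffordAlgebra.contractLeft d (oneForm θ * σ) = d θ • σ - oneForm θ *
        CliffordAlgebra.contractLeft d σ := CliffordAlgebra.contractLeft_ι_mul (d := d) θ σ
    have h2 : CliffordAlgebra.contractLeft d (oneForm θ) = algebraMap ℂ (CForms V) (d θ) :=
      CliffordAlgebra.contractLeft_ι _ d θ
    rw [h1, h2, invo_oneForm, Algebra.smul_def]
    noncomm_ring
  | mul a b ha hb =>
    rw [mul_assoc, ha, hb, ha, map_mul]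
    noncomm_ring
  | add a b ha hb =>
    rw [add_mul, map_add, ha, hb, map_add, map_add]
    noncomm_ring

lemma interior_mul (X : V) (ρ σ : CForms V) :
    interior X (ρ * σ) = interior X ρ * σ + invo ρ * interior X σ :=
  contractLeft_mul _ _ _

lemma oneForm_mul_eq (θ : V →L[ℝ] ℂ) (ρ : CForms V) :
    oneForm θ * ρ = invo ρ * oneForm θ := by
  induction ρ using ExteriorAlgebra.induction with
  | algebraMap c => rw [AlgHom.commutes, Algebra.commutes]
  | ι η =>
    have h := ExteriorAlgebra.ι_add_mul_swap (R := ℂ) θ η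
    have h2 : invo (ExteriorAlgebra.ι ℂ η : CForms V) = - ExteriorAlgebra.ι ℂ η := invo_oneForm η
    rw [h2, neg_mul]
    exact eq_neg_of_add_eq_zero_left h
  | mul a b ha hb => rw [← mul_assoc, ha, mul_assoc, hb, map_mul, mul_assoc]
  | add a b ha hb => rw [mul_add, ha, hb, map_add, add_mul]

@[simp] lemma oneForm_sq (θ : V →L[ℝ] ℂ) : oneForm θ * oneForm θ = 0 :=
  ExteriorAlgebra.ι_sq_zero θ

lemma oneForm_swap (θ η : V →L[ℝ] ℂ) : oneForm θ * oneForm η = -(oneForm η * oneForm θ) :=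
  eq_neg_of_add_eq_zero_left (ExteriorAlgebra.ι_add_mul_swap θ η)

lemma toComplex_add (ξ η : V →L[ℝ] ℝ) : toComplex (ξ + η) = toComplex ξ + toComplex η := by
  ext v; simp [toComplex]

lemma toComplex_smul (r : ℝ) (ξ : V →L[ℝ] ℝ) : toComplex (r • ξ) = (r : ℂ) • toComplex ξ := by
  ext v; simp [toComplex]

@[simp] lemma toComplex_apply (ξ : V →L[ℝ] ℝ) (v : V) : toComplex ξ v = (ξ v : ℂ) := rfl

@[simp] lemma toComplex_zero : toComplex (0 : V →L[ℝ] ℝ) = 0 := by ext v; simp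

@[simp] lemma conj_apply (θ : V →L[ℝ] ℂ) (v : V) : conj θ v = (starRingEnd ℂ) (θ v) := rfl

/-- Multiplication by a covector, as a linear operator on forms. -/
def wedgeL (θ : V →L[ℝ] ℂ) : Module.End ℂ (CForms V) := LinearMap.mulLeft ℂ (oneForm θ)

/-- The Clifford action of a generalized vector, as a linear operator on forms. -/
def actL (a : Gen V) : Module.End ℂ (CForms V) :=
  CliffordAlgebra.contractLeft (evalC a.1) + wedgeL (toComplex a.2)

@[simp] lemma wedgeL_apply (θ : V →L[ℝ] ℂ) (ρ : CForms V) : wedgeL θ ρ = oneForm θ * ρ := rfl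

lemma wedgeL_add (θ η : V →L[ℝ] ℂ) : wedgeL (θ + η) = wedgeL θ + wedgeL η := by
  refine LinearMap.ext fun ρ => ?_
  simp [add_mul]

lemma wedgeL_smul (c : ℂ) (θ : V →L[ℝ] ℂ) : wedgeL (c • θ) = c • wedgeL θ := by
  refine LinearMap.ext fun ρ => ?_
  simp

lemma actL_add (a b : Gen V) : actL (a + b) = actL a + actL b := by
  rw [actL, Prod.fst_add, Prod.snd_add, evalC_add, toComplex_add, wedgeL_add, map_add, actL, actL]
  abel

lemma actL_smul (r : ℝ) (a : Gen V) : actL (r • a) = (r : ℂ) • actL a := by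
  rw [actL, Prod.smul_fst, Prod.smul_snd, evalC_smul, toComplex_smul, wedgeL_smul, map_smul, actL,
    smul_add]

lemma actL_neg (a : Gen V) : actL (-a) = -actL a := by
  have h1 : (-1 : ℝ) • a = -a := neg_one_smul ℝ a
  have h2 := actL_smul (-1) a
  rw [h1] at h2
  rw [h2, Complex.ofReal_neg, Complex.ofReal_one]
  exact neg_one_smul ℂ (actL a)

lemma actL_sub (a b : Gen V) : actL (a - b) = actL a - actL b := by
  rw [sub_eq_add_neg, actL_add, actL_neg, sub_eq_add_neg]

/-- The mixed Clifford relation, with θ complex so that it serves both for the factors of Ω and for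
the basis covectors in the derived bracket formula. -/
lemma wedgeL_mul_actL (θ : V →L[ℝ] ℂ) (a : Gen V) :
    wedgeL θ * actL a + actL a * wedgeL θ = θ a.1 • (1 : Module.End ℂ (CForms V)) := by
  refine LinearMap.ext fun ρ => ?_
  change oneForm θ * act a ρ + act a (oneForm θ * ρ) = θ a.1 • ρ
  rw [act, act, interior_oneForm_mul, mul_add, ← mul_assoc, ← mul_assoc,
    oneForm_swap θ (toComplex a.2)]
  noncomm_ring

/-- The Clifford relation of V ⊕ V*: contractions anticommute, covectors anticommute, and the two
mixed anticommutators add up to twice the pairing. Isotropy of annihilators rests on it. -/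
lemma actL_mul_actL (a b : Gen V) :
    actL a * actL b + actL b * actL a =
      ((2 * pairing a b : ℝ) : ℂ) • (1 : Module.End ℂ (CForms V)) := by
  have h1 := wedgeL_mul_actL (toComplex b.2) a
  have h2 := wedgeL_mul_actL (toComplex a.2) b
  have h3 : wedgeL (toComplex a.2) * wedgeL (toComplex b.2)
      + wedgeL (toComplex b.2) * wedgeL (toComplex a.2) = (0 : Module.End ℂ (CForms V)) := by
    refine LinearMap.ext fun ρ => ?_
    change oneForm (toComplex a.2) * (oneForm (toComplex b.2) * ρ) +
      oneForm (toComplex b.2) * (oneForm (toComplex a.2) * ρ) = 0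
    rw [← mul_assoc, ← mul_assoc, oneForm_swap]
    noncomm_ring
  have h4 : (CliffordAlgebra.contractLeft (evalC a.1) : Module.End ℂ (CForms V))
      * CliffordAlgebra.contractLeft (evalC b.1)
      + CliffordAlgebra.contractLeft (evalC b.1) * CliffordAlgebra.contractLeft (evalC a.1)
      = (0 : Module.End ℂ (CForms V)) := by
    refine LinearMap.ext fun ρ => ?_
    change CliffordAlgebra.contractLeft _ (CliffordAlgebra.contractLeft _ ρ) +
      CliffordAlgebra.contractLeft _ (CliffordAlgebra.contractLeft _ ρ) = 0
    rw [CliffordAlgebra.contractLeft_comm, neg_add_cancel]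
  have h5 : ((2 * pairing a b : ℝ) : ℂ) • (1 : Module.End ℂ (CForms V))
      = toComplex b.2 a.1 • (1 : Module.End ℂ (CForms V))
        + toComplex a.2 b.1 • (1 : Module.End ℂ (CForms V)) := by
    rw [← add_smul]; congr 1; simp [pairing]; ring
  rw [h5, ← h1, ← h2]
  rw [← sub_eq_zero]
  have : actL a * actL b + actL b * actL a -
    (wedgeL (toComplex b.2) * actL a + actL a * wedgeL (toComplex b.2) +
      (wedgeL (toComplex a.2) * actL b + actL b * wedgeL (toComplex a.2)))
     = ((CliffordAlgebra.contractLeft (evalC a.1) : Module.End ℂ (CForms V))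
      * CliffordAlgebra.contractLeft (evalC b.1)
      + CliffordAlgebra.contractLeft (evalC b.1) * CliffordAlgebra.contractLeft (evalC a.1)) -
      (wedgeL (toComplex a.2) * wedgeL (toComplex b.2)
      + wedgeL (toComplex b.2) * wedgeL (toComplex a.2)) := by
    simp only [actL]
    noncomm_ring
  rw [this, h3, h4, sub_zero]

/-- The complexified Clifford action of `a + i b`. -/
def actCL (a b : Gen V) : Module.End ℂ (CForms V) := actL a + Complex.I • actL b

@[simp] lemma actCL_apply (a b : Gen V) (ρ : CForms V) : actCL a b ρ = actC a b ρ := rfl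

lemma interior_pullForm (D : V →L[ℝ] W) (X : V) (ρ : CForms W) :
    interior X (pullForm D ρ) = pullForm D (interior (D X) ρ) := by
  induction ρ using ExteriorAlgebra.induction with
  | algebraMap c => simp only [AlgHom.commutes, interior_algebraMap, map_zero]
  | ι θ =>
    have h1 := pullForm_oneForm D θ
    have h2 := interior_oneForm (D X) θ
    rw [h1, h2, interior_oneForm, AlgHom.commutes]; rfl
  | mul a b ha hb =>
    have h : ∀ a : CForms W, invo (pullForm D a) = pullForm D (invo a) := by
      intro a
      have : invo.comp (pullForm D) = (pullForm D).comp invo := by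
        apply ExteriorAlgebra.hom_ext
        ext1 θ
        change invo (pullForm D (oneForm θ)) = pullForm D (invo (oneForm θ))
        simp
      exact DFunLike.congr_fun this a
    rw [map_mul, interior_mul, ha, hb, h, interior_mul, map_add, map_mul, map_mul]
  | add a b ha hb => rw [map_add, interior_add, ha, hb, interior_add, map_add]

lemma toComplex_comp (ξ : W →L[ℝ] ℝ) (D : V →L[ℝ] W) :
    toComplex (ξ.comp D) = (toComplex ξ).comp D := rfl

lemma act_pullForm (D : V →L[ℝ] W) (X : V) (ξ : W →L[ℝ] ℝ) (ρ : CForms W) :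
    act (X, ξ.comp D) (pullForm D ρ) = pullForm D (act (D X, ξ) ρ) := by
  rw [act, act, interior_pullForm, map_add, map_mul, pullForm_oneForm, toComplex_comp]

lemma complexify_ι (ξ : V →L[ℝ] ℝ) :
    complexify (ExteriorAlgebra.ι ℝ ξ) = oneForm (toComplex ξ) :=
  ExteriorAlgebra.lift_ι_apply _ _ _ _

end Algebra

end GCGeom

/-! ### Exterior powers, even forms and exponentials -/

namespace GCGeom

section ExteriorPowers

/-- The k-fold products of members of an independent family are independent; here the product of all
k vectors is the member indexed by the full subset. -/
lemma ιMulti_ne_zero_of_linearIndependent {K M : Type*} [Field K] [AddCommGroup M] [Module K M]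
    {k : ℕ} {v : Fin k → M} (hv : LinearIndependent K v) : ExteriorAlgebra.ιMulti K k v ≠ 0 := by
  have h := (exteriorPower.ιMulti_family_linearIndependent_field (n := k) hv).ne_zero
    (Set.powersetCard.ofFinEmbEquiv (RelEmbedding.refl _))
  intro h0
  apply h
  apply Subtype.ext
  rw [exteriorPower.ιMulti_family_apply_coe, ExteriorAlgebra.ιMulti_family,
    Equiv.symm_apply_apply]
  exact h0

lemma linearIndependent_of_ιMulti_ne_zero {K M : Type*} [Field K] [AddCommGroup M] [Module K M]
    {k : ℕ} {v : Fin k → M} (hv : ExteriorAlgebra.ιMulti K k v ≠ 0) : LinearIndependent K v := by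
  by_contra h
  exact hv (AlternatingMap.map_linearDependent _ v h)

lemma eq_zero_of_mem_exteriorPower {K M : Type*} [Field K] [AddCommGroup M] [Module K M]
    [Module.Finite K M] {k : ℕ} (hk : Module.finrank K M < k) {x : ExteriorAlgebra K M}
    (hx : x ∈ ⋀[K]^k M) : x = 0 := by
  have h : Module.finrank K (⋀[K]^k M) = 0 := by
    rw [exteriorPower.finrank_eq, Nat.choose_eq_zero_of_lt hk]
  have := Module.finrank_zero_iff.1 h
  exact congrArg Subtype.val (Subsingleton.elim (⟨x, hx⟩ : ⋀[K]^k M) 0)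

lemma mul_mem_exteriorPower {R M : Type*} [CommRing R] [AddCommGroup M] [Module R M]
    {i j : ℕ} {x y : ExteriorAlgebra R M} (hx : x ∈ ⋀[R]^i M) (hy : y ∈ ⋀[R]^j M) :
    x * y ∈ ⋀[R]^(i + j) M := by
  rw [ExteriorAlgebra.exteriorPower, pow_add]
  exact Submodule.mul_mem_mul hx hy

lemma pow_mem_exteriorPower {R M : Type*} [CommRing R] [AddCommGroup M] [Module R M]
    {i : ℕ} {x : ExteriorAlgebra R M} (hx : x ∈ ⋀[R]^i M) (j : ℕ) :
    x ^ j ∈ ⋀[R]^(i * j) M := by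
  rw [ExteriorAlgebra.exteriorPower, pow_mul]
  exact Submodule.pow_mem_pow _ hx j

lemma ι_mem_exteriorPower_one {R M : Type*} [CommRing R] [AddCommGroup M] [Module R M] (m : M) :
    ExteriorAlgebra.ι R m ∈ ⋀[R]^1 M := by
  rw [ExteriorAlgebra.exteriorPower, pow_one]
  exact LinearMap.mem_range_self _ _

lemma ιMulti_mem_exteriorPower {R M : Type*} [CommRing R] [AddCommGroup M] [Module R M]
    {k : ℕ} (v : Fin k → M) : ExteriorAlgebra.ιMulti R k v ∈ ⋀[R]^k M := by
  rw [← ExteriorAlgebra.ιMulti_span_fixedDegree]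
  exact Submodule.subset_span ⟨v, rfl⟩

end ExteriorPowers

section Algebra

variable {V W : Type*} [AddCommGroup V] [Module ℝ V] [TopologicalSpace V]
  [AddCommGroup W] [Module ℝ W] [TopologicalSpace W]

lemma complexify_smul (r : ℝ) (w : RForms V) :
    complexify (r • w) = (r : ℂ) • complexify w := by
  rw [map_smul]
  exact (Complex.coe_smul r (complexify w)).symm

lemma oneForm_add (θ η : V →L[ℝ] ℂ) : oneForm (θ + η) = oneForm θ + oneForm η := map_add _ _ _

lemma oneForm_sub (θ η : V →L[ℝ] ℂ) : oneForm (θ - η) = oneForm θ - oneForm η := map_sub _ _ _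

lemma oneForm_neg (θ : V →L[ℝ] ℂ) : oneForm (-θ) = -oneForm θ := map_neg _ _

lemma oneForm_smul (c : ℂ) (θ : V →L[ℝ] ℂ) : oneForm (c • θ) = c • oneForm θ := map_smul _ _ _

/-- Induction for forms of degree two. -/
lemma two_form_induction {p : RForms V → Prop}
    (hι : ∀ ξ η : V →L[ℝ] ℝ, p (ExteriorAlgebra.ι ℝ ξ * ExteriorAlgebra.ι ℝ η))
    (hadd : ∀ a b, p a → p b → p (a + b)) (w : ⋀[ℝ]^2 (V →L[ℝ] ℝ)) : p w := by
  have hw : (w : RForms V) ∈ LinearMap.range (ExteriorAlgebra.ι ℝ (M := V →L[ℝ] ℝ)) ^ 2 := w.2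
  rw [pow_two] at hw
  refine Submodule.mul_induction_on hw ?_ hadd
  rintro _ ⟨ξ, rfl⟩ _ ⟨η, rfl⟩
  exact hι ξ η

lemma complexify_two_mem (w : ⋀[ℝ]^2 (V →L[ℝ] ℝ)) :
    complexify (w : RForms V) ∈ ⋀[ℂ]^2 (V →L[ℝ] ℂ) := by
  refine two_form_induction (p := fun w => complexify w ∈ ⋀[ℂ]^2 (V →L[ℝ] ℂ)) ?_ ?_ w
  · intro ξ η
    rw [map_mul, complexify_ι, complexify_ι]
    exact mul_mem_exteriorPower (ι_mem_exteriorPower_one _) (ι_mem_exteriorPower_one _)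
  · intro a b ha hb
    rw [map_add]
    exact add_mem ha hb

lemma invo_complexify_two (w : ⋀[ℝ]^2 (V →L[ℝ] ℝ)) :
    invo (complexify (w : RForms V)) = complexify (w : RForms V) := by
  refine two_form_induction (p := fun w => invo (complexify w) = complexify w) ?_ ?_ w
  · intro ξ η
    rw [map_mul, map_mul, complexify_ι, complexify_ι, invo_oneForm, invo_oneForm, neg_mul_neg]
  · intro a b ha hb
    rw [map_add, map_add, ha, hb]

/-- The contraction `X ↦ ι_X w` of a real two-form. -/
lemma exists_contraction (w : ⋀[ℝ]^2 (V →L[ℝ] ℝ)) :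
    ∃ f : V →ₗ[ℝ] (V →L[ℝ] ℝ), ∀ X,
      interior X (complexify (w : RForms V)) = oneForm (toComplex (f X)) := by
  refine two_form_induction (p := fun w => ∃ f : V →ₗ[ℝ] (V →L[ℝ] ℝ), ∀ X,
      interior X (complexify w) = oneForm (toComplex (f X))) ?_ ?_ w
  · intro ξ η
    refine ⟨ξ.toLinearMap.smulRight η - η.toLinearMap.smulRight ξ, fun X => ?_⟩
    have h : toComplex ((ξ.toLinearMap.smulRight η - η.toLinearMap.smulRight ξ) X)
        = toComplex ξ X • toComplex η - toComplex η X • toComplex ξ := by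
      ext v; simp
    rw [map_mul, complexify_ι, complexify_ι, interior_oneForm_mul, interior_oneForm, h, oneForm_sub,
      oneForm_smul, oneForm_smul, ← Algebra.commutes, ← Algebra.smul_def]
  · rintro a b ⟨f, hf⟩ ⟨g, hg⟩
    refine ⟨f + g, fun X => ?_⟩
    rw [map_add, interior_add, hf, hg, LinearMap.add_apply, toComplex_add, oneForm_add]

/-- An even form commutes with every covector, and covectors generate the algebra. This gives the
usual power and exponential rules. -/
lemma commute_of_invo_eq {C : CForms V} (hC : invo C = C) (ρ : CForms V) : Commute C ρ := by
  induction ρ using ExteriorAlgebra.induction with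
  | algebraMap c => exact (Algebra.commutes c C).symm
  | ι θ =>
    have := oneForm_mul_eq θ C
    rw [hC] at this
    exact this.symm
  | mul a b ha hb => exact ha.mul_right hb
  | add a b ha hb => exact ha.add_right hb

lemma contractLeft_pow {C : CForms V} (hC : invo C = C) (d : Module.Dual ℂ (V →L[ℝ] ℂ)) (m : ℕ) :
    CliffordAlgebra.contractLeft d (C ^ (m + 1)) =
      ((m + 1 : ℕ) : ℂ) • (C ^ m * CliffordAlgebra.contractLeft d C) := by
  induction m with
  | zero => simp
  | succ m ih =>
    have h := (commute_of_invo_eq hC (CliffordAlgebra.contractLeft d C)).pow_left (m + 1)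
    rw [pow_succ', contractLeft_mul, ih, hC, mul_smul_comm, ← mul_assoc, ← pow_succ', ← h.eq]
    push_cast
    module

lemma contractLeft_ιMulti_eq_zero {k : ℕ} {θ : Fin k → V →L[ℝ] ℂ}
    {d : Module.Dual ℂ (V →L[ℝ] ℂ)} (hd : ∀ i, d (θ i) = 0) :
    CliffordAlgebra.contractLeft d (ExteriorAlgebra.ιMulti ℂ k θ) = 0 := by
  induction k with
  | zero =>
    rw [ExteriorAlgebra.ιMulti_zero_apply]
    exact CliffordAlgebra.contractLeft_one _ d
  | succ k ih =>
    rw [ExteriorAlgebra.ιMulti_succ_apply]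
    have h1 := CliffordAlgebra.contractLeft_ι_mul (d := d)
      (Q := (0 : QuadraticForm ℂ (V →L[ℝ] ℂ))) (θ 0)
      (ExteriorAlgebra.ιMulti ℂ k (Matrix.vecTail θ))
    have h2 := ih (θ := Matrix.vecTail θ) (fun i => hd i.succ)
    rw [h2, hd, zero_smul, mul_zero, sub_zero] at h1
    exact h1

lemma oneForm_mul_ιMulti {k : ℕ} (η : V →L[ℝ] ℂ) (θ : Fin k → V →L[ℝ] ℂ) :
    oneForm η * ExteriorAlgebra.ιMulti ℂ k θ =
      ExteriorAlgebra.ιMulti ℂ (k + 1) (Fin.cons η θ : Fin (k + 1) → V →L[ℝ] ℂ) := by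
  rw [ExteriorAlgebra.ιMulti_succ_apply]
  rfl

lemma oneForm_mul_ιMulti_eq_zero {k : ℕ} {η : V →L[ℝ] ℂ} {θ : Fin k → V →L[ℝ] ℂ}
    (h : η ∈ Submodule.span ℂ (Set.range θ)) :
    oneForm η * ExteriorAlgebra.ιMulti ℂ k θ = 0 := by
  by_contra h0
  rw [oneForm_mul_ιMulti] at h0
  have := linearIndependent_of_ιMulti_ne_zero h0
  rw [linearIndependent_finCons] at this
  exact this.2 h

lemma mem_span_of_oneForm_mul_ιMulti {k : ℕ} {η : V →L[ℝ] ℂ} {θ : Fin k → V →L[ℝ] ℂ}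
    (hθ : ExteriorAlgebra.ιMulti ℂ k θ ≠ 0)
    (h : oneForm η * ExteriorAlgebra.ιMulti ℂ k θ = 0) :
    η ∈ Submodule.span ℂ (Set.range θ) := by
  by_contra h0
  rw [oneForm_mul_ιMulti] at h
  exact ιMulti_ne_zero_of_linearIndependent
    (linearIndependent_finCons.2 ⟨linearIndependent_of_ιMulti_ne_zero hθ, h0⟩) h

/-- Complex conjugation of complex covectors. -/
def conjL : (V →L[ℝ] ℂ) →ₛₗ[starRingEnd ℂ] (V →L[ℝ] ℂ) where
  toFun := conj
  map_add' θ η := by ext v; simp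
  map_smul' c θ := by ext v; simp

/-- Killing a nonzero decomposable form means lying in the span of its factors, and conjugation
respects spans. Thus no conjugation on the whole algebra of forms is required. -/
lemma oneForm_conj_mul_ιMulti {k : ℕ} {η : V →L[ℝ] ℂ} {θ : Fin k → V →L[ℝ] ℂ}
    (hθ : ExteriorAlgebra.ιMulti ℂ k θ ≠ 0)
    (h : oneForm η * ExteriorAlgebra.ιMulti ℂ k θ = 0) :
    oneForm (conj η) * ExteriorAlgebra.ιMulti ℂ k (fun i => conj (θ i)) = 0 := by
  apply oneForm_mul_ιMulti_eq_zero
  have h1 := mem_span_of_oneForm_mul_ιMulti hθ h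
  have h2 := Submodule.mem_map_of_mem (f := conjL) h1
  rw [Submodule.map_span, ← Set.range_comp] at h2
  exact h2

end Algebra

section VectorSpace

variable {E : Type*} [NormedAddCommGroup E] [NormedSpace ℝ E] [FiniteDimensional ℝ E]

lemma finrank_covectors : Module.finrank ℂ (E →L[ℝ] ℂ) = Module.finrank ℝ E := by
  rw [← Module.finrank_linearMap_self ℝ ℂ E]
  exact LinearEquiv.finrank_eq
    { toFun := fun θ => θ.toLinearMap
      invFun := fun θ => LinearMap.toContinuousLinearMap θ
      map_add' := fun _ _ => rfl
      map_smul' := fun _ _ => rfl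
      left_inv := fun θ => by ext; rfl
      right_inv := fun θ => by ext; rfl }

lemma pow_finrank_eq_zero {C : CForms E} (hC : C ∈ ⋀[ℂ]^2 (E →L[ℝ] ℂ))
    (hE : 0 < Module.finrank ℝ E) : C ^ Module.finrank ℝ E = 0 :=
  eq_zero_of_mem_exteriorPower (by rw [finrank_covectors]; omega)
    (pow_mem_exteriorPower hC (Module.finrank ℝ E))

/-- The power rule for contraction, applied term by term, shifts the exponential series by one. -/
lemma contractLeft_expForm {C : CForms E} (hC : invo C = C) (hC2 : C ∈ ⋀[ℂ]^2 (E →L[ℝ] ℂ))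
    (hE : 0 < Module.finrank ℝ E) (d : Module.Dual ℂ (E →L[ℝ] ℂ)) :
    CliffordAlgebra.contractLeft d (expForm C) =
      CliffordAlgebra.contractLeft d C * expForm C := by
  set N := Module.finrank ℝ E with hN
  have h0 : CliffordAlgebra.contractLeft d (1 : CForms E) = 0 :=
    CliffordAlgebra.contractLeft_one _ d
  have h1 : CliffordAlgebra.contractLeft d (expForm C) =
      ∑ j ∈ Finset.range N, ((j.factorial : ℂ)⁻¹) • (CliffordAlgebra.contractLeft d C * C ^ j) := by
    rw [expForm, map_sum, Finset.sum_range_succ']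
    simp only [map_smul, pow_zero, h0, smul_zero, add_zero]
    refine Finset.sum_congr rfl fun j _ => ?_
    rw [contractLeft_pow hC, smul_smul, ((commute_of_invo_eq hC _).pow_left j).eq]
    congr 1
    rw [Nat.factorial_succ]
    have : ((j + 1 : ℕ) : ℂ) ≠ 0 := Nat.cast_ne_zero.2 (Nat.succ_ne_zero j)
    have h3 : ((j.factorial : ℕ) : ℂ) ≠ 0 := Nat.cast_ne_zero.2 (Nat.factorial_ne_zero j)
    push_cast at this ⊢
    field_simp
  -- The shifted sum lacks the last term of the truncated exponential. That term is a multiple of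
  -- C^N, of degree 2N > N, hence zero.
  rw [h1, expForm, Finset.sum_range_succ, ← hN, hN, pow_finrank_eq_zero hC2 hE, smul_zero, add_zero,
    Finset.mul_sum]
  simp only [mul_smul_comm]

/-- The exponential is 1 plus a multiple of the nilpotent C by a commuting factor. -/
lemma isUnit_expForm {C : CForms E} (hC2 : C ∈ ⋀[ℂ]^2 (E →L[ℝ] ℂ))
    (hE : 0 < Module.finrank ℝ E) : IsUnit (expForm C) := by
  set N := Module.finrank ℝ E with hN
  have hc : ∀ j, Commute C (C ^ j) := fun j => (Commute.refl C).pow_right j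
  have h : expForm C =
      C * (∑ j ∈ Finset.range N, (((j + 1).factorial : ℂ)⁻¹) • C ^ j) + 1 := by
    rw [expForm, Finset.sum_range_succ', Finset.mul_sum]
    simp [pow_succ', ← hN]
  rw [h]
  refine IsNilpotent.isUnit_add_one (Commute.isNilpotent_mul_right ?_ ⟨N, ?_⟩)
  · exact Commute.sum_right _ _ _ fun j _ => (hc j).smul_right _
  · exact pow_finrank_eq_zero hC2 hE

end VectorSpace

end GCGeom

/-! ### The orthogonal complex structure defined by a non-degenerate pure form -/

namespace GCGeom

section PureSpinor

variable {E : Type*} [NormedAddCommGroup E] [NormedSpace ℝ E] [FiniteDimensional ℝ E]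

/-- The complex two-form `B + i w`. -/
def complexTwo (B w : ⋀[ℝ]^2 (E →L[ℝ] ℝ)) : CForms E :=
  complexify (B : RForms E) + Complex.I • complexify (w : RForms E)

lemma complexTwo_mem (B w : ⋀[ℝ]^2 (E →L[ℝ] ℝ)) : complexTwo B w ∈ ⋀[ℂ]^2 (E →L[ℝ] ℂ) :=
  add_mem (complexify_two_mem B) (Submodule.smul_mem _ _ (complexify_two_mem w))

lemma invo_complexTwo (B w : ⋀[ℝ]^2 (E →L[ℝ] ℝ)) : invo (complexTwo B w) = complexTwo B w := by
  rw [complexTwo, map_add, map_smul, invo_complexify_two, invo_complexify_two]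

/-- The pure form `e^{B + i w} θ¹ ∧ ⋯ ∧ θᵏ` on a vector space. -/
def pureSpinor {k : ℕ} (B w : ⋀[ℝ]^2 (E →L[ℝ] ℝ)) (θ : Fin k → E →L[ℝ] ℂ) : CForms E :=
  expForm (complexTwo B w) * ExteriorAlgebra.ιMulti ℂ k θ

variable {k : ℕ} {B w : ⋀[ℝ]^2 (E →L[ℝ] ℝ)} {θ : Fin k → E →L[ℝ] ℂ}

lemma invo_expForm {C : CForms E} (hC : invo C = C) : invo (expForm C) = expForm C := by
  simp only [expForm, map_sum, map_smul, map_pow, hC]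

lemma pureSpinor_ne_zero (hE : 0 < Module.finrank ℝ E)
    (hθ : ExteriorAlgebra.ιMulti ℂ k θ ≠ 0) : pureSpinor B w θ ≠ 0 := by
  intro h
  exact hθ ((isUnit_expForm (complexTwo_mem B w) hE).mul_right_eq_zero.1 h)

lemma oneForm_mul_pureSpinor (η : E →L[ℝ] ℂ) :
    oneForm η * pureSpinor B w θ =
      expForm (complexTwo B w) * (oneForm η * ExteriorAlgebra.ιMulti ℂ k θ) := by
  rw [pureSpinor, ← mul_assoc, oneForm_mul_eq η, invo_expForm (invo_complexTwo B w), mul_assoc]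

/-- A complex vector killed by all factors of Ω acts on e^C Ω like the covector obtained by
contracting it into C. This makes the annihilator explicit. -/
lemma contractLeft_pureSpinor (hE : 0 < Module.finrank ℝ E) {d : Module.Dual ℂ (E →L[ℝ] ℂ)}
    (hd : ∀ i, d (θ i) = 0) :
    CliffordAlgebra.contractLeft d (pureSpinor B w θ) =
      CliffordAlgebra.contractLeft d (complexTwo B w) * pureSpinor B w θ := by
  rw [pureSpinor, contractLeft_mul, contractLeft_ιMulti_eq_zero hd, mul_zero, add_zero,
    contractLeft_expForm (invo_complexTwo B w) (complexTwo_mem B w) hE, mul_assoc]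

/-- A vector whose contraction annihilates a non-zero form of top degree vanishes. -/
lemma eq_zero_of_interior_top {m : ℕ} {T : CForms E} (hT : T ∈ ⋀[ℂ]^m (E →L[ℝ] ℂ))
    (hm : m = Module.finrank ℝ E) (hT0 : T ≠ 0) {X : E} (hX : interior X T = 0) : X = 0 := by
  by_contra hX0
  obtain ⟨ξ, -, hξ⟩ := exists_dual_vector'' ℝ X
  have h1 : oneForm (toComplex ξ) * T = 0 := by
    apply eq_zero_of_mem_exteriorPower (k := 1 + m)
    · rw [finrank_covectors]; omega
    · exact mul_mem_exteriorPower (ι_mem_exteriorPower_one _) hT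
  have h2 := interior_oneForm_mul X (toComplex ξ) T
  rw [h1, hX, interior_zero, mul_zero, sub_zero, toComplex_apply, hξ] at h2
  have h3 : ((‖X‖ : ℝ) : ℂ) ≠ 0 := by
    simpa using hX0
  exact (smul_ne_zero h3 hT0) h2.symm

/-- `w^{n-k} ∧ Ω ∧ Ω̄ ≠ 0` -/
structure NondegenerateAt (w : ⋀[ℝ]^2 (E →L[ℝ] ℝ)) (θ : Fin k → E →L[ℝ] ℂ) (n : ℕ) : Prop where
  finrank_eq : Module.finrank ℝ E = 2 * n
  le : k ≤ n
  pos : 0 < n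
  ne_zero : complexify (w : RForms E) ^ (n - k) * ExteriorAlgebra.ιMulti ℂ k θ *
    ExteriorAlgebra.ιMulti ℂ k (fun i => conj (θ i)) ≠ 0

variable {n : ℕ}

lemma NondegenerateAt.Ω_ne_zero (h : NondegenerateAt w θ n) :
    ExteriorAlgebra.ιMulti ℂ k θ ≠ 0 := by
  intro h0
  apply h.ne_zero
  rw [h0, mul_zero, zero_mul]

lemma NondegenerateAt.Ω_mul_ne_zero (h : NondegenerateAt w θ n) :
    ExteriorAlgebra.ιMulti ℂ k θ * ExteriorAlgebra.ιMulti ℂ k (fun i => conj (θ i)) ≠ 0 := by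
  intro h0
  apply h.ne_zero
  rw [mul_assoc, h0, mul_zero]

lemma NondegenerateAt.finrank_pos (h : NondegenerateAt w θ n) : 0 < Module.finrank ℝ E := by
  have := h.finrank_eq; have := h.pos; omega

lemma interior_complexTwo (X : E) :
    interior X (complexTwo B w) = interior X (complexify (B : RForms E)) +
      Complex.I • interior X (complexify (w : RForms E)) := by
  rw [complexTwo, interior_add, interior_smul]

/-- A real generalized vector annihilating a non-degenerate pure form vanishes. -/
lemma NondegenerateAt.eq_zero_of_act (h : NondegenerateAt w θ n) {a : Gen E}
    (ha : act a (pureSpinor B w θ) = 0) : a = 0 := by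
  obtain ⟨X, ξ⟩ := a
  have hE := h.finrank_pos
  have hρ : pureSpinor B w θ ≠ 0 := pureSpinor_ne_zero hE h.Ω_ne_zero
  set Ω := ExteriorAlgebra.ιMulti ℂ k θ with hΩ
  set Ω' := ExteriorAlgebra.ιMulti ℂ k (fun i => conj (θ i)) with hΩ'
  -- Both θ^i and X + ξ annihilate ρ, so their anticommutator, the scalar θ^i(X), does too; and ρ ≠
  -- 0.
  have hθX : ∀ i, θ i X = 0 := by
    intro i
    have h1 : oneForm (θ i) * pureSpinor B w θ = 0 := by
      rw [oneForm_mul_pureSpinor,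
        oneForm_mul_ιMulti_eq_zero (Submodule.subset_span ⟨i, rfl⟩), mul_zero]
    have h2 := LinearMap.congr_fun (wedgeL_mul_actL (θ i) (X, ξ)) (pureSpinor B w θ)
    change oneForm (θ i) * act (X, ξ) (pureSpinor B w θ) +
      act (X, ξ) (oneForm (θ i) * pureSpinor B w θ) = θ i X • pureSpinor B w θ at h2
    rw [ha, h1, mul_zero, zero_add] at h2
    have h3 : act (X, ξ) (0 : CForms E) = 0 := map_zero (actL (X, ξ))
    rw [h3] at h2
    exact (smul_eq_zero.1 h2.symm).resolve_right hρ
  obtain ⟨fB, hfB⟩ := exists_contraction B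
  obtain ⟨fw, hfw⟩ := exists_contraction w
  -- On ρ, contraction by X is multiplication by ι_X(B + iω). Cancelling the unit e^{B+iω} leaves an
  -- equation on Ω alone.
  have hη : oneForm (toComplex (fB X + ξ) + Complex.I • toComplex (fw X)) * Ω = 0 := by
    have h1 := contractLeft_pureSpinor (B := B) (w := w) (d := evalC X) hE hθX
    rw [← interior_eq, ← interior_eq, interior_complexTwo, hfB, hfw] at h1
    rw [act, h1, ← add_mul] at ha
    have h2 : oneForm (toComplex (fB X)) + Complex.I • oneForm (toComplex (fw X)) +
        oneForm (toComplex ξ) =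
        oneForm (toComplex (fB X + ξ) + Complex.I • toComplex (fw X)) := by
      rw [oneForm_add, oneForm_smul, toComplex_add, oneForm_add]; abel
    rw [h2, oneForm_mul_pureSpinor] at ha
    exact (isUnit_expForm (complexTwo_mem B w) hE).mul_right_eq_zero.1 ha
  have hη' := oneForm_conj_mul_ιMulti h.Ω_ne_zero hη
  have hconj : conj (toComplex (fB X + ξ) + Complex.I • toComplex (fw X)) =
      toComplex (fB X + ξ) - Complex.I • toComplex (fw X) := by
    ext v; simp; ring
  rw [hconj, ← hΩ'] at hη'
  have hcomm : ∀ η : E →L[ℝ] ℂ, oneForm η * Ω' = 0 → oneForm η * (Ω * Ω') = 0 := by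
    intro η h0
    rw [← mul_assoc, oneForm_mul_eq, mul_assoc, h0, mul_zero]
  have h1 : oneForm (toComplex (fB X + ξ) + Complex.I • toComplex (fw X)) * (Ω * Ω') = 0 := by
    rw [← mul_assoc, hη, zero_mul]
  have h2 := hcomm _ hη'
  -- The covector of `hη` and its conjugate both kill Ω ∧ Ω̄, hence so does the imaginary part,
  -- which is ι_X ω.
  have h3 : oneForm (toComplex (fw X)) * (Ω * Ω') = 0 := by
    have h4 : toComplex (fw X) = (-Complex.I / 2) •
        ((toComplex (fB X + ξ) + Complex.I • toComplex (fw X)) -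
          (toComplex (fB X + ξ) - Complex.I • toComplex (fw X))) := by
      ext v
      simp
      ring_nf
      simp
    rw [h4, oneForm_smul, oneForm_sub, smul_mul_assoc, sub_mul, h1, h2, sub_zero, smul_zero]
  -- X is contracted into the top form ω^{n-k} ∧ Ω ∧ Ω̄: it kills Ω ∧ Ω̄, and contracting the power
  -- produces a factor ι_X ω, which also kills Ω ∧ Ω̄.
  have hX : X = 0 := by
    refine eq_zero_of_interior_top (m := 2 * (n - k) + k + k) ?_ ?_ h.ne_zero ?_
    · exact mul_mem_exteriorPower (mul_mem_exteriorPower (pow_mem_exteriorPower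
        (complexify_two_mem w) _) (ιMulti_mem_exteriorPower _)) (ιMulti_mem_exteriorPower _)
    · have := h.finrank_eq; have := h.le; omega
    · have hz : interior X (Ω * Ω') = 0 := by
        have hΩX : interior X Ω = 0 := contractLeft_ιMulti_eq_zero (d := evalC X) hθX
        have hΩX' : interior X Ω' = 0 := contractLeft_ιMulti_eq_zero (d := evalC X) fun i => by
          change conj (θ i) X = 0
          rw [conj_apply, hθX, map_zero]
        rw [interior_mul, hΩX, hΩX', zero_mul, mul_zero, add_zero]
      rw [mul_assoc, interior_mul, hz, mul_zero, add_zero]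
      rcases Nat.eq_zero_or_pos (n - k) with h0 | h0
      · rw [h0, pow_zero, interior_one, zero_mul]
      · obtain ⟨m, hm⟩ := Nat.exists_eq_succ_of_ne_zero h0.ne'
        rw [hm, interior_eq, contractLeft_pow (invo_complexify_two w), ← interior_eq, hfw,
          smul_mul_assoc, mul_assoc, h3, mul_zero, smul_zero]
  subst hX
  have hξ : oneForm (toComplex ξ) * Ω = 0 := by
    simpa using hη
  have hξ0 : ξ = 0 := by
    by_contra hne
    obtain ⟨Y, hY⟩ : ∃ Y, ξ Y ≠ 0 := by
      by_contra hall
      push Not at hall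
      exact hne (ContinuousLinearMap.ext hall)
    have hξ' : oneForm (toComplex ξ) * Ω' = 0 := by
      have := oneForm_conj_mul_ιMulti h.Ω_ne_zero hξ
      have hc : conj (toComplex ξ) = toComplex ξ := by ext v; simp
      rwa [hc] at this
    have h5 := interior_oneForm_mul Y (toComplex ξ) Ω
    rw [hξ, interior_zero] at h5
    -- Contracting ξ ∧ Ω = 0 with Y gives ξ(Y) Ω = ξ ∧ ι_Y Ω. Multiplied by Ω̄ this vanishes, since
    -- the real covector ξ also kills Ω̄.
    have h6 : toComplex ξ Y • (Ω * Ω') = 0 := by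
      rw [← smul_mul_assoc, sub_eq_zero.1 h5.symm, oneForm_mul_eq, mul_assoc, hξ', mul_zero]
    exact (smul_ne_zero (by simpa using hY) h.Ω_mul_ne_zero) h6
  rw [hξ0]; rfl

/-- The complex annihilator of a form, as pairs of real generalized vectors. -/
def annihilator (ρ : CForms E) : Submodule ℝ (Gen E × Gen E) where
  carrier := {p | actC p.1 p.2 ρ = 0}
  add_mem' := by
    intro p q hp hq
    have : actCL (p + q).1 (p + q).2 = actCL p.1 p.2 + actCL q.1 q.2 := by
      simp only [actCL, Prod.fst_add, Prod.snd_add, actL_add, smul_add]; abel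
    have h := LinearMap.congr_fun this ρ
    change actC _ _ ρ = actC p.1 p.2 ρ + actC q.1 q.2 ρ at h
    rw [hp, hq, add_zero] at h
    exact h
  zero_mem' := by
    have : actCL (0 : Gen E) 0 = 0 := by
      have h0 : actL (0 : Gen E) = 0 := by simpa using actL_sub (0 : Gen E) 0
      simp [actCL, h0]
    exact LinearMap.congr_fun this ρ
  smul_mem' := by
    intro r p hp
    have : actCL (r • p).1 (r • p).2 = (r : ℂ) • actCL p.1 p.2 := by
      simp only [actCL, Prod.smul_fst, Prod.smul_snd, actL_smul, smul_add, smul_smul, mul_comm]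
    have h := LinearMap.congr_fun this ρ
    change actC _ _ ρ = (r : ℂ) • actC p.1 p.2 ρ at h
    rw [hp, smul_zero] at h
    exact h

lemma mem_annihilator {ρ : CForms E} {a b : Gen E} :
    (a, b) ∈ annihilator ρ ↔ actC a b ρ = 0 := Iff.rfl

lemma sub_mem_annihilator {ρ : CForms E} {a b a' b' : Gen E} (h : (a, b) ∈ annihilator ρ)
    (h' : (a', b') ∈ annihilator ρ) : (a - a', b - b') ∈ annihilator ρ := by
  have : actCL (a - a') (b - b') = actCL a b - actCL a' b' := by
    simp only [actCL, actL_sub, smul_sub]; abel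
  have h1 := LinearMap.congr_fun this ρ
  change actC _ _ ρ = actC a b ρ - actC a' b' ρ at h1
  rw [mem_annihilator.1 h, mem_annihilator.1 h', sub_zero] at h1
  exact h1

/-- A parametrization of the annihilator of a pure form. -/
def annParam (fB fw : E →ₗ[ℝ] (E →L[ℝ] ℝ)) (θ : Fin k → E →L[ℝ] ℂ) :
    (E × E) × (Fin k → ℂ) →ₗ[ℝ] Gen E × Gen E where
  -- For p = ((X, Y), t) and ζ = ∑ t_j θ^j, these are the real and imaginary parts of X + iY plus
  -- the covector ζ - ι_{X+iY}(B + iω).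
  toFun p := ((p.1.1, Complex.reCLM.comp (Fintype.linearCombination ℂ θ p.2)
      - fB p.1.1 + fw p.1.2),
    (p.1.2, Complex.imCLM.comp (Fintype.linearCombination ℂ θ p.2) - fw p.1.1 - fB p.1.2))
  map_add' p q := by
    ext <;> simp <;> ring
  map_smul' r p := by
    have h : Fintype.linearCombination ℂ θ (r • p.2) =
        r • Fintype.linearCombination ℂ θ p.2 :=
      ((Fintype.linearCombination ℂ θ).restrictScalars ℝ).map_smul r p.2
    ext v <;> simp [h] <;> ring

/-- The joint kernel of complex covectors on complex vectors. -/
def complexKer (θ : Fin k → E →L[ℝ] ℂ) : E × E →ₗ[ℝ] (Fin k → ℂ) where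
  toFun p i := θ i p.1 + Complex.I * θ i p.2
  map_add' p q := by ext i; simp; ring
  map_smul' r p := by ext i; simp; ring

/-- The covector part cancels the effect of contracting X + iY into e^{B+iω}, up to a combination ζ
of the factors of Ω, which kills Ω. -/
lemma actC_annParam (hE : 0 < Module.finrank ℝ E) {fB fw : E →ₗ[ℝ] (E →L[ℝ] ℝ)}
    (hfB : ∀ X, interior X (complexify (B : RForms E)) = oneForm (toComplex (fB X)))
    (hfw : ∀ X, interior X (complexify (w : RForms E)) = oneForm (toComplex (fw X)))
    {p : E × E} (hp : complexKer θ p = 0) (t : Fin k → ℂ) :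
    actC (annParam fB fw θ (p, t)).1 (annParam fB fw θ (p, t)).2 (pureSpinor B w θ) = 0 := by
  obtain ⟨X, Y⟩ := p
  set ζ := Fintype.linearCombination ℂ θ t with hζ
  have hd : ∀ i, (evalC X + Complex.I • evalC Y) (θ i) = 0 := fun i => congrFun hp i
  have h1 := contractLeft_pureSpinor (B := B) (w := w) hE hd
  have h2 : ∀ σ : CForms E, CliffordAlgebra.contractLeft (evalC X + Complex.I • evalC Y) σ =
      interior X σ + Complex.I • interior Y σ := by
    intro σ
    simp only [interior_eq, map_add, map_smul, LinearMap.add_apply, LinearMap.smul_apply]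
  rw [h2, h2, interior_complexTwo, interior_complexTwo, hfB, hfw, hfB, hfw] at h1
  have h3 : oneForm ζ * pureSpinor B w θ = 0 := by
    rw [oneForm_mul_pureSpinor, oneForm_mul_ιMulti_eq_zero, mul_zero]
    rw [hζ, Fintype.linearCombination_apply]
    exact Submodule.sum_mem _ fun j _ => Submodule.smul_mem _ _ (Submodule.subset_span ⟨j, rfl⟩)
  have h4 : oneForm (toComplex (Complex.reCLM.comp ζ - fB X + fw Y)) +
      Complex.I • oneForm (toComplex (Complex.imCLM.comp ζ - fw X - fB Y)) =
      oneForm ζ - (oneForm (toComplex (fB X)) + Complex.I • oneForm (toComplex (fw X)) +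
        Complex.I • (oneForm (toComplex (fB Y)) + Complex.I • oneForm (toComplex (fw Y)))) := by
    rw [← oneForm_smul, ← oneForm_smul, ← oneForm_smul, ← oneForm_add, ← oneForm_add,
      ← oneForm_add, ← oneForm_smul, ← oneForm_add, ← oneForm_sub]
    congr 1
    ext v
    apply Complex.ext <;> simp <;> ring
  change act (X, Complex.reCLM.comp ζ - fB X + fw Y) (pureSpinor B w θ) +
    Complex.I • act (Y, Complex.imCLM.comp ζ - fw X - fB Y) (pureSpinor B w θ) = 0
  have h5 : ∀ (a b c d : CForms E), a + c + Complex.I • (b + d) = (a + Complex.I • b) +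
      (c + Complex.I • d) := by
    intro a b c d; module
  rw [act, act, h5, h1, ← smul_mul_assoc, ← add_mul, h4, ← add_mul, add_sub_cancel, h3]

/-- The annihilator contains no nonzero real element and has real dimension at least 4n = dim (V ⊕
V*), so taking the real part is an isomorphism from it onto V ⊕ V*. It is therefore the graph of -J.
Stability under multiplication by i gives J² = -1, and isotropy gives orthogonality. -/
lemma NondegenerateAt.exists_structure (h : NondegenerateAt w θ n) :
    ∃ J : Gen E →ₗ[ℝ] Gen E, (∀ a, J (J a) = -a) ∧
      (∀ a b, pairing (J a) (J b) = pairing a b) ∧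
      ∀ a b, actC a b (pureSpinor B w θ) = 0 ↔ J a = -b := by
  set ρ := pureSpinor B w θ with hρ
  have hE := h.finrank_pos
  have hρ0 : ρ ≠ 0 := pureSpinor_ne_zero hE h.Ω_ne_zero
  obtain ⟨fB, hfB⟩ := exists_contraction B
  obtain ⟨fw, hfw⟩ := exists_contraction w
  -- multiplication by `i`
  have hI : ∀ a b : Gen E, (a, b) ∈ annihilator ρ → (b, -a) ∈ annihilator ρ := by
    intro a b hab
    have : actCL b (-a) = -(Complex.I • actCL a b) := by
      rw [actCL, actCL, actL_neg, smul_add, smul_smul, Complex.I_mul_I]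
      module
    have h1 := LinearMap.congr_fun this ρ
    change actC b (-a) ρ = -(Complex.I • actC a b ρ) at h1
    rw [mem_annihilator.1 hab, smul_zero, neg_zero] at h1
    exact h1
  have hreal : ∀ b : Gen E, (b, 0) ∈ annihilator ρ → b = 0 := by
    intro b hb
    apply h.eq_zero_of_act (B := B)
    have h0 : actL (0 : Gen E) = 0 := by simpa using actL_sub (0 : Gen E) 0
    have h1 : actCL b 0 = actL b := by rw [actCL, h0, smul_zero, add_zero]
    have h2 := LinearMap.congr_fun h1 ρ
    exact h2.symm.trans hb
  let p : annihilator ρ →ₗ[ℝ] Gen E := (LinearMap.fst ℝ _ _).comp (annihilator ρ).subtype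
  have hpinj : Function.Injective p := by
    rintro ⟨⟨a, b⟩, hab⟩ ⟨⟨a', b'⟩, hab'⟩ h0
    have h0' : a = a' := h0
    subst h0'
    -- Two elements with the same real part differ by i times a real element; multiplication by -i
    -- turns it into a real annihilating element.
    have h1 := hI _ _ (sub_mem_annihilator hab hab')
    rw [sub_self, neg_zero] at h1
    have h2 := sub_eq_zero.1 (hreal (b - b') h1)
    subst h2
    rfl
  have hG : Module.finrank ℝ (Gen E) = 4 * n := by
    have h1 : Module.finrank ℝ (E →L[ℝ] ℝ) = Module.finrank ℝ E := by
      rw [← (LinearMap.toContinuousLinearMap (𝕜 := ℝ) (E := E) (F' := ℝ)).finrank_eq,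
        Module.finrank_linearMap_self]
    rw [Module.finrank_prod, h1, h.finrank_eq]; ring
  -- The common kernel of the θ^i on complex vectors has real dimension at least 4n - 2k, and the
  -- coefficients t contribute 2k; the parametrization is injective because the θ^i are independent.
  have hdim : 4 * n ≤ Module.finrank ℝ (annihilator ρ) := by
    let K := LinearMap.ker (complexKer θ)
    let f : K × (Fin k → ℂ) →ₗ[ℝ] annihilator ρ :=
      LinearMap.codRestrict (annihilator ρ)
        ((annParam fB fw θ).comp (K.subtype.prodMap LinearMap.id)) fun q =>
          actC_annParam hE hfB hfw q.1.2 q.2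
    have hf : Function.Injective f := by
      refine (injective_iff_map_eq_zero f).2 ?_
      rintro ⟨⟨⟨X, Y⟩, hXY⟩, t⟩ h0
      have h1 : annParam fB fw θ ((X, Y), t) = 0 := congrArg Subtype.val h0
      have hX : X = 0 := congrArg (fun q => q.1.1) h1
      have hY : Y = 0 := congrArg (fun q => q.2.1) h1
      subst hX hY
      have hre := congrArg (fun q => q.1.2) h1
      have him := congrArg (fun q => q.2.2) h1
      have ht : ∑ j, t j • θ j = 0 := by
        ext v
        have e1 := DFunLike.congr_fun hre v
        have e2 := DFunLike.congr_fun him v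
        apply Complex.ext
        · simpa [annParam, Fintype.linearCombination_apply] using e1
        · simpa [annParam, Fintype.linearCombination_apply] using e2
      have ht0 : t = 0 := by
        funext j
        exact Fintype.linearIndependent_iff.1 (linearIndependent_of_ιMulti_ne_zero h.Ω_ne_zero)
          t ht j
      subst ht0
      rfl
    have h1 := LinearMap.finrank_le_finrank_of_injective hf
    have h2 := (complexKer θ).finrank_range_add_finrank_ker
    have h3 : Module.finrank ℝ (LinearMap.range (complexKer θ)) ≤ Module.finrank ℝ (Fin k → ℂ) :=
      Submodule.finrank_le _
    have h4 : Module.finrank ℝ (Fin k → ℂ) = k * 2 := by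
      rw [Module.finrank_pi_fintype]; simp [Complex.finrank_real_complex]
    rw [Module.finrank_prod] at h1 h2
    rw [h.finrank_eq] at h2
    change Module.finrank ℝ K + _ ≤ _ at h1
    change _ + Module.finrank ℝ K = _ at h2
    omega
  have hpsurj : Function.Surjective p := by
    rw [← LinearMap.range_eq_top]
    apply Submodule.eq_top_of_finrank_eq
    have h1 := LinearMap.finrank_range_of_inj hpinj
    have h2 : Module.finrank ℝ (LinearMap.range p) ≤ Module.finrank ℝ (Gen E) :=
      Submodule.finrank_le _
    omega
  let P : annihilator ρ ≃ₗ[ℝ] Gen E := LinearEquiv.ofBijective p ⟨hpinj, hpsurj⟩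
  let J : Gen E →ₗ[ℝ] Gen E :=
    -((LinearMap.snd ℝ _ _).comp ((annihilator ρ).subtype.comp P.symm.toLinearMap))
  have hP : ∀ a, ((P.symm a : Gen E × Gen E)).1 = a := fun a => P.apply_symm_apply a
  have hJ : ∀ a b, actC a b ρ = 0 ↔ J a = -b := by
    intro a b
    constructor
    · intro hab
      have : P.symm a = ⟨(a, b), hab⟩ := by
        rw [LinearEquiv.symm_apply_eq]; rfl
      change -((P.symm a : Gen E × Gen E)).2 = -b
      rw [this]
    · intro hab
      have h1 : ((P.symm a : Gen E × Gen E)).2 = b := neg_injective hab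
      have h2 : (P.symm a : Gen E × Gen E) = (a, b) := Prod.ext (hP a) h1
      have h3 := (P.symm a).2
      rw [h2] at h3
      exact h3
  refine ⟨J, ?_, ?_, hJ⟩
  · intro a
    have h1 : actC a (-J a) ρ = 0 := (hJ _ _).2 (neg_neg _).symm
    have h2 : actC (-J a) (-a) ρ = 0 := hI _ _ h1
    have h3 := (hJ _ _).1 h2
    rw [map_neg, neg_neg] at h3
    exact neg_eq_iff_eq_neg.1 h3
  · intro a b
    have h1 : actC a (-J a) ρ = 0 := (hJ _ _).2 (neg_neg _).symm
    have h2 : actC b (-J b) ρ = 0 := (hJ _ _).2 (neg_neg _).symm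
    set a' := -J a with ha'
    set b' := -J b with hb'
    -- The anticommutator of two annihilating elements is a scalar killing ρ ≠ 0, so it is zero; its
    -- real part is the orthogonality relation.
    have h3 : actCL a a' * actCL b b' + actCL b b' * actCL a a' =
        (((2 * pairing a b : ℝ) : ℂ) - ((2 * pairing a' b' : ℝ) : ℂ) +
          Complex.I * (((2 * pairing a b' : ℝ) : ℂ) + ((2 * pairing a' b : ℝ) : ℂ))) •
          (1 : Module.End ℂ (CForms E)) := by
      have e1 := actL_mul_actL a b
      have e2 := actL_mul_actL a' b'
      have e3 := actL_mul_actL a b'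
      have e4 := actL_mul_actL a' b
      rw [add_smul, sub_smul, mul_smul, add_smul, ← e1, ← e2, ← e3, ← e4, actCL, actCL]
      simp only [add_mul, mul_add, smul_mul_assoc, mul_smul_comm, smul_add, smul_smul,
        Complex.I_mul_I]
      module
    have h4 := LinearMap.congr_fun h3 ρ
    have e1 : (actCL a a' * actCL b b' + actCL b b' * actCL a a') ρ = 0 := by
      change actCL a a' (actC b b' ρ) + actCL b b' (actC a a' ρ) = 0
      rw [h1, h2, map_zero, map_zero, add_zero]
    rw [e1] at h4
    rw [LinearMap.smul_apply, Module.End.one_apply] at h4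
    have h5 := (smul_eq_zero.1 h4.symm).resolve_right hρ0
    have h6 := congrArg Complex.re h5
    simp at h6
    have h7 : pairing (J a) (J b) = pairing a' b' := by
      simp [pairing, ha', hb']
    rw [h7]; linarith

end PureSpinor

end GCGeom

/-! ### Calculus of form-valued maps and involutivity of the annihilator -/

namespace GCGeom

section Calculus

variable {E : Type*} [NormedAddCommGroup E] [NormedSpace ℝ E] [FiniteDimensional ℝ E]

lemma coe_smul_cforms (r : ℝ) (ρ : CForms E) : r • ρ = (r : ℂ) • ρ :=
  (Complex.coe_smul r ρ).symm

/-- Coordinates on the space of complex forms, as a real linear equivalence. -/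
def formCoordR : CForms E ≃ₗ[ℝ] (Fin (Module.finrank ℂ (CForms E)) → ℂ) :=
  { (Module.finBasis ℂ (CForms E)).equivFun with
    map_smul' := fun r ρ => by
      change (Module.finBasis ℂ (CForms E)).equivFun (r • ρ) =
        r • (Module.finBasis ℂ (CForms E)).equivFun ρ
      rw [coe_smul_cforms, map_smul, Complex.coe_smul] }

/-- The norm is transported from coordinates, so that differentiability of a form-valued map is that
of its coefficients and `fderiv` replaces the coefficientwise derivative of `dirDeriv`. -/
instance normedAddCommGroupCForms : NormedAddCommGroup (CForms E) :=
  NormedAddCommGroup.induced (CForms E) (Fin (Module.finrank ℂ (CForms E)) → ℂ)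
    (formCoordR (E := E)) formCoordR.injective

instance normedSpaceCForms : NormedSpace ℝ (CForms E) :=
  NormedSpace.induced ℝ (CForms E) (Fin (Module.finrank ℂ (CForms E)) → ℂ) (formCoordR (E := E))

lemma real_smul_eq (r : ℝ) (ρ : CForms E) : r • ρ = (r : ℂ) • ρ := coe_smul_cforms r ρ

instance finiteReal_cforms : FiniteDimensional ℝ (CForms E) :=
  LinearEquiv.finiteDimensional (formCoordR (E := E)).symm

/-- Coordinates on the space of complex forms, as a continuous linear equivalence. -/
def formCoord : CForms E ≃L[ℝ] (Fin (Module.finrank ℂ (CForms E)) → ℂ) :=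
  (formCoordR (E := E)).toContinuousLinearEquiv

/-- A complex linear map on complex forms is a continuous real linear map. -/
def formCLM {F : Type*} [NormedAddCommGroup F] [NormedSpace ℝ F] [Module ℂ F]
    [IsScalarTower ℝ ℂ F] (l : CForms E →ₗ[ℂ] F) : CForms E →L[ℝ] F :=
  LinearMap.toContinuousLinearMap
    { toFun := l
      map_add' := map_add l
      map_smul' := fun r ρ => by
        exact (congrArg l (real_smul_eq r ρ)).trans
          ((map_smul l (r : ℂ) ρ).trans (algebraMap_smul ℂ r (l ρ))) }

lemma contDiffAt_form_iff {F : Type*} [NormedAddCommGroup F] [NormedSpace ℝ F] {n : WithTop ℕ∞}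
    {ρ : F → CForms E} {y : F} :
    (∀ l : CForms E →ₗ[ℂ] ℂ, ContDiffAt ℝ n (fun z => l (ρ z)) y) ↔ ContDiffAt ℝ n ρ y := by
  constructor
  · intro h
    rw [← (formCoord (E := E)).comp_contDiffAt_iff, contDiffAt_pi]
    intro j
    exact h ((Module.finBasis ℂ (CForms E)).coord j)
  · intro h l
    exact (formCLM l).contDiff.contDiffAt.comp y h

lemma dirDeriv_eq {ρ : E → CForms E} {y : E} (h : DifferentiableAt ℝ ρ y) (v : E) :
    dirDeriv ρ y v = fderiv ℝ ρ y v := by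
  rw [dirDeriv, ← (Module.finBasis ℂ (CForms E)).sum_repr (fderiv ℝ ρ y v)]
  refine Finset.sum_congr rfl fun j _ => ?_
  congr 1
  have h1 := ((formCLM ((Module.finBasis ℂ (CForms E)).coord j)).hasFDerivAt.comp y
    h.hasFDerivAt).fderiv
  have h2 := DFunLike.congr_fun h1 v
  exact h2

/-- `∑ bᵢ* ∧ L(bᵢ)` for a basis `b`. -/
def contractSum {ι : Type*} [Fintype ι] (b : Module.Basis ι ℝ E) (L : E →ₗ[ℝ] CForms E) : CForms E :=
  ∑ i, oneForm (toComplex (LinearMap.toContinuousLinearMap (b.coord i))) * L (b i)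

lemma oneForm_toComplex_sum {ι : Type*} (s : Finset ι) (r : ι → ℝ) (ξ : ι → E →L[ℝ] ℝ) :
    oneForm (toComplex (∑ i ∈ s, r i • ξ i)) = ∑ i ∈ s, (r i : ℂ) • oneForm (toComplex (ξ i)) := by
  classical
  induction s using Finset.induction_on with
  | empty => simp
  | insert a s ha ih =>
    rw [Finset.sum_insert ha, Finset.sum_insert ha, toComplex_add, oneForm_add, ih, toComplex_smul,
      oneForm_smul]

/-- The sum is the image of L ∈ E* ⊗ ⋀• under the exterior product, which involves no basis. -/
lemma contractSum_eq {ι ι' : Type*} [Fintype ι] [Fintype ι'] (b : Module.Basis ι ℝ E)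
    (b' : Module.Basis ι' ℝ E) (L : E →ₗ[ℝ] CForms E) : contractSum b L = contractSum b' L := by
  have h1 : ∀ j, LinearMap.toContinuousLinearMap (b'.coord j) =
      ∑ i, b'.coord j (b i) • LinearMap.toContinuousLinearMap (b.coord i) := by
    intro j
    have h0 : ∀ v, b'.coord j v = ∑ i, b'.coord j (b i) * b.coord i v := by
      intro v
      conv_lhs => rw [← b.sum_repr v]
      simp only [map_sum, map_smul, smul_eq_mul]
      exact Finset.sum_congr rfl fun i _ => mul_comm _ _
    ext v
    simpa using h0 v
  have h2 : ∀ i, L (b i) = ∑ j, (b'.coord j (b i) : ℂ) • L (b' j) := by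
    intro i
    conv_lhs => rw [← b'.sum_repr (b i)]
    rw [map_sum]
    refine Finset.sum_congr rfl fun j _ => ?_
    rw [map_smul, real_smul_eq]; rfl
  rw [contractSum, contractSum]
  simp_rw [h1, oneForm_toComplex_sum, h2, Finset.mul_sum, Finset.sum_mul]
  rw [Finset.sum_comm]
  refine Finset.sum_congr rfl fun j _ => Finset.sum_congr rfl fun i _ => ?_
  rw [mul_smul_comm, smul_mul_assoc]

lemma extDerivE_eq {ρ : E → CForms E} {y : E} (h : DifferentiableAt ℝ ρ y)
    {ι : Type*} [Fintype ι] (b : Module.Basis ι ℝ E) :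
    extDerivE ρ y = contractSum b (fderiv ℝ ρ y).toLinearMap := by
  rw [contractSum_eq b (Module.finBasis ℝ E), extDerivE, contractSum]
  refine Finset.sum_congr rfl fun i _ => ?_
  rw [dirDeriv_eq h]; rfl

/-- The exterior product as a continuous real bilinear map. -/
def mulCLM : CForms E →L[ℝ] CForms E →L[ℝ] CForms E :=
  LinearMap.toContinuousBilinearMap
    (LinearMap.mk₂ ℝ (fun ρ σ : CForms E => ρ * σ) add_mul
      (fun r ρ σ => by simp only [smul_mul_assoc]) mul_add
      (fun r ρ σ => by simp only [mul_smul_comm]))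

lemma hasFDerivAt_form_mul {F : Type*} [NormedAddCommGroup F] [NormedSpace ℝ F]
    {ρ σ : F → CForms E} {y : F} (hρ : DifferentiableAt ℝ ρ y) (hσ : DifferentiableAt ℝ σ y) :
    DifferentiableAt ℝ (fun z => ρ z * σ z) y ∧ ∀ v, fderiv ℝ (fun z => ρ z * σ z) y v =
      ρ y * fderiv ℝ σ y v + fderiv ℝ ρ y v * σ y := by
  have h := mulCLM.hasFDerivAt_of_bilinear hρ.hasFDerivAt hσ.hasFDerivAt
  exact ⟨h.differentiableAt, fun v => DFunLike.congr_fun h.fderiv v⟩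

lemma contDiffAt_form_mul {F : Type*} [NormedAddCommGroup F] [NormedSpace ℝ F] {n : WithTop ℕ∞}
    {ρ σ : F → CForms E} {y : F} (hρ : ContDiffAt ℝ n ρ y) (hσ : ContDiffAt ℝ n σ y) :
    ContDiffAt ℝ n (fun z => ρ z * σ z) y :=
  mulCLM.isBoundedBilinearMap.contDiff.contDiffAt.comp y (hρ.prodMk hσ)

/-- Moving the basis covector dx^i past ρ(y) costs the grade involution, the sign in the Leibniz
rule for mixed degrees. -/
lemma extDerivE_mul {ρ σ : E → CForms E} {y : E} (hρ : DifferentiableAt ℝ ρ y)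
    (hσ : DifferentiableAt ℝ σ y) :
    extDerivE (fun z => ρ z * σ z) y = extDerivE ρ y * σ y + invo (ρ y) * extDerivE σ y := by
  obtain ⟨h1, h2⟩ := hasFDerivAt_form_mul hρ hσ
  rw [extDerivE_eq h1 (Module.finBasis ℝ E), extDerivE_eq hρ (Module.finBasis ℝ E),
    extDerivE_eq hσ (Module.finBasis ℝ E), contractSum, contractSum, contractSum,
    Finset.sum_mul, Finset.mul_sum, ← Finset.sum_add_distrib]
  refine Finset.sum_congr rfl fun i _ => ?_
  change _ * fderiv ℝ (fun z => ρ z * σ z) y _ = _ * fderiv ℝ ρ y _ * σ y +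
    invo (ρ y) * (_ * fderiv ℝ σ y _)
  rw [h2, mul_add, ← mul_assoc, ← mul_assoc, ← mul_assoc, ← oneForm_mul_eq, add_comm]

/-- The Clifford action as a continuous real bilinear map. -/
def actCLM : Gen E →L[ℝ] CForms E →L[ℝ] CForms E :=
  LinearMap.toContinuousBilinearMap
    (LinearMap.mk₂ ℝ (fun (a : Gen E) (ρ : CForms E) => act a ρ)
      (fun a b ρ => LinearMap.congr_fun (actL_add a b) ρ)
      (fun r a ρ => (LinearMap.congr_fun (actL_smul r a) ρ).trans (real_smul_eq r (act a ρ)).symm)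
      (fun a ρ σ => map_add (actL a) ρ σ)
      (fun r a ρ => (congrArg (actL a) (real_smul_eq r ρ)).trans
        ((map_smul (actL a) (r : ℂ) ρ).trans (real_smul_eq r (act a ρ)).symm)))

lemma fderiv_act {a : E → Gen E} {ρ : E → CForms E} {y : E} (ha : DifferentiableAt ℝ a y)
    (hρ : DifferentiableAt ℝ ρ y) :
    DifferentiableAt ℝ (fun z => act (a z) (ρ z)) y ∧
      ∀ v, fderiv ℝ (fun z => act (a z) (ρ z)) y v =
        actL (a y) (fderiv ℝ ρ y v) + actL (fderiv ℝ a y v) (ρ y) := by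
  have h := actCLM.hasFDerivAt_of_bilinear ha.hasFDerivAt hρ.hasFDerivAt
  exact ⟨h.differentiableAt, fun v => DFunLike.congr_fun h.fderiv v⟩

lemma fderiv_actC {a b : E → Gen E} {ρ : E → CForms E} {y : E} (ha : DifferentiableAt ℝ a y)
    (hb : DifferentiableAt ℝ b y) (hρ : DifferentiableAt ℝ ρ y) (v : E) :
    fderiv ℝ (fun z => actC (a z) (b z) (ρ z)) y v =
      actCL (a y) (b y) (fderiv ℝ ρ y v) + actCL (fderiv ℝ a y v) (fderiv ℝ b y v) (ρ y) := by
  obtain ⟨h1, h2⟩ := fderiv_act ha hρ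
  obtain ⟨h3, h4⟩ := fderiv_act hb hρ
  let mulI : CForms E →L[ℝ] CForms E := formCLM (Complex.I • LinearMap.id)
  have h5 := (h1.hasFDerivAt.add (mulI.hasFDerivAt.comp y h3.hasFDerivAt)).fderiv
  have h6 := DFunLike.congr_fun h5 v
  refine h6.trans ?_
  change fderiv ℝ (fun z => act (a z) (ρ z)) y v + Complex.I • fderiv ℝ (fun z => act (b z) (ρ z)) y v
    = _
  rw [h2, h4]
  simp only [actCL, LinearMap.add_apply, LinearMap.smul_apply]
  module

/-- The pairing as a continuous bilinear map. -/
def pairingCLM : Gen E →L[ℝ] Gen E →L[ℝ] ℝ :=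
  LinearMap.toContinuousBilinearMap
    (LinearMap.mk₂ ℝ pairing (fun a b c => by simp [pairing]; ring)
      (fun r a b => by simp [pairing]; ring) (fun a b c => by simp [pairing]; ring)
      (fun r a b => by simp [pairing]; ring))

lemma fderiv_pairing {u v : E → Gen E} {y : E} (hu : DifferentiableAt ℝ u y)
    (hv : DifferentiableAt ℝ v y) :
    DifferentiableAt ℝ (fun z => pairing (u z) (v z)) y ∧
      ∀ w, fderiv ℝ (fun z => pairing (u z) (v z)) y w =
        pairing (u y) (fderiv ℝ v y w) + pairing (fderiv ℝ u y w) (v y) := by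
  have h := pairingCLM.hasFDerivAt_of_bilinear hu.hasFDerivAt hv.hasFDerivAt
  exact ⟨h.differentiableAt, fun v => DFunLike.congr_fun h.fderiv v⟩

/-- The Dorfman bracket in terms of the values and the derivatives of two sections. -/
def dorfman (u v : Gen E) (u' v' : E →L[ℝ] Gen E) : Gen E :=
  v' u.1 - u' v.1 + (0, (2 : ℝ) • (pairingCLM v).comp u')

lemma pairing_comm (a b : Gen E) : pairing a b = pairing b a := by
  simp [pairing]; ring

/-- By Cartan's formula L_Y ξ = ι_Y dξ + d(ξ(Y)), the skew bracket and the Dorfman bracket differ by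
d⟨u | v⟩. -/
lemma courantE_eq {u v : E → Gen E} {y : E} (hu : DifferentiableAt ℝ u y)
    (hv : DifferentiableAt ℝ v y) :
    courantE u v y = dorfman (u y) (v y) (fderiv ℝ u y) (fderiv ℝ v y)
      - (0, fderiv ℝ (fun z => pairing (u z) (v z)) y) := by
  have hu1 : fderiv ℝ (fun z => (u z).1) y = (ContinuousLinearMap.fst ℝ _ _).comp (fderiv ℝ u y) :=
    fderiv.fst hu
  have hu2 : fderiv ℝ (fun z => (u z).2) y = (ContinuousLinearMap.snd ℝ _ _).comp (fderiv ℝ u y) :=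
    fderiv.snd hu
  have hv1 : fderiv ℝ (fun z => (v z).1) y = (ContinuousLinearMap.fst ℝ _ _).comp (fderiv ℝ v y) :=
    fderiv.fst hv
  have hv2 : fderiv ℝ (fun z => (v z).2) y = (ContinuousLinearMap.snd ℝ _ _).comp (fderiv ℝ v y) :=
    fderiv.snd hv
  have e1 := (hv.snd.hasFDerivAt.clm_apply hu.fst.hasFDerivAt)
  have e2 := (hu.snd.hasFDerivAt.clm_apply hv.fst.hasFDerivAt)
  have e3 := (e1.sub e2).fderiv
  apply Prod.ext
  · simp [courantE, dorfman, VectorField.lieBracket, hu1, hv1]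
  · ext w
    have e4 := DFunLike.congr_fun e3 w
    have e5 := (fderiv_pairing hu hv).2 w
    simp only [courantE, lieDerivE, dorfman, Prod.snd_sub, Prod.snd_add,
      sub_apply, add_apply, smul_apply]
    rw [e5]
    change _ - _ - (1 / 2 : ℝ) • (fderiv ℝ _ y w) = _
    erw [e4]
    simp [hu1, hu2, hv1, hv2, pairing, pairingCLM]
    ring

lemma actL_zero : actL (0 : Gen E) = 0 := by simpa using actL_sub (0 : Gen E) 0

lemma actL_sum {ι : Type*} (s : Finset ι) (a : ι → Gen E) :
    actL (∑ i ∈ s, a i) = ∑ i ∈ s, actL (a i) := by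
  classical
  induction s using Finset.induction_on with
  | empty => simp [actL_zero]
  | insert i s hi ih => rw [Finset.sum_insert hi, Finset.sum_insert hi, actL_add, ih]

/-- The covector `bᵢ*` of a basis. -/
abbrev dualVec {ι : Type*} (b : Module.Basis ι ℝ E) (i : ι) : E →L[ℝ] ℂ :=
  toComplex (LinearMap.toContinuousLinearMap (b.coord i))

/-- The Dorfman bracket acts on forms as a derived bracket. -/
lemma actL_dorfman {ι : Type*} [Fintype ι] (b : Module.Basis ι ℝ E) (u v : Gen E)
    (u' v' : E →L[ℝ] Gen E) :
    actL (dorfman u v u' v') = ∑ i,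
      ((wedgeL (dualVec b i) * actL u + actL u * wedgeL (dualVec b i)) * actL (v' (b i))
        + wedgeL (dualVec b i) * actL (u' (b i)) * actL v
        - actL v * wedgeL (dualVec b i) * actL (u' (b i))) := by
  have hexp : ∀ (f : E →L[ℝ] Gen E) (X : E),
      actL (f X) = ∑ i, dualVec b i X • actL (f (b i)) := by
    intro f X
    conv_lhs => rw [← b.sum_repr X]
    rw [map_sum, actL_sum]
    refine Finset.sum_congr rfl fun i _ => ?_
    rw [map_smul, actL_smul]; rfl
  -- The Clifford relation rewrites twice the pairing of u'(b_i) with v as an anticommutator,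
  -- leaving only products of operators.
  have hpair : actL ((0, (2 : ℝ) • (pairingCLM v).comp u') : Gen E) =
      ∑ i, wedgeL (dualVec b i) * (actL (u' (b i)) * actL v + actL v * actL (u' (b i))) := by
    have h0 : (2 : ℝ) • (pairingCLM v).comp u' =
        ∑ i, (2 * pairing (u' (b i)) v) • LinearMap.toContinuousLinearMap (b.coord i) := by
      ext X
      have h1 : u' X = ∑ i, b.coord i X • u' (b i) := by
        conv_lhs => rw [← b.sum_repr X]
        rw [map_sum]
        refine Finset.sum_congr rfl fun i _ => ?_
        rw [map_smul]; rfl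
      simp only [smul_apply, ContinuousLinearMap.comp_apply, h1, map_sum,
        map_smul, sum_apply, smul_eq_mul, Finset.mul_sum]
      refine Finset.sum_congr rfl fun i _ => ?_
      rw [pairing_comm]
      change 2 * (_ * pairing v (u' (b i))) = _ * b.coord i X
      ring
    refine LinearMap.ext fun ρ => ?_
    have h2 : actL ((0, (2 : ℝ) • (pairingCLM v).comp u') : Gen E) ρ =
        oneForm (toComplex ((2 : ℝ) • (pairingCLM v).comp u')) * ρ := by
      change interior (0 : E) ρ + _ = _
      have : interior (0 : E) ρ = 0 := by
        have := interior_smul_left (0 : ℝ) (0 : E) ρ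
        simpa using this
      rw [this, zero_add]; rfl
    rw [h2, h0, oneForm_toComplex_sum, Finset.sum_mul, LinearMap.sum_apply]
    refine Finset.sum_congr rfl fun i _ => ?_
    rw [actL_mul_actL, mul_smul_comm, mul_one, LinearMap.smul_apply, wedgeL_apply, smul_mul_assoc]
  rw [dorfman, actL_add, actL_sub, hexp v', hexp u', hpair, ← Finset.sum_sub_distrib,
    ← Finset.sum_add_distrib]
  refine Finset.sum_congr rfl fun i _ => ?_
  have h1 := wedgeL_mul_actL (dualVec b i) u
  have h2 := wedgeL_mul_actL (dualVec b i) v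
  rw [h1]
  have h3 : dualVec b i v.1 • actL (u' (b i)) =
      (wedgeL (dualVec b i) * actL v + actL v * wedgeL (dualVec b i)) * actL (u' (b i)) := by
    rw [h2, smul_mul_assoc, one_mul]
  rw [h3, smul_mul_assoc, one_mul]
  noncomm_ring

/-- The annihilator of a closed form is involutive. -/
lemma actC_courantE {ρ : E → CForms E} {a b c d : E → Gen E} {y : E}
    (hρ : DifferentiableAt ℝ ρ y) (ha : DifferentiableAt ℝ a y) (hb : DifferentiableAt ℝ b y)
    (hc : DifferentiableAt ℝ c y) (hd : DifferentiableAt ℝ d y) (hclosed : extDerivE ρ y = 0)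
    (hab : ∀ᶠ z in 𝓝 y, actC (a z) (b z) (ρ z) = 0)
    (hcd : ∀ᶠ z in 𝓝 y, actC (c z) (d z) (ρ z) = 0)
    (hp : ∀ᶠ z in 𝓝 y, pairing (a z) (c z) = pairing (b z) (d z))
    (hq : ∀ᶠ z in 𝓝 y, pairing (a z) (d z) = -pairing (b z) (c z)) :
    actC (courantE a c y - courantE b d y) (courantE a d y + courantE b c y) (ρ y) = 0 := by
  let B := Module.finBasis ℝ E
  set D := fun u v : E → Gen E => dorfman (u y) (v y) (fderiv ℝ u y) (fderiv ℝ v y) with hD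
  -- For a + ib and c + id isotropic, the exact corrections cancel in both real and imaginary parts,
  -- so the complex Courant bracket is the complex Dorfman bracket.
  have hre : courantE a c y - courantE b d y = D a c - D b d := by
    rw [courantE_eq ha hc, courantE_eq hb hd, Filter.EventuallyEq.fderiv_eq hp]
    abel
  have him : courantE a d y + courantE b c y = D a d + D b c := by
    have h1 : fderiv ℝ (fun z => pairing (a z) (d z)) y =
        -fderiv ℝ (fun z => pairing (b z) (c z)) y := by
      rw [Filter.EventuallyEq.fderiv_eq hq]
      exact fderiv_neg
    rw [courantE_eq ha hd, courantE_eq hb hc, h1]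
    have h2 : ((0, -fderiv ℝ (fun z => pairing (b z) (c z)) y) : Gen E) =
        -(0, fderiv ℝ (fun z => pairing (b z) (c z)) y) := by simp
    rw [h2]; abel
  set U := actCL (a y) (b y) with hU
  set Vv := actCL (c y) (d y) with hV
  set U' := fun i => actCL (fderiv ℝ a y (B i)) (fderiv ℝ b y (B i)) with hU'
  set V' := fun i => actCL (fderiv ℝ c y (B i)) (fderiv ℝ d y (B i)) with hV'
  set x := fun i => (wedgeL (dualVec B i) : Module.End ℂ (CForms E)) with hx
  have hS : actCL (D a c - D b d) (D a d + D b c) = ∑ i,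
      ((x i * U + U * x i) * V' i + x i * U' i * Vv - Vv * x i * U' i) := by
    rw [actCL, actL_sub, actL_add, hD]
    simp only [actL_dorfman B]
    rw [← Finset.sum_sub_distrib, ← Finset.sum_add_distrib, Finset.smul_sum,
      ← Finset.sum_add_distrib]
    refine Finset.sum_congr rfl fun i _ => ?_
    simp only [hU, hV, hU', hV', hx, actCL]
    simp only [add_mul, mul_add, smul_mul_assoc, mul_smul_comm, smul_add, smul_sub, smul_smul,
      Complex.I_mul_I]
    module
  have hx' : ∀ i, x i * U + U * x i =
      (dualVec B i (a y).1 + Complex.I * dualVec B i (b y).1) • (1 : Module.End ℂ (CForms E)) := by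
    intro i
    rw [add_smul, mul_smul, ← wedgeL_mul_actL, ← wedgeL_mul_actL]
    simp only [hU, hx, actCL, add_mul, mul_add, smul_mul_assoc, mul_smul_comm, smul_add]
    abel
  have hVρ : Vv (ρ y) = 0 := hcd.self_of_nhds
  -- The identity (a + ib)·ρ = 0 holds near y, so it may be differentiated.
  have hUi : ∀ i, U' i (ρ y) = -U (fderiv ℝ ρ y (B i)) := by
    intro i
    have h1 := fderiv_actC ha hb hρ (B i)
    have h2 : fderiv ℝ (fun z => actC (a z) (b z) (ρ z)) y = 0 := by
      rw [Filter.EventuallyEq.fderiv_eq (f := fun _ => (0 : CForms E)) hab]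
      exact fderiv_const_apply 0
    rw [h2] at h1
    exact eq_neg_of_add_eq_zero_right h1.symm
  have hVi : ∀ i, V' i (ρ y) = -Vv (fderiv ℝ ρ y (B i)) := by
    intro i
    have h1 := fderiv_actC hc hd hρ (B i)
    have h2 : fderiv ℝ (fun z => actC (c z) (d z) (ρ z)) y = 0 := by
      rw [Filter.EventuallyEq.fderiv_eq (f := fun _ => (0 : CForms E)) hcd]
      exact fderiv_const_apply 0
    rw [h2] at h1
    exact eq_neg_of_add_eq_zero_right h1.symm
  have hsum : ∑ i, x i (fderiv ℝ ρ y (B i)) = 0 := by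
    rw [extDerivE_eq hρ B] at hclosed
    exact hclosed
  rw [hre, him, ← actCL_apply, hS, LinearMap.sum_apply]
  -- After substitution of the differentiated identities, the scalar terms x_i U + U x_i cancel.
  -- What remains is -V U applied to dx^i ∧ ∂_iρ, and the sum of these is -V U (dρ).
  have hterm : ∀ i, ((x i * U + U * x i) * V' i + x i * U' i * Vv - Vv * x i * U' i) (ρ y) =
      -(Vv (U (x i (fderiv ℝ ρ y (B i))))) := by
    intro i
    have h1 : (x i * U) (fderiv ℝ ρ y (B i)) =
        (dualVec B i (a y).1 + Complex.I * dualVec B i (b y).1) • fderiv ℝ ρ y (B i)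
          - U (x i (fderiv ℝ ρ y (B i))) := by
      have := LinearMap.congr_fun (hx' i) (fderiv ℝ ρ y (B i))
      exact eq_sub_of_add_eq this
    rw [hx', LinearMap.sub_apply, LinearMap.add_apply, Module.End.mul_apply, Module.End.mul_apply,
      Module.End.mul_apply, Module.End.mul_apply, hVρ, hVi, hUi, map_neg, map_neg,
      Module.End.mul_apply, map_zero, map_zero, add_zero]
    rw [Module.End.mul_apply] at h1
    rw [h1, map_sub, map_smul, LinearMap.smul_apply, Module.End.one_apply]
    abel
  simp_rw [hterm]
  rw [Finset.sum_neg_distrib, ← map_sum, ← map_sum, hsum, map_zero, map_zero, neg_zero]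

end Calculus

end GCGeom

/-! ### Naturality under invertible maps, and a calculus of exterior derivatives -/

namespace GCGeom

section Transport

variable {U V W : Type*} [AddCommGroup U] [Module ℝ U] [TopologicalSpace U]
  [AddCommGroup V] [Module ℝ V] [TopologicalSpace V]
  [AddCommGroup W] [Module ℝ W] [TopologicalSpace W]

/-- The push-forward of `X + ξ` along an invertible map. -/
def pushGen (D : V →L[ℝ] W) : Gen V →ₗ[ℝ] Gen W where
  toFun a := (D a.1, a.2.comp D.inverse)
  map_add' a b := by
    apply Prod.ext
    · exact map_add D _ _
    · rfl
  map_smul' r a := by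
    apply Prod.ext
    · exact map_smul D _ _
    · rfl

/-- The pull-back of generalized vectors as a linear map. -/
def pullGenL (D : V →L[ℝ] W) : Gen W →ₗ[ℝ] Gen V where
  toFun a := pullGen D a
  map_add' a b := by
    apply Prod.ext
    · exact map_add D.inverse _ _
    · rfl
  map_smul' r a := by
    apply Prod.ext
    · exact map_smul D.inverse _ _
    · rfl

@[simp] lemma pullGenL_apply (D : V →L[ℝ] W) (a : Gen W) : pullGenL D a = pullGen D a := rfl

lemma pushGen_pullGen {D : V →L[ℝ] W} (hD : D.IsInvertible) (a : Gen W) :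
    pushGen D (pullGen D a) = a := by
  obtain ⟨e, rfl⟩ := hD
  apply Prod.ext
  · simp [pushGen, pullGen]
  · ext v; simp [pushGen, pullGen]

lemma pullGen_pushGen {D : V →L[ℝ] W} (hD : D.IsInvertible) (a : Gen V) :
    pullGen D (pushGen D a) = a := by
  obtain ⟨e, rfl⟩ := hD
  apply Prod.ext
  · simp [pushGen, pullGen]
  · ext v; simp [pushGen, pullGen]

lemma pullGen_comp {D : V →L[ℝ] W} {D' : U →L[ℝ] V} (hD : D.IsInvertible) (hD' : D'.IsInvertible)
    (a : Gen W) : pullGen (D.comp D') a = pullGen D' (pullGen D a) := by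
  obtain ⟨e, rfl⟩ := hD
  obtain ⟨e', rfl⟩ := hD'
  have h : ((e : V →L[ℝ] W).comp (e' : U →L[ℝ] V)) = ((e'.trans e : U ≃L[ℝ] W) : U →L[ℝ] W) := rfl
  apply Prod.ext
  · simp only [pullGen, h, ContinuousLinearMap.inverse_equiv]
    rfl
  · rfl

lemma pairing_pullGen {D : V →L[ℝ] W} (hD : D.IsInvertible) (a b : Gen W) :
    pairing (pullGen D a) (pullGen D b) = pairing a b := by
  obtain ⟨e, rfl⟩ := hD
  simp [pairing, pullGen]

lemma act_pullGen {D : V →L[ℝ] W} (hD : D.IsInvertible) (a : Gen W) (ρ : CForms W) :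
    act (pullGen D a) (pullForm D ρ) = pullForm D (act a ρ) := by
  obtain ⟨e, rfl⟩ := hD
  rw [pullGen, act_pullForm]
  simp

lemma actC_pullGen {D : V →L[ℝ] W} (hD : D.IsInvertible) (a b : Gen W) (ρ : CForms W) :
    actC (pullGen D a) (pullGen D b) (pullForm D ρ) = pullForm D (actC a b ρ) := by
  rw [actC, actC, act_pullGen hD, act_pullGen hD, map_add, map_smul]

lemma pullForm_injective {D : V →L[ℝ] W} (hD : D.IsInvertible) :
    Function.Injective (pullForm D) := by
  obtain ⟨e, rfl⟩ := hD
  have h : ∀ ρ, pullForm (e.symm : W →L[ℝ] V) (pullForm (e : V →L[ℝ] W) ρ) = ρ := by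
    intro ρ
    rw [← pullForm_comp, ContinuousLinearEquiv.coe_comp_coe_symm, pullForm_id]
  exact fun ρ σ hρσ => by rw [← h ρ, hρσ, h]

/-- Pull-back of real forms along a linear map. -/
def pullReal (D : V →L[ℝ] W) : RForms W →ₐ[ℝ] RForms V :=
  ExteriorAlgebra.map
    { toFun := fun ξ => ξ.comp D
      map_add' := fun _ _ => rfl
      map_smul' := fun _ _ => rfl }

@[simp] lemma pullReal_ι (D : V →L[ℝ] W) (ξ : W →L[ℝ] ℝ) :
    pullReal D (ExteriorAlgebra.ι ℝ ξ) = ExteriorAlgebra.ι ℝ (ξ.comp D) :=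
  ExteriorAlgebra.map_apply_ι _ _

lemma complexify_pullReal_two (D : V →L[ℝ] W) (w : ⋀[ℝ]^2 (W →L[ℝ] ℝ)) :
    complexify (pullReal D (w : RForms W)) = pullForm D (complexify (w : RForms W)) := by
  refine two_form_induction
    (p := fun w => complexify (pullReal D w) = pullForm D (complexify w)) ?_ ?_ w
  · intro ξ η
    rw [map_mul, map_mul, map_mul, map_mul, pullReal_ι, pullReal_ι, complexify_ι, complexify_ι,
      complexify_ι, complexify_ι, pullForm_oneForm, pullForm_oneForm]
    rfl
  · intro a b ha hb
    rw [map_add, map_add, map_add, map_add, ha, hb]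

/-- Pull-back of real two-forms. -/
def pullTwo (D : V →L[ℝ] W) (w : ⋀[ℝ]^2 (W →L[ℝ] ℝ)) : ⋀[ℝ]^2 (V →L[ℝ] ℝ) :=
  ⟨pullReal D w, by
    refine two_form_induction (p := fun w => pullReal D w ∈ ⋀[ℝ]^2 (V →L[ℝ] ℝ)) ?_ ?_ w
    · intro ξ η
      rw [map_mul, pullReal_ι, pullReal_ι]
      exact mul_mem_exteriorPower (ι_mem_exteriorPower_one _) (ι_mem_exteriorPower_one _)
    · intro a b ha hb
      rw [map_add]
      exact add_mem ha hb⟩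

end Transport

section Calculus

variable {E : Type*} [NormedAddCommGroup E] [NormedSpace ℝ E] [FiniteDimensional ℝ E]

lemma contDiffAt_oneForm {F : Type*} [NormedAddCommGroup F] [NormedSpace ℝ F] {n : WithTop ℕ∞}
    {η : F → E →L[ℝ] ℂ} {y : F} (h : ContDiffAt ℝ n η y) :
    ContDiffAt ℝ n (fun z => oneForm (η z)) y := by
  let l : (E →L[ℝ] ℂ) →ₗ[ℝ] CForms E :=
    { toFun := fun η => oneForm η
      map_add' := oneForm_add
      map_smul' := fun r η => by
        have h1 : r • η = (r : ℂ) • η := (Complex.coe_smul r η).symm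
        rw [h1, oneForm_smul]
        exact (real_smul_eq r (oneForm η)).symm }
  exact (LinearMap.toContinuousLinearMap l).contDiff.contDiffAt.comp y h

/-- Pulling back a fixed form is polynomial in the linear map; the induction follows the generators
of the algebra. -/
lemma contDiffAt_pullForm {F : Type*} [NormedAddCommGroup F] [NormedSpace ℝ F] {n : WithTop ℕ∞}
    {W : Type*} [NormedAddCommGroup W] [NormedSpace ℝ W]
    {D : F → E →L[ℝ] W} {y : F} (h : ContDiffAt ℝ n D y) (ρ : CForms W) :
    ContDiffAt ℝ n (fun z => pullForm (D z) ρ) y := by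
  induction ρ using ExteriorAlgebra.induction with
  | algebraMap c =>
    simp only [AlgHom.commutes]
    exact contDiffAt_const
  | ι θ =>
    have h1 : ∀ z, pullForm (D z) (ExteriorAlgebra.ι ℂ θ) = oneForm (θ.comp (D z)) :=
      fun z => pullForm_oneForm (D z) θ
    simp only [h1]
    exact contDiffAt_oneForm (contDiffAt_const.clm_comp h)
  | mul a b ha hb =>
    simp only [map_mul]
    exact contDiffAt_form_mul ha hb
  | add a b ha hb =>
    simp only [map_add]
    exact ha.add hb

/-- `ρ` is differentiable at `y` with exterior derivative `σ`. -/
def HasExtDerivAt (ρ : E → CForms E) (σ : CForms E) (y : E) : Prop :=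
  DifferentiableAt ℝ ρ y ∧ extDerivE ρ y = σ

namespace HasExtDerivAt

variable {ρ ρ' : E → CForms E} {σ σ' : CForms E} {y : E}

lemma congr (h : HasExtDerivAt ρ σ y) (e : ρ = ρ') (e' : σ = σ') : HasExtDerivAt ρ' σ' y := by
  subst e e'; exact h

lemma mul (h : HasExtDerivAt ρ σ y) (h' : HasExtDerivAt ρ' σ' y) :
    HasExtDerivAt (fun z => ρ z * ρ' z) (σ * ρ' y + invo (ρ y) * σ') y :=
  ⟨(hasFDerivAt_form_mul h.1 h'.1).1, by rw [extDerivE_mul h.1 h'.1, h.2, h'.2]⟩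

lemma add (h : HasExtDerivAt ρ σ y) (h' : HasExtDerivAt ρ' σ' y) :
    HasExtDerivAt (fun z => ρ z + ρ' z) (σ + σ') y := by
  refine ⟨h.1.add h'.1, ?_⟩
  have h1 := (h.1.hasFDerivAt.add h'.1.hasFDerivAt).fderiv
  change extDerivE (ρ + ρ') y = σ + σ'
  rw [extDerivE_eq (h.1.add h'.1) (Module.finBasis ℝ E), ← h.2, ← h'.2,
    extDerivE_eq h.1 (Module.finBasis ℝ E), extDerivE_eq h'.1 (Module.finBasis ℝ E),
    contractSum, contractSum, contractSum, ← Finset.sum_add_distrib]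
  refine Finset.sum_congr rfl fun i _ => ?_
  rw [← mul_add]
  congr 1
  exact DFunLike.congr_fun h1 _

lemma const (ρ : CForms E) : HasExtDerivAt (fun _ => ρ) 0 y := by
  refine ⟨differentiableAt_const ρ, ?_⟩
  rw [extDerivE_eq (differentiableAt_const ρ) (Module.finBasis ℝ E), contractSum]
  refine Finset.sum_eq_zero fun i _ => ?_
  have : fderiv ℝ (fun _ : E => ρ) y = 0 := fderiv_const_apply ρ
  rw [this]
  exact mul_zero _

/-- The exterior derivative of a function times a constant form. -/
lemma smul_const {f : E → ℝ} {f' : E →L[ℝ] ℝ} (hf : HasFDerivAt f f' y) (ρ : CForms E) :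
    HasExtDerivAt (fun z => (f z : ℂ) • ρ) (oneForm (toComplex f') * ρ) y := by
  let l : ℝ →L[ℝ] CForms E := LinearMap.toContinuousLinearMap (LinearMap.toSpanSingleton ℝ _ ρ)
  have h1 : (fun z => (f z : ℂ) • ρ) = fun z => l (f z) := by
    funext z; exact (real_smul_eq (f z) ρ).symm
  have h2 : HasFDerivAt (fun z => (f z : ℂ) • ρ) (l.comp f') y := by
    rw [h1]; exact l.hasFDerivAt.comp y hf
  refine ⟨h2.differentiableAt, ?_⟩
  rw [extDerivE_eq h2.differentiableAt (Module.finBasis ℝ E), h2.fderiv, contractSum]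
  have h3 : f' = ∑ i, f' (Module.finBasis ℝ E i) •
      LinearMap.toContinuousLinearMap ((Module.finBasis ℝ E).coord i) := by
    ext v
    conv_lhs => rw [← (Module.finBasis ℝ E).sum_repr v]
    simp only [map_sum, map_smul, sum_apply, smul_apply, smul_eq_mul]
    exact Finset.sum_congr rfl fun i _ => mul_comm _ _
  conv_rhs => rw [h3, oneForm_toComplex_sum, Finset.sum_mul]
  refine Finset.sum_congr rfl fun i _ => ?_
  rw [smul_mul_assoc, ← mul_smul_comm]
  congr 1

lemma const_smul (h : HasExtDerivAt ρ σ y) (c : ℂ) : HasExtDerivAt (fun z => c • ρ z) (c • σ) y := by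
  have h1 := (const (y := y) (algebraMap ℂ (CForms E) c)).mul h
  refine h1.congr ?_ ?_
  · funext z; exact (Algebra.smul_def c (ρ z)).symm
  · rw [zero_mul, zero_add, AlgHom.commutes, ← Algebra.smul_def]

end HasExtDerivAt

end Calculus

end GCGeom

/-! ### The left-invariant coframe in coordinates -/

namespace NilGroup

variable {α : ℝ}

/-- The matrix of the left-invariant coframe at `y` in the coordinates of `ℝ⁸`. -/
def coframe (α : ℝ) (y : Fin 8 → ℝ) : (Fin 8 → ℝ) →L[ℝ] (Fin 8 → ℝ) :=
  let p : Fin 8 → (Fin 8 → ℝ) →L[ℝ] ℝ := fun i => ContinuousLinearMap.proj i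
  ContinuousLinearMap.pi ![p 0, p 1, p 2, p 3,
    p 4 + y 0 • p 1,
    p 5 + y 0 • p 4 + (y 0 ^ 2 / 2) • p 1 + ((1 - α) * y 1) • p 3,
    p 6 - ((1 + α) * y 0) • p 3 - y 1 • p 2 + ((1 + α) * y 1) • p 4,
    p 7 + y 0 • p 5 + y 1 • p 6 + (y 0 ^ 2 / 2 + (1 + α) * y 1 ^ 2 / 2 - 2 * y 3) • p 4
      + (y 0 ^ 3 / 6) • p 1 - (y 1 ^ 2 / 2) • p 2 + (y 2 + (1 - α) * (y 0 * y 1)) • p 3]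

lemma coframe_apply (y v : Fin 8 → ℝ) : coframe α y v = ![v 0, v 1, v 2, v 3,
    v 4 + y 0 * v 1,
    v 5 + y 0 * v 4 + y 0 ^ 2 / 2 * v 1 + (1 - α) * y 1 * v 3,
    v 6 - (1 + α) * y 0 * v 3 - y 1 * v 2 + (1 + α) * y 1 * v 4,
    v 7 + y 0 * v 5 + y 1 * v 6 + (y 0 ^ 2 / 2 + (1 + α) * y 1 ^ 2 / 2 - 2 * y 3) * v 4
      + y 0 ^ 3 / 6 * v 1 - y 1 ^ 2 / 2 * v 2 + (y 2 + (1 - α) * (y 0 * y 1)) * v 3] := by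
  funext i
  fin_cases i <;> rfl

lemma contDiff_coframe : ContDiff ℝ ∞ (coframe α) := by
  rw [contDiff_clm_apply_iff]
  intro v
  rw [contDiff_pi]
  intro i
  simp only [coframe_apply]
  fin_cases i <;> simp <;> fun_prop

/-- The matrix is triangular with ones on the diagonal, so the coordinates of a kernel vector vanish
successively. -/
lemma coframe_injective (y : Fin 8 → ℝ) : Function.Injective (coframe α y) := by
  refine (injective_iff_map_eq_zero _).2 fun v hv => ?_
  have h := congrFun hv
  simp only [coframe_apply] at h
  have h0 : v 0 = 0 := h 0
  have h1 : v 1 = 0 := h 1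
  have h2 : v 2 = 0 := h 2
  have h3 : v 3 = 0 := h 3
  have h4 : v 4 = 0 := by simpa [h1] using h 4
  have h5 : v 5 = 0 := by simpa [h1, h3, h4] using h 5
  have h6 : v 6 = 0 := by simpa [h2, h3, h4] using h 6
  have h7 : v 7 = 0 := by simpa [h1, h2, h3, h4, h5, h6] using h 7
  funext i
  fin_cases i <;> assumption

lemma coframe_isInvertible (y : Fin 8 → ℝ) : (coframe α y).IsInvertible := by
  have h := (coframe_injective (α := α) y)
  let e := LinearEquiv.ofInjectiveEndo (coframe α y).toLinearMap h
  exact ⟨e.toContinuousLinearEquiv, by ext v : 1; rfl⟩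

/-- The directional derivative of a left translation. -/
def leftDeriv (α : ℝ) (g y v : Fin 8 → ℝ) : Fin 8 → ℝ :=
  ![v 0, v 1, v 2, v 3, v 4 - g 0 * v 1,
    v 5 - g 0 * v 4 + g 0 ^ 2 / 2 * v 1 - (1 - α) * g 1 * v 3,
    v 6 + (1 + α) * g 0 * v 3 + g 1 * v 2 - (1 + α) * g 1 * v 4
      + (1 + α) * g 0 * (g 1 * v 1 + y 1 * v 1),
    v 7 - g 0 * v 5 - g 1 * v 6 + (g 0 ^ 2 / 2 + (1 + α) * g 1 ^ 2 / 2 + 2 * g 3) * v 4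
      - g 1 ^ 2 / 2 * v 2 - (g 2 + (1 + α) * g 0 * g 1) * v 3
      - 2 * g 0 * (y 1 * v 3 + v 1 * y 3) - g 0 ^ 3 / 6 * v 1 - 2 * g 0 * g 3 * v 1
      - (1 + α) / 6 * g 0 * (3 * g 1 ^ 2 * v 1 + 6 * g 1 * y 1 * v 1 + 3 * y 1 ^ 2 * v 1)]

lemma differentiable_mulVec (g : Fin 8 → ℝ) : Differentiable ℝ (mulVec α g) :=
  ((contDiff_mulVec (α := α)).comp (contDiff_const.prodMk contDiff_id)).differentiable (by simp)

/-- Along the line y + tv the group law is a polynomial of degree at most 3 in t, and the derivative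
at 0 is its linear coefficient. -/
lemma fderiv_mulVec (g y v : Fin 8 → ℝ) : fderiv ℝ (mulVec α g) y v = leftDeriv α g y v := by
  have h1 : HasDerivAt (fun t : ℝ => mulVec α g (y + t • v)) (fderiv ℝ (mulVec α g) y v) 0 := by
    have h2 : HasDerivAt (fun t : ℝ => y + t • v) v 0 := by
      simpa using ((hasDerivAt_id (0 : ℝ)).smul_const v).const_add y
    have h3 : HasFDerivAt (mulVec α g) (fderiv ℝ (mulVec α g) y) (y + (0 : ℝ) • v) := by
      simpa using (differentiable_mulVec g y).hasFDerivAt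
    exact h3.comp_hasDerivAt 0 h2
  have hcubic : ∀ a b c d : ℝ, HasDerivAt (fun t : ℝ => a + b * t + c * t ^ 2 + d * t ^ 3) b 0 := by
    intro a b c d
    have := (((hasDerivAt_id (0 : ℝ)).const_mul b).const_add a).add
      (((hasDerivAt_pow 2 (0 : ℝ)).const_mul c).add ((hasDerivAt_pow 3 (0 : ℝ)).const_mul d))
    refine HasDerivAt.congr_deriv (f := fun t : ℝ => a + b * t + c * t ^ 2 + d * t ^ 3) ?_
      (by simp : b * 1 + (c * (((2 : ℕ) : ℝ) * 0 ^ 1) + d * (((3 : ℕ) : ℝ) * 0 ^ 2)) = b)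
    convert this using 1
    funext t; simp; ring
  have h4 : HasDerivAt (fun t : ℝ => mulVec α g (y + t • v)) (leftDeriv α g y v) 0 := by
    rw [hasDerivAt_pi]
    intro i
    -- The two vectors supplied below are the coefficients of t² and t³; only the last two
    -- coordinates of the group law are nonlinear in the second factor.
    refine (hcubic (mulVec α g y i) (leftDeriv α g y v i)
      (![0, 0, 0, 0, 0, 0, (1 + α) * g 0 * (v 1 ^ 2 / 2),
        -2 * g 0 * (v 1 * v 3) - (1 + α) / 6 * g 0 * (3 * g 1 * v 1 ^ 2 + 3 * y 1 * v 1 ^ 2)] i)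
      (![0, 0, 0, 0, 0, 0, 0, - (1 + α) / 6 * g 0 * v 1 ^ 3] i)).congr_of_eventuallyEq
      (Filter.Eventually.of_forall fun t => ?_)
    fin_cases i <;> simp [mulVec, leftDeriv] <;> ring
  exact h1.unique h4

/-- The coframe is left-invariant. -/
lemma coframe_mulVec (g y : Fin 8 → ℝ) :
    (coframe α (mulVec α g y)).comp (fderiv ℝ (mulVec α g) y) = coframe α y := by
  ext v : 1
  rw [ContinuousLinearMap.comp_apply, fderiv_mulVec, coframe_apply, coframe_apply]
  funext i
  fin_cases i <;> simp [mulVec, leftDeriv] <;> ring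

lemma coframe_zero : coframe α 0 = ContinuousLinearMap.id ℝ _ := by
  ext v : 1
  rw [coframe_apply]
  funext i
  fin_cases i <;> simp

end NilGroup

/-! ### The projection, the charts and the invariant frame on the quotient -/

namespace Nilmanifold

open GCGeom NilGroup

variable {α : ℝ} {Γ : Subgroup (NilGroup α)}

/-- The projection in the coordinates of `ℝ⁸`. -/
def projVec (Γ : Subgroup (NilGroup α)) (y : Fin 8 → ℝ) : Nilmanifold α Γ := proj Γ (ofVec y)

lemma projVec_mulVec {γ : Fin 8 → ℝ} (hγ : ofVec γ ∈ Γ) (y : Fin 8 → ℝ) :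
    projVec Γ (mulVec α γ y) = projVec Γ y :=
  proj_smul (⟨ofVec γ, hγ⟩ : Γ) (ofVec y)

variable [DiscreteTopology Γ]

lemma chart_symm (x : Nilmanifold α Γ) : ⇑(chartAt (Fin 8 → ℝ) x).symm = projVec Γ :=
  funext fun y => symm_of_mem_atlas _ (chart_mem_atlas _ x) y

/-- The centre of the preferred chart. -/
def center (x : Nilmanifold α Γ) : Fin 8 → ℝ := chartAt (Fin 8 → ℝ) x x

lemma center_mem (x : Nilmanifold α Γ) : center x ∈ (chartAt (Fin 8 → ℝ) x).target :=
  mem_chart_target _ x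

lemma projVec_center (x : Nilmanifold α Γ) : projVec Γ (center x) = x := by
  rw [← chart_symm x]
  exact (chartAt (Fin 8 → ℝ) x).left_inv (mem_chart_source _ x)

/-- The derivative of the projection. -/
def dproj (Γ : Subgroup (NilGroup α)) [DiscreteTopology Γ] (y : Fin 8 → ℝ) :
    (Fin 8 → ℝ) →L[ℝ] (Fin 8 → ℝ) :=
  mfderiv 𝓘(ℝ, Fin 8 → ℝ) 𝓘(ℝ, Fin 8 → ℝ) (projVec Γ) y

/-- The derivative of the preferred chart at its centre. -/
def dchart (x : Nilmanifold α Γ) : (Fin 8 → ℝ) →L[ℝ] (Fin 8 → ℝ) :=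
  mfderiv 𝓘(ℝ, Fin 8 → ℝ) 𝓘(ℝ, Fin 8 → ℝ) (chartAt (Fin 8 → ℝ) x) x

lemma mdifferentiableAt_projVec_center (x : Nilmanifold α Γ) :
    MDifferentiableAt 𝓘(ℝ, Fin 8 → ℝ) 𝓘(ℝ, Fin 8 → ℝ) (projVec Γ) (center x) := by
  rw [← chart_symm x]
  exact mdifferentiableAt_atlas_symm (chart_mem_atlas _ x) (center_mem x)

lemma dchart_comp_dproj (x : Nilmanifold α Γ) :
    (dchart x).comp (dproj Γ (center x)) = ContinuousLinearMap.id ℝ _ := by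
  have h := (mdifferentiable_chart (I := 𝓘(ℝ, Fin 8 → ℝ)) x).comp_symm_deriv (center_mem x)
  have h2 : (chartAt (Fin 8 → ℝ) x).symm (center x) = x := by rw [chart_symm, projVec_center]
  -- The tangent spaces depend on the point, so the point and the map are generalized before the
  -- equalities are substituted.
  have key : ∀ (q : Nilmanifold α Γ) (f : (Fin 8 → ℝ) → Nilmanifold α Γ), q = x → f = projVec Γ →
      (mfderiv 𝓘(ℝ, Fin 8 → ℝ) 𝓘(ℝ, Fin 8 → ℝ) (chartAt (Fin 8 → ℝ) x) q).comp
        (mfderiv 𝓘(ℝ, Fin 8 → ℝ) 𝓘(ℝ, Fin 8 → ℝ) f (center x) :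
          (Fin 8 → ℝ) →L[ℝ] TangentSpace 𝓘(ℝ, Fin 8 → ℝ) q) = ContinuousLinearMap.id ℝ _ →
      (dchart x).comp (dproj Γ (center x)) = ContinuousLinearMap.id ℝ _ := by
    rintro q f rfl rfl h
    exact h
  exact key _ _ h2 (chart_symm x) h

/-- Any point of a fibre is moved by Γ to the centre of the chart, which carries facts known at
chart centres to all of ℝ⁸. -/
lemma exists_mulVec_eq_center (y : Fin 8 → ℝ) :
    ∃ γ : Fin 8 → ℝ, ofVec γ ∈ Γ ∧ mulVec α γ y = center (projVec Γ y) := by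
  have h : proj Γ (ofVec (center (projVec Γ y))) = proj Γ (ofVec y) := projVec_center _
  obtain ⟨γ, hγ⟩ := proj_eq_iff.1 h
  exact ⟨(γ : NilGroup α), γ.2, hγ⟩

lemma mdifferentiableAt_mulVec (g y : Fin 8 → ℝ) :
    MDifferentiableAt 𝓘(ℝ, Fin 8 → ℝ) 𝓘(ℝ, Fin 8 → ℝ) (mulVec α g) y :=
  (differentiable_mulVec g y).mdifferentiableAt

lemma mdifferentiableAt_projVec (y : Fin 8 → ℝ) :
    MDifferentiableAt 𝓘(ℝ, Fin 8 → ℝ) 𝓘(ℝ, Fin 8 → ℝ) (projVec Γ) y := by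
  obtain ⟨γ, hγ, h⟩ := exists_mulVec_eq_center (Γ := Γ) y
  have h1 : projVec Γ = projVec Γ ∘ mulVec α γ := funext fun z => (projVec_mulVec hγ z).symm
  rw [h1]
  have h2 := mdifferentiableAt_projVec_center (projVec Γ y)
  rw [← h] at h2
  exact h2.comp y (mdifferentiableAt_mulVec γ y)

lemma dproj_comp {f : (Fin 8 → ℝ) → (Fin 8 → ℝ)} {y : Fin 8 → ℝ} (hf : DifferentiableAt ℝ f y) :
    mfderiv 𝓘(ℝ, Fin 8 → ℝ) 𝓘(ℝ, Fin 8 → ℝ) (projVec Γ ∘ f) y =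
      (dproj Γ (f y)).comp (fderiv ℝ f y) := by
  rw [mfderiv_comp y (mdifferentiableAt_projVec (f y)) hf.mdifferentiableAt, mfderiv_eq_fderiv]
  rfl

lemma dproj_mulVec {γ : Fin 8 → ℝ} (hγ : ofVec γ ∈ Γ) (y : Fin 8 → ℝ) :
    dproj Γ y = (dproj Γ (mulVec α γ y)).comp (fderiv ℝ (mulVec α γ) y) := by
  have h1 : projVec Γ ∘ mulVec α γ = projVec Γ := funext fun z => projVec_mulVec hγ z
  have h2 := dproj_comp (Γ := Γ) (differentiable_mulVec (α := α) γ y)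
  rw [h1] at h2
  exact h2

/-- The invariant trivialization of the tangent bundle. -/
def frame (x : Nilmanifold α Γ) : TangentSpace 𝓘(ℝ, Fin 8 → ℝ) x →L[ℝ] (Fin 8 → ℝ) :=
  (coframe α (center x)).comp (dchart x)

/-- The frame is defined at one point of each fibre. Left-invariance of the coframe under Γ makes
its pull-back the coframe at every other point of the fibre: the coframe descends. -/
lemma frame_comp_dproj (Γ : Subgroup (NilGroup α)) [DiscreteTopology Γ] (y : Fin 8 → ℝ) :
    (frame (projVec Γ y) : (Fin 8 → ℝ) →L[ℝ] (Fin 8 → ℝ)).comp (dproj Γ y) = coframe α y := by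
  obtain ⟨γ, hγ, h⟩ := exists_mulVec_eq_center (Γ := Γ) y
  rw [dproj_mulVec hγ, h]
  change ((coframe α (center (projVec Γ y))).comp (dchart (projVec Γ y))).comp
    ((dproj Γ (center (projVec Γ y))).comp (fderiv ℝ (mulVec α γ) y)) = _
  rw [ContinuousLinearMap.comp_assoc, ← ContinuousLinearMap.comp_assoc (dchart _),
    dchart_comp_dproj, ContinuousLinearMap.id_comp, ← h, coframe_mulVec]

lemma isInvertible_of_comp_eq_id {D D' : (Fin 8 → ℝ) →L[ℝ] (Fin 8 → ℝ)}
    (h : D.comp D' = ContinuousLinearMap.id ℝ _) : D.IsInvertible := by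
  have h1 : D'.comp D = ContinuousLinearMap.id ℝ _ := by
    have h2 : D.toLinearMap * D'.toLinearMap = 1 := by
      refine LinearMap.ext fun v => ?_
      exact DFunLike.congr_fun h v
    have h3 := mul_eq_one_comm.1 h2
    ext v : 1
    exact LinearMap.congr_fun h3 v
  exact ⟨ContinuousLinearEquiv.equivOfInverse D D' (fun v => DFunLike.congr_fun h1 v)
    (fun v => DFunLike.congr_fun h v), rfl⟩

lemma dchart_isInvertible (x : Nilmanifold α Γ) : (dchart x).IsInvertible :=
  isInvertible_of_comp_eq_id (dchart_comp_dproj x)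

lemma frame_isInvertible (x : Nilmanifold α Γ) : (frame x).IsInvertible :=
  (coframe_isInvertible (α := α) (center x)).comp (dchart_isInvertible x)

lemma dproj_isInvertible (y : Fin 8 → ℝ) : (dproj Γ y).IsInvertible := by
  obtain ⟨e, he⟩ := frame_isInvertible (projVec Γ y)
  obtain ⟨e', he'⟩ := coframe_isInvertible (α := α) y
  refine ⟨e'.trans e.symm, ?_⟩
  have h := frame_comp_dproj Γ y
  rw [← he, ← he'] at h
  ext v : 1
  have h1 := DFunLike.congr_fun h v
  exact (e.symm_apply_eq.2 h1.symm)

end Nilmanifold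

/-! ### Invariant forms and invariant generalized complex structures -/

namespace Nilmanifold

open GCGeom NilGroup

variable {α : ℝ} {Γ : Subgroup (NilGroup α)} [DiscreteTopology Γ]

/-- The form on the nilmanifold which is constant in the invariant frame. -/
def invariantForm (Γ : Subgroup (NilGroup α)) [DiscreteTopology Γ] (ρ : CForms (Fin 8 → ℝ)) :
    FormField (Fin 8 → ℝ) (Nilmanifold α Γ) := fun x => pullForm (frame x) ρ

/-- The chart at x disappears from the right-hand side, so local computations are the same at every
point and take place on ℝ⁸. -/
lemma formRep_invariantForm (ρ : CForms (Fin 8 → ℝ)) (x : Nilmanifold α Γ) (y : Fin 8 → ℝ) :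
    formRep (invariantForm Γ ρ) x y = pullForm (coframe α y) ρ := by
  have key : ∀ f : (Fin 8 → ℝ) → Nilmanifold α Γ, f = projVec Γ →
      pullForm (W := TangentSpace 𝓘(ℝ, Fin 8 → ℝ) (f y))
        (mfderiv 𝓘(ℝ, Fin 8 → ℝ) 𝓘(ℝ, Fin 8 → ℝ) f y)
        (pullForm (frame (f y)) ρ) = pullForm (coframe α y) ρ := by
    rintro f rfl
    rw [← frame_comp_dproj Γ y]
    exact (pullForm_comp (frame (projVec Γ y)) _ ρ).symm
  exact key _ (chart_symm x)

lemma genRep_eq (u : GenField (Fin 8 → ℝ) (Nilmanifold α Γ)) (x : Nilmanifold α Γ)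
    (y : Fin 8 → ℝ) :
    genRep u x y = pullGen (W := Fin 8 → ℝ) (dproj Γ y) (u (projVec Γ y)) := by
  have key : ∀ f : (Fin 8 → ℝ) → Nilmanifold α Γ, f = projVec Γ →
      pullGen (V := Fin 8 → ℝ) (W := TangentSpace 𝓘(ℝ, Fin 8 → ℝ) (f y))
        (mfderiv 𝓘(ℝ, Fin 8 → ℝ) 𝓘(ℝ, Fin 8 → ℝ) f y) (u (f y)) =
        pullGen (W := Fin 8 → ℝ) (dproj Γ y) (u (projVec Γ y)) := by
    rintro f rfl
    rfl
  exact key _ (chart_symm x)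

lemma contDiffAt_coframe {n : WithTop ℕ∞} (hn : n ≤ ∞) (y : Fin 8 → ℝ) :
    ContDiffAt ℝ n (coframe α) y :=
  (contDiff_coframe.of_le hn).contDiffAt

lemma smoothForm_invariantForm (ρ : CForms (Fin 8 → ℝ)) : SmoothForm (invariantForm Γ ρ) := by
  intro x
  rw [contDiffAt_form_iff]
  have h : formRep (invariantForm Γ ρ) x = fun y => pullForm (coframe α y) ρ :=
    funext fun y => formRep_invariantForm ρ x y
  rw [h]
  exact contDiffAt_pullForm (contDiffAt_coframe le_rfl _) ρ

lemma extDerivM_invariantForm {ρ σ : CForms (Fin 8 → ℝ)} (x : Nilmanifold α Γ)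
    (h : ∀ y, HasExtDerivAt (fun z => pullForm (coframe α z) ρ) (pullForm (coframe α y) σ) y) :
    extDerivM (invariantForm Γ ρ) x = invariantForm Γ σ x := by
  have h1 : formRep (invariantForm Γ ρ) x = fun y => pullForm (coframe α y) ρ :=
    funext fun y => formRep_invariantForm ρ x y
  have h2 : extDerivE (formRep (invariantForm Γ ρ) x) (center x) =
      pullForm (coframe α (center x)) σ := by
    rw [h1]; exact (h _).2
  refine (congrArg (pullForm (V := Fin 8 → ℝ) (W := Fin 8 → ℝ) (dchart x)) h2).trans ?_
  exact (pullForm_comp (coframe α (center x)) (dchart x) σ).symm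

lemma frame_comp_mfderiv_translate (g h : NilGroup α) :
    (frame (proj Γ (g * h))).comp
      (mfderiv 𝓘(ℝ, Fin 8 → ℝ) 𝓘(ℝ, Fin 8 → ℝ) (fun k : NilGroup α => proj Γ (g * k)) h) =
      coframe α h := by
  have h1 := dproj_comp (Γ := Γ) (differentiable_mulVec (α := α) g h)
  have h2 : mfderiv 𝓘(ℝ, Fin 8 → ℝ) 𝓘(ℝ, Fin 8 → ℝ) (fun k : NilGroup α => proj Γ (g * k)) h =
    (dproj Γ (mulVec α g h)).comp (fderiv ℝ (mulVec α g) h) := h1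
  have h3 : ∀ g h : Fin 8 → ℝ, ((frame (projVec Γ (mulVec α g h)) :
      (Fin 8 → ℝ) →L[ℝ] (Fin 8 → ℝ)).comp (dproj Γ (mulVec α g h))).comp
        (fderiv ℝ (mulVec α g) h) = coframe α h := by
    intro g h
    rw [frame_comp_dproj, coframe_mulVec]
  rw [h2]
  exact h3 g h

lemma frame_comp_mfderiv_proj (h : NilGroup α) :
    (frame (proj Γ h)).comp (mfderiv 𝓘(ℝ, Fin 8 → ℝ) 𝓘(ℝ, Fin 8 → ℝ) (proj Γ) h) = coframe α h :=
  frame_comp_dproj Γ h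

lemma invariantForm_invariantForm (ρ : CForms (Fin 8 → ℝ)) :
    InvariantForm (invariantForm Γ ρ) := by
  intro g h
  rw [invariantForm, invariantForm, ← pullForm_comp, ← pullForm_comp,
    frame_comp_mfderiv_translate, frame_comp_mfderiv_proj]

/-- The invariant coframe. -/
def coframeForm (Γ : Subgroup (NilGroup α)) [DiscreteTopology Γ] (i : Fin 8)
    (x : Nilmanifold α Γ) : TangentSpace 𝓘(ℝ, Fin 8 → ℝ) x →L[ℝ] ℝ :=
  (ContinuousLinearMap.proj i : (Fin 8 → ℝ) →L[ℝ] ℝ).comp (frame x)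

lemma isInvariantCoframe_coframeForm : IsInvariantCoframe (coframeForm Γ) := by
  constructor
  · intro i g h
    rw [coframeForm, coframeForm, ContinuousLinearMap.comp_assoc, ContinuousLinearMap.comp_assoc,
      frame_comp_mfderiv_translate, frame_comp_mfderiv_proj]
  · intro i v
    have h1 := DFunLike.congr_fun (frame_comp_mfderiv_proj (Γ := Γ) 1) v
    have h2 : coframe α (1 : NilGroup α) = ContinuousLinearMap.id ℝ _ := coframe_zero
    rw [h2] at h1
    exact congrFun h1 i

/-- The endomorphism of `TM ⊕ T*M` which is constant in the invariant frame. -/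
def transportJ (J : Gen (Fin 8 → ℝ) →ₗ[ℝ] Gen (Fin 8 → ℝ)) (x : Nilmanifold α Γ) :
    Gen (TangentSpace 𝓘(ℝ, Fin 8 → ℝ) x) →ₗ[ℝ] Gen (TangentSpace 𝓘(ℝ, Fin 8 → ℝ) x) :=
  (pullGenL (frame x)).comp (J.comp (pushGen (frame x)))

lemma transportJ_apply (J : Gen (Fin 8 → ℝ) →ₗ[ℝ] Gen (Fin 8 → ℝ)) (x : Nilmanifold α Γ) (a) :
    transportJ J x a = pullGen (frame x) (J (pushGen (frame x) a)) := rfl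

lemma transportJ_pullGen (J : Gen (Fin 8 → ℝ) →ₗ[ℝ] Gen (Fin 8 → ℝ)) (x : Nilmanifold α Γ) (a) :
    transportJ J x (pullGen (frame x) a) = pullGen (frame x) (J a) := by
  rw [transportJ_apply, pushGen_pullGen (frame_isInvertible x)]

/-- The expression of `transportJ` in coordinates. -/
def transportE (α : ℝ) (J : Gen (Fin 8 → ℝ) →ₗ[ℝ] Gen (Fin 8 → ℝ)) (y : Fin 8 → ℝ)
    (a : Gen (Fin 8 → ℝ)) : Gen (Fin 8 → ℝ) :=
  pullGen (coframe α y) (J (pushGen (coframe α y) a))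

lemma pullGen_coframe (y : Fin 8 → ℝ) (a : Gen (Fin 8 → ℝ)) :
    pullGen (coframe α y) a =
      pullGen (W := Fin 8 → ℝ) (dproj Γ y) (pullGen (frame (projVec Γ y)) a) := by
  rw [← frame_comp_dproj Γ y]
  exact pullGen_comp (V := Fin 8 → ℝ) (frame_isInvertible (projVec Γ y)) (dproj_isInvertible y) a

/-- Both sides become J once the section is written in the invariant frame, since that frame pulls
back to the coframe. -/
lemma genRep_transportJ (J : Gen (Fin 8 → ℝ) →ₗ[ℝ] Gen (Fin 8 → ℝ))
    (u : GenField (Fin 8 → ℝ) (Nilmanifold α Γ)) (x : Nilmanifold α Γ) (y : Fin 8 → ℝ) :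
    genRep (fun q => transportJ J q (u q)) x y = transportE α J y (genRep u x y) := by
  obtain ⟨a, ha⟩ : ∃ a, u (projVec Γ y) = pullGen (frame (projVec Γ y)) a :=
    ⟨_, (pullGen_pushGen (frame_isInvertible _) _).symm⟩
  rw [genRep_eq, genRep_eq, ha, transportJ_pullGen]
  refine (pullGen_coframe (Γ := Γ) y (J a)).symm.trans (Eq.trans ?_
    (congrArg (transportE α J y) (pullGen_coframe (Γ := Γ) y a)))
  rw [transportE, pushGen_pullGen (coframe_isInvertible y)]

lemma contDiffAt_transportE (J : Gen (Fin 8 → ℝ) →ₗ[ℝ] Gen (Fin 8 → ℝ))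
    {u : (Fin 8 → ℝ) → Gen (Fin 8 → ℝ)} {y : Fin 8 → ℝ} (hu : ContDiffAt ℝ ∞ u y) :
    ContDiffAt ℝ ∞ (fun z => transportE α J z (u z)) y := by
  have h1 : ContDiffAt ℝ ∞ (coframe α) y := contDiffAt_coframe le_rfl y
  have h2 : ContDiffAt ℝ ∞ (fun z => (coframe α z).inverse) y := by
    obtain ⟨e, he⟩ := coframe_isInvertible (α := α) y
    have h3 := contDiffAt_map_inverse (n := ∞) e
    rw [he] at h3
    exact h3.comp y h1
  have h3 : ContDiffAt ℝ ∞ (fun z => pushGen (coframe α z) (u z)) y :=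
    (h1.clm_apply hu.fst).prodMk (hu.snd.clm_comp h2)
  have h4 : ContDiffAt ℝ ∞ (fun z => J (pushGen (coframe α z) (u z))) y :=
    (LinearMap.toContinuousLinearMap J).contDiff.contDiffAt.comp y h3
  exact (h2.clm_apply h4.fst).prodMk (h4.snd.clm_comp h1)

/-- An invariant closed form whose annihilator is the `i`-eigenspace of an orthogonal complex
structure defines an invariant generalized complex structure. -/
lemma exists_gcStructure (Γ : Subgroup (NilGroup α)) [DiscreteTopology Γ]
    {J : Gen (Fin 8 → ℝ) →ₗ[ℝ] Gen (Fin 8 → ℝ)} {ρ : CForms (Fin 8 → ℝ)}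
    (hsq : ∀ a, J (J a) = -a) (horth : ∀ a b, pairing (J a) (J b) = pairing a b)
    (hann : ∀ a b, actC a b ρ = 0 ↔ J a = -b) (hρ : ρ ≠ 0)
    (hclosed : ∀ y, HasExtDerivAt (fun z => pullForm (coframe α z) ρ) 0 y) :
    ∃ 𝒥 : GCStructure (Fin 8 → ℝ) (Nilmanifold α Γ), (∀ x, 𝒥.J x = transportJ J x) ∧
      InvariantGC 𝒥 ∧ 𝒥.Canonical (invariantForm Γ ρ) := by
  have hcanon : ∀ (x : Nilmanifold α Γ) (a b : Gen (TangentSpace 𝓘(ℝ, Fin 8 → ℝ) x)),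
      actC a b (invariantForm Γ ρ x) = 0 ↔ transportJ J x a = -b := by
    intro x a b
    have hi := frame_isInvertible x
    obtain ⟨a, rfl⟩ : ∃ a', a = pullGen (frame x) a' := ⟨_, (pullGen_pushGen hi _).symm⟩
    obtain ⟨b, rfl⟩ : ∃ b', b = pullGen (frame x) b' := ⟨_, (pullGen_pushGen hi _).symm⟩
    rw [invariantForm, actC_pullGen hi, transportJ_pullGen, ← pullGenL_apply, ← pullGenL_apply,
      ← map_neg]
    constructor
    · intro h
      rw [(hann _ _).1 (pullForm_injective hi (h.trans (map_zero _).symm))]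
    · intro h
      have h1 := congrArg (pushGen (frame x)) h
      rw [pullGenL_apply, pullGenL_apply, pushGen_pullGen hi, pushGen_pullGen hi] at h1
      rw [(hann _ _).2 h1, map_zero]
  have hE : ∀ (y : Fin 8 → ℝ) (a b : Gen (Fin 8 → ℝ)), transportE α J y a = -b →
      actC a b (pullForm (coframe α y) ρ) = 0 := by
    intro y a b h
    have hi := coframe_isInvertible (α := α) y
    obtain ⟨a, rfl⟩ : ∃ a', a = pullGen (coframe α y) a' := ⟨_, (pullGen_pushGen hi _).symm⟩
    obtain ⟨b, rfl⟩ : ∃ b', b = pullGen (coframe α y) b' := ⟨_, (pullGen_pushGen hi _).symm⟩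
    rw [transportE, pushGen_pullGen hi, ← pullGenL_apply, ← pullGenL_apply, ← map_neg] at h
    have h1 := congrArg (pushGen (coframe α y)) h
    rw [pullGenL_apply, pullGenL_apply, pushGen_pullGen hi, pushGen_pullGen hi] at h1
    rw [actC_pullGen hi, (hann _ _).2 h1, map_zero]
  have hpairE : ∀ (y : Fin 8 → ℝ) (a b : Gen (Fin 8 → ℝ)),
      pairing (transportE α J y a) (transportE α J y b) = pairing a b := by
    intro y a b
    have hi := coframe_isInvertible (α := α) y
    rw [transportE, transportE, pairing_pullGen hi, horth, ← pairing_pullGen hi,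
      pullGen_pushGen hi, pullGen_pushGen hi]
  have hsqE : ∀ (y : Fin 8 → ℝ) (a b : Gen (Fin 8 → ℝ)), transportE α J y a = -b →
      transportE α J y b = a := by
    intro y a b h
    have hi := coframe_isInvertible (α := α) y
    obtain ⟨a, rfl⟩ : ∃ a', a = pullGen (coframe α y) a' := ⟨_, (pullGen_pushGen hi _).symm⟩
    obtain ⟨b, rfl⟩ : ∃ b', b = pullGen (coframe α y) b' := ⟨_, (pullGen_pushGen hi _).symm⟩
    rw [transportE, pushGen_pullGen hi, ← pullGenL_apply, ← pullGenL_apply, ← map_neg] at h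
    have h1 := congrArg (pushGen (coframe α y)) h
    rw [pullGenL_apply, pullGenL_apply, pushGen_pullGen hi, pushGen_pullGen hi] at h1
    have h2 : b = -J a := by rw [h1, neg_neg]
    rw [transportE, pushGen_pullGen hi, h2, map_neg, hsq, neg_neg]
  let 𝒥 : GCStructure (Fin 8 → ℝ) (Nilmanifold α Γ) :=
    { J := transportJ J
      smooth := by
        intro u x hu
        have h : genRep (fun q => transportJ J q (u q)) x =
            fun y => transportE α J y (genRep u x y) :=
          funext fun y => genRep_transportJ J u x y
        rw [SmoothGenAt, h]
        exact contDiffAt_transportE J hu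
      sq := by
        intro x a
        have hi := frame_isInvertible x
        obtain ⟨a, rfl⟩ : ∃ a', a = pullGen (frame x) a' := ⟨_, (pullGen_pushGen hi _).symm⟩
        rw [transportJ_pullGen, transportJ_pullGen, hsq, ← pullGenL_apply, ← pullGenL_apply, map_neg]
      orthogonal := by
        intro x a b
        have hi := frame_isInvertible x
        obtain ⟨a, rfl⟩ : ∃ a', a = pullGen (frame x) a' := ⟨_, (pullGen_pushGen hi _).symm⟩
        obtain ⟨b, rfl⟩ : ∃ b', b = pullGen (frame x) b' := ⟨_, (pullGen_pushGen hi _).symm⟩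
        rw [transportJ_pullGen, transportJ_pullGen, pairing_pullGen hi, pairing_pullGen hi, horth]
      involutive := by
        intro a b c d x ha hb hc hd hab hcd
        -- Membership in the i-eigenbundle near x is transferred to coordinates through the
        -- continuity of the projection at the chart centre.
        have hev : ∀ a b : GenField (Fin 8 → ℝ) (Nilmanifold α Γ),
            (∀ᶠ q in 𝓝 x, transportJ J q (a q) = -b q) →
            ∀ᶠ z in 𝓝 (center x), transportE α J z (genRep a x z) = -genRep b x z := by
          intro a b hab
          have h1 : Filter.Tendsto (projVec Γ) (𝓝 (center x)) (𝓝 x) := by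
            have h2 : ContinuousAt (projVec Γ) (center x) :=
              (mdifferentiableAt_projVec (center x)).continuousAt
            have h3 := h2.tendsto
            rwa [projVec_center] at h3
          filter_upwards [h1.eventually hab] with z hz
          rw [← genRep_transportJ, genRep_eq, genRep_eq, hz]
          exact map_neg (pullGenL (W := Fin 8 → ℝ) (dproj Γ z)) (b (projVec Γ z))
        have hab' := hev a b hab
        have hcd' := hev c d hcd
        have hdiff : ∀ {u : GenField (Fin 8 → ℝ) (Nilmanifold α Γ)}, SmoothGenAt u x →
            DifferentiableAt ℝ (genRep u x) (center x) := fun hu =>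
          ContDiffAt.differentiableAt hu (by simp)
        -- The two isotropy hypotheses come from orthogonality: from Ja = -b and Jc = -d it gives
        -- ⟨a|c⟩ = ⟨b|d⟩, and with Jd = c it gives ⟨a|d⟩ = -⟨b|c⟩.
        have h := actC_courantE (hclosed (center x)).1 (hdiff ha) (hdiff hb) (hdiff hc) (hdiff hd)
          (hclosed (center x)).2
          (hab'.mono fun z hz => hE _ _ _ hz) (hcd'.mono fun z hz => hE _ _ _ hz)
          (by
            filter_upwards [hab', hcd'] with z h1 h2
            rw [← hpairE z (genRep a x z), h1, h2]
            simp [pairing])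
          (by
            filter_upwards [hab', hcd'] with z h1 h2
            have h3 := hsqE z _ _ h2
            rw [← hpairE z (genRep a x z), h1, h3]
            simp [pairing]
            ring)
        have hi := dchart_isInvertible x
        have h5 := actC_pullGen hi (courantE (genRep a x) (genRep c x) (center x) -
            courantE (genRep b x) (genRep d x) (center x))
          (courantE (genRep a x) (genRep d x) (center x) +
            courantE (genRep b x) (genRep c x) (center x)) (pullForm (coframe α (center x)) ρ)
        rw [h, map_zero, ← pullForm_comp, ← pullGenL_apply, ← pullGenL_apply, map_sub, map_add] at h5
        exact (hcanon x _ _).1 h5 }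
  refine ⟨𝒥, fun x => rfl, ?_, ?_⟩
  · intro g h a b hab
    have hi1 := frame_isInvertible (proj Γ (g * h))
    have hi2 := frame_isInvertible (proj Γ h)
    have hc := coframe_isInvertible (α := α) h
    have e1 := frame_comp_mfderiv_translate (Γ := Γ) g h
    have e2 := frame_comp_mfderiv_proj (Γ := Γ) h
    have inv_of : ∀ {x : Nilmanifold α Γ}
        {D : (Fin 8 → ℝ) →L[ℝ] TangentSpace 𝓘(ℝ, Fin 8 → ℝ) x},
        (frame x).comp D = coframe α h → D.IsInvertible := by
      intro x D hD
      obtain ⟨e, he⟩ := frame_isInvertible x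
      obtain ⟨e', he'⟩ := hc
      refine ⟨e'.trans e.symm, ?_⟩
      rw [← he, ← he'] at hD
      refine ContinuousLinearMap.ext fun v => ?_
      exact e.symm_apply_eq.2 (DFunLike.congr_fun hD v).symm
    have hD1 := inv_of e1
    have hD2 := inv_of e2
    obtain ⟨a, rfl⟩ : ∃ a', a = pullGen (frame (proj Γ (g * h))) a' :=
      ⟨_, (pullGen_pushGen hi1 _).symm⟩
    obtain ⟨b, rfl⟩ : ∃ b', b = pullGen (frame (proj Γ h)) b' := ⟨_, (pullGen_pushGen hi2 _).symm⟩
    have p1 := fun a => (congrArg (fun T => pullGen T a) e1).symm.trans (pullGen_comp hi1 hD1 a)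
    have p2 := fun a => (congrArg (fun T => pullGen T a) e2).symm.trans (pullGen_comp hi2 hD2 a)
    -- Both the translated and the plain projection pull the frame back to the coframe at h, so
    -- equal pull-backs have equal components in the frame.
    have hab' : pullGen (coframe α h) a = pullGen (coframe α h) b := by
      exact (p1 a).trans (hab.trans (p2 b).symm)
    have h3 : a = b := by
      rw [← pushGen_pullGen hc a, hab', pushGen_pullGen hc]
    subst h3
    change pullGen _ (transportJ J _ (pullGen (frame (proj Γ (g * h))) a)) =
      pullGen _ (transportJ J _ (pullGen (frame (proj Γ h)) a))
    rw [transportJ_pullGen, transportJ_pullGen]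
    exact (p1 _).symm.trans (p2 _)
  · intro x
    refine ⟨fun h => hρ (pullForm_injective (frame_isInvertible x) (h.trans (map_zero _).symm)),
      fun a b => hcanon x a b⟩

end Nilmanifold

/-! ### The differential on left-invariant forms and the reduction to the identity -/

namespace Nilmanifold

open GCGeom NilGroup

variable {α : ℝ} {k : ℕ}

/-- The exterior derivative of left-invariant forms: the left-invariant form with value `ρ` at the
identity has exterior derivative the left-invariant form with value `σ`. -/
def HasInvDeriv (α : ℝ) (ρ σ : CForms (Fin 8 → ℝ)) : Prop :=
  ∀ y, HasExtDerivAt (fun z => pullForm (coframe α z) ρ) (pullForm (coframe α y) σ) y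

lemma invo_pullForm {V W : Type*} [AddCommGroup V] [Module ℝ V] [TopologicalSpace V]
    [AddCommGroup W] [Module ℝ W] [TopologicalSpace W] (D : V →L[ℝ] W) (ρ : CForms W) :
    invo (pullForm D ρ) = pullForm D (invo ρ) := by
  have : invo.comp (pullForm D) = (pullForm D).comp invo := by
    apply ExteriorAlgebra.hom_ext
    ext1 θ
    change invo (pullForm D (oneForm θ)) = pullForm D (invo (oneForm θ))
    simp
  exact DFunLike.congr_fun this ρ

namespace HasInvDeriv

variable {ρ ρ' σ σ' : CForms (Fin 8 → ℝ)}

lemma congr (h : HasInvDeriv α ρ σ) (e : ρ = ρ') (e' : σ = σ') : HasInvDeriv α ρ' σ' := by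
  subst e e'; exact h

lemma mul (h : HasInvDeriv α ρ σ) (h' : HasInvDeriv α ρ' σ') :
    HasInvDeriv α (ρ * ρ') (σ * ρ' + invo ρ * σ') := fun y =>
  ((h y).mul (h' y)).congr (funext fun z => (map_mul (pullForm (coframe α z)) ρ ρ').symm)
    (by rw [map_add, map_mul, map_mul, invo_pullForm])

lemma add (h : HasInvDeriv α ρ σ) (h' : HasInvDeriv α ρ' σ') :
    HasInvDeriv α (ρ + ρ') (σ + σ') := fun y =>
  ((h y).add (h' y)).congr (funext fun z => (map_add (pullForm (coframe α z)) ρ ρ').symm)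
    (map_add _ _ _).symm

lemma smul (c : ℂ) (h : HasInvDeriv α ρ σ) : HasInvDeriv α (c • ρ) (c • σ) := fun y =>
  ((h y).const_smul c).congr (funext fun z => (map_smul (pullForm (coframe α z)) c ρ).symm)
    (map_smul _ _ _).symm

lemma neg (h : HasInvDeriv α ρ σ) : HasInvDeriv α (-ρ) (-σ) :=
  (h.smul (-1)).congr (neg_one_smul ℂ ρ) (neg_one_smul ℂ σ)

lemma sub (h : HasInvDeriv α ρ σ) (h' : HasInvDeriv α ρ' σ') : HasInvDeriv α (ρ - ρ') (σ - σ') :=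
  (h.add h'.neg).congr (sub_eq_add_neg _ _).symm (sub_eq_add_neg _ _).symm

lemma one : HasInvDeriv α 1 0 := fun _ =>
  (HasExtDerivAt.const 1).congr (funext fun z => (map_one (pullForm (coframe α z))).symm)
    (map_zero _).symm

lemma zero : HasInvDeriv α 0 0 := fun _ =>
  (HasExtDerivAt.const 0).congr (funext fun z => (map_zero (pullForm (coframe α z))).symm)
    (map_zero _).symm

lemma sum {ι : Type*} (s : Finset ι) {f g : ι → CForms (Fin 8 → ℝ)}
    (h : ∀ i ∈ s, HasInvDeriv α (f i) (g i)) : HasInvDeriv α (∑ i ∈ s, f i) (∑ i ∈ s, g i) := by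
  classical
  induction s using Finset.induction_on with
  | empty => exact zero
  | insert a s ha ih =>
    rw [Finset.sum_insert ha, Finset.sum_insert ha]
    exact (h a (Finset.mem_insert_self a s)).add
      (ih fun i hi => h i (Finset.mem_insert_of_mem hi))

/-- Closedness of `C ^ j ∧ Ω` for even `C` with `dC ∧ Ω = 0` and `dΩ = 0`. -/
lemma pow_mul_closed {C C' Ω : CForms (Fin 8 → ℝ)} (hC : invo C = C) (h : HasInvDeriv α C C')
    (hΩ : HasInvDeriv α Ω 0) (h0 : C' * Ω = 0) (j : ℕ) : HasInvDeriv α (C ^ j * Ω) 0 := by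
  induction j with
  | zero => exact hΩ.congr (by rw [pow_zero, one_mul]) rfl
  | succ j ih =>
    refine (h.mul ih).congr (by rw [pow_succ', mul_assoc]) ?_
    rw [mul_zero, add_zero, ← mul_assoc, ← ((commute_of_invo_eq hC C').pow_left j).eq, mul_assoc, h0,
      mul_zero]

/-- Only dC ∧ Ω = 0 is demanded, not dC = 0; types 3 and 2 rely on this weaker condition. -/
lemma expForm_mul_closed {C C' Ω : CForms (Fin 8 → ℝ)} (hC : invo C = C) (h : HasInvDeriv α C C')
    (hΩ : HasInvDeriv α Ω 0) (h0 : C' * Ω = 0) : HasInvDeriv α (expForm C * Ω) 0 := by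
  have h1 : expForm C * Ω = ∑ j ∈ Finset.range (Module.finrank ℝ (Fin 8 → ℝ) + 1),
      ((j.factorial : ℂ)⁻¹) • (C ^ j * Ω) := by
    rw [expForm, Finset.sum_mul]
    simp only [smul_mul_assoc]
  refine (sum _ fun j _ => (pow_mul_closed hC h hΩ h0 j).smul ((j.factorial : ℂ)⁻¹)).congr h1.symm ?_
  simp

end HasInvDeriv

variable {Γ : Subgroup (NilGroup α)} [DiscreteTopology Γ]

/-- The data of a pure form which are constant in the invariant frame. -/
def invariantPure (Γ : Subgroup (NilGroup α)) [DiscreteTopology Γ]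
    (B w : ⋀[ℝ]^2 ((Fin 8 → ℝ) →L[ℝ] ℝ)) (θ : Fin k → (Fin 8 → ℝ) →L[ℝ] ℂ) :
    PureForm (Fin 8 → ℝ) (Nilmanifold α Γ) k where
  B x := pullTwo (frame x) B
  omega x := pullTwo (frame x) w
  θ i x := (θ i).comp (frame x)

variable {B w : ⋀[ℝ]^2 ((Fin 8 → ℝ) →L[ℝ] ℝ)} {θ : Fin k → (Fin 8 → ℝ) →L[ℝ] ℂ}

lemma BForm_invariantPure :
    (invariantPure Γ B w θ).BForm = invariantForm Γ (complexify (B : RForms (Fin 8 → ℝ))) :=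
  funext fun x => complexify_pullReal_two (frame x) B

lemma omegaForm_invariantPure :
    (invariantPure Γ B w θ).omegaForm = invariantForm Γ (complexify (w : RForms (Fin 8 → ℝ))) :=
  funext fun x => complexify_pullReal_two (frame x) w

lemma θ_invariantPure (i : Fin k) : (fun x => oneForm ((invariantPure Γ B w θ).θ i x)) =
    invariantForm Γ (oneForm (θ i)) :=
  funext fun x => (pullForm_oneForm (frame x) (θ i)).symm

lemma pullForm_expForm (x : Nilmanifold α Γ) (C : CForms (Fin 8 → ℝ)) :
    pullForm (frame x) (expForm C) = expForm (pullForm (frame x) C) := by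
  rw [expForm, map_sum, expForm]
  simp only [map_smul, map_pow]
  rfl

lemma ρ_invariantPure :
    (invariantPure Γ B w θ).ρ = invariantForm Γ (pureSpinor B w θ) := by
  funext x
  rw [PureForm.ρ, BForm_invariantPure, omegaForm_invariantPure, invariantForm, invariantForm,
    invariantForm, pureSpinor, map_mul, pullForm_expForm, complexTwo, map_add, map_smul,
    pullForm_ιMulti]
  rfl

/-- The common reduction for all five types. The endomorphism J at the identity is exported with its
annihilator property, so that types 4 and 0 can identify it afterwards. -/
lemma exists_invariantGivenBy (Γ : Subgroup (NilGroup α)) [DiscreteTopology Γ]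
    (h : NondegenerateAt w θ 4) (hclosed : HasInvDeriv α (pureSpinor B w θ) 0) :
    ∃ (J : Gen (Fin 8 → ℝ) →ₗ[ℝ] Gen (Fin 8 → ℝ))
      (𝒥 : GCStructure (Fin 8 → ℝ) (Nilmanifold α Γ)),
      (∀ a b, actC a b (pureSpinor B w θ) = 0 ↔ J a = -b) ∧ (∀ x, 𝒥.J x = transportJ J x) ∧
        InvariantGivenBy 𝒥 (invariantPure Γ B w θ) := by
  obtain ⟨J, hsq, horth, hann⟩ := h.exists_structure (B := B)
  have hρ : pureSpinor B w θ ≠ 0 := pureSpinor_ne_zero h.finrank_pos h.Ω_ne_zero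
  obtain ⟨𝒥, h1, h2, h3⟩ := exists_gcStructure Γ hsq horth hann hρ fun y =>
    (hclosed y).congr rfl (map_zero _)
  refine ⟨J, 𝒥, hann, h1, h2, ?_, ?_, ?_, ⟨?_, ?_, ?_⟩, ?_, ?_, ?_⟩
  · rw [BForm_invariantPure]; exact invariantForm_invariantForm _
  · rw [omegaForm_invariantPure]; exact invariantForm_invariantForm _
  · intro i; rw [θ_invariantPure]; exact invariantForm_invariantForm _
  · rw [BForm_invariantPure]; exact smoothForm_invariantForm _
  · rw [omegaForm_invariantPure]; exact smoothForm_invariantForm _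
  · intro i; rw [θ_invariantPure]; exact smoothForm_invariantForm _
  · intro x
    rw [ρ_invariantPure, extDerivM_invariantForm x hclosed]
    exact map_zero _
  · refine ⟨4, h.finrank_eq, h.le, fun x hx => h.ne_zero ?_⟩
    refine pullForm_injective (frame_isInvertible x) (Eq.trans ?_ (hx.trans (map_zero _).symm))
    rw [omegaForm_invariantPure, map_mul, map_mul, map_pow, pullForm_ιMulti, pullForm_ιMulti]
    rfl
  · rw [ρ_invariantPure]; exact h3

/-- The standard coframe of `ℝ⁸`, as complex forms. -/
def ε (i : Fin 8) : CForms (Fin 8 → ℝ) :=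
  oneForm (toComplex (ContinuousLinearMap.proj i : (Fin 8 → ℝ) →L[ℝ] ℝ))

lemma ε_sq (i : Fin 8) : ε i * ε i = 0 := oneForm_sq _

lemma ε_swap (i j : Fin 8) : ε i * ε j = -(ε j * ε i) := oneForm_swap _ _

@[simp] lemma invo_ε (i : Fin 8) : invo (ε i) = -ε i := invo_oneForm _

lemma ε_sq_mul (i : Fin 8) (ρ : CForms (Fin 8 → ℝ)) : ε i * (ε i * ρ) = 0 := by
  rw [← mul_assoc, ε_sq, zero_mul]

lemma ε_swap_mul (i j : Fin 8) (ρ : CForms (Fin 8 → ℝ)) :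
    ε i * (ε j * ρ) = -(ε j * (ε i * ρ)) := by
  rw [← mul_assoc, ε_swap, neg_mul, mul_assoc]

lemma pullForm_coframe_ε (y : Fin 8 → ℝ) (i : Fin 8) : pullForm (coframe α y) (ε i) =
    ![ε 0, ε 1, ε 2, ε 3,
      ε 4 + (y 0 : ℂ) • ε 1,
      ε 5 + (y 0 : ℂ) • ε 4 + ((y 0 ^ 2 / 2 : ℝ) : ℂ) • ε 1 + (((1 - α) * y 1 : ℝ) : ℂ) • ε 3,
      ε 6 - (((1 + α) * y 0 : ℝ) : ℂ) • ε 3 - (y 1 : ℂ) • ε 2 + (((1 + α) * y 1 : ℝ) : ℂ) • ε 4,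
      ε 7 + (y 0 : ℂ) • ε 5 + (y 1 : ℂ) • ε 6
        + ((y 0 ^ 2 / 2 + (1 + α) * y 1 ^ 2 / 2 - 2 * y 3 : ℝ) : ℂ) • ε 4
        + ((y 0 ^ 3 / 6 : ℝ) : ℂ) • ε 1 - ((y 1 ^ 2 / 2 : ℝ) : ℂ) • ε 2
        + ((y 2 + (1 - α) * (y 0 * y 1) : ℝ) : ℂ) • ε 3] i := by
  rw [ε, pullForm_oneForm]
  have key : ∀ (η : (Fin 8 → ℝ) →L[ℝ] ℂ), (∀ v, ((coframe α y v i : ℝ) : ℂ) = η v) →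
      (toComplex (ContinuousLinearMap.proj i : (Fin 8 → ℝ) →L[ℝ] ℝ)).comp (coframe α y) = η :=
    fun η h => ContinuousLinearMap.ext h
  simp only [ε, ← oneForm_smul, ← oneForm_add, ← oneForm_sub]
  fin_cases i
  all_goals
    refine congrArg oneForm (key _ fun v => ?_)
    rw [coframe_apply]
    simp

end Nilmanifold

/-! ### The structure equations -/

namespace Nilmanifold

open GCGeom NilGroup

variable {α : ℝ}

/-- The condition j < i makes this a terminating rewrite rule: monomials are brought to increasing
indices. -/
lemma ε_swap_of_lt {i j : Fin 8} (_ : j < i) : ε i * ε j = -(ε j * ε i) := ε_swap i j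

lemma ε_swap_mul_of_lt {i j : Fin 8} (_ : j < i) (ρ : CForms (Fin 8 → ℝ)) :
    ε i * (ε j * ρ) = -(ε j * (ε i * ρ)) := ε_swap_mul i j ρ

/-- The right-hand sides of the structure equations. -/
def structureForm (α : ℝ) : Fin 8 → CForms (Fin 8 → ℝ) :=
  ![0, 0, 0, 0, ε 0 * ε 1,
    ε 0 * ε 4 + ((1 - α : ℝ) : ℂ) • (ε 1 * ε 3),
    -(((1 + α : ℝ) : ℂ) • (ε 0 * ε 3)) - ε 1 * ε 2 + ((1 + α : ℝ) : ℂ) • (ε 1 * ε 4),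
    ε 0 * ε 5 + ε 1 * ε 6 + ε 2 * ε 3 - (2 : ℂ) • (ε 3 * ε 4)]

/-- Each row of the coframe is a sum of coordinate functions times constant covectors. Its
differential is compared with the coframe pull-back of the stated two-form after both are expanded
and sorted in the constant basis. -/
lemma hasInvDeriv_ε (i : Fin 8) : HasInvDeriv α (ε i) (structureForm α i) := by
  intro y
  let p : Fin 8 → (Fin 8 → ℝ) →L[ℝ] ℝ := fun i => ContinuousLinearMap.proj i
  have hp : ∀ i, HasFDerivAt (fun z : Fin 8 → ℝ => z i) (p i) y := fun i => hasFDerivAt_apply i y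
  have hε : ∀ i, oneForm (toComplex (p i)) = ε i := fun i => rfl
  have hc : ∀ i, HasExtDerivAt (fun _ => ε i) 0 y := fun i => HasExtDerivAt.const _
  have hneg : ∀ {ρ : (Fin 8 → ℝ) → CForms (Fin 8 → ℝ)} {σ : CForms (Fin 8 → ℝ)},
      HasExtDerivAt ρ σ y → HasExtDerivAt (fun z => -ρ z) (-σ) y := fun h =>
    (h.const_smul (-1)).congr (funext fun z => neg_one_smul ℂ _) (neg_one_smul ℂ _)
  have hsq : ∀ i, HasFDerivAt (fun z : Fin 8 → ℝ => z i ^ 2 / 2) (y i • p i) y := fun i =>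
    (((hp i).pow 2).mul_const (1 / 2)).congr_fderiv (by ext v; simp; ring) |>.congr_of_eventuallyEq
      (Filter.Eventually.of_forall fun z => by simp; ring)
  have hcube : HasFDerivAt (fun z : Fin 8 → ℝ => z 0 ^ 3 / 6) ((y 0 ^ 2 / 2) • p 0) y :=
    (((hp 0).pow 3).mul_const (1 / 6)).congr_fderiv (by ext v; simp; ring) |>.congr_of_eventuallyEq
      (Filter.Eventually.of_forall fun z => by simp; ring)
  have hq : HasFDerivAt (fun z : Fin 8 → ℝ => z 0 ^ 2 / 2 + (1 + α) * z 1 ^ 2 / 2 - 2 * z 3)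
      (y 0 • p 0 + ((1 + α) * y 1) • p 1 - (2 : ℝ) • p 3) y :=
    (((hsq 0).add ((hsq 1).const_mul (1 + α))).sub ((hp 3).const_mul 2)).congr_fderiv
      (by ext v; simp; ring) |>.congr_of_eventuallyEq
      (Filter.Eventually.of_forall fun z => by simp; ring)
  have hr : HasFDerivAt (fun z : Fin 8 → ℝ => z 2 + (1 - α) * (z 0 * z 1))
      (p 2 + ((1 - α) * y 1) • p 0 + ((1 - α) * y 0) • p 1) y :=
    ((hp 2).add (((hp 0).mul (hp 1)).const_mul (1 - α))).congr_fderiv (by ext v; simp; ring)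
  have hsub : ∀ ξ η : (Fin 8 → ℝ) →L[ℝ] ℝ, toComplex (ξ - η) = toComplex ξ - toComplex η :=
    fun ξ η => by ext v; simp [toComplex]
  have hexp := pullForm_coframe_ε (α := α) y
  have h0 := hexp 0
  have h1 := hexp 1
  have h2 := hexp 2
  have h3 := hexp 3
  have h4 := hexp 4
  have h5 := hexp 5
  have h6 := hexp 6
  simp only [Matrix.cons_val] at h0 h1 h2 h3 h4 h5 h6
  have hfun : ∀ i, (fun z => pullForm (coframe α z) (ε i)) = _ :=
    fun i => funext fun z => pullForm_coframe_ε (α := α) z i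
  fin_cases i
  · refine (hc 0).congr (hfun 0).symm ?_
    exact (map_zero _).symm
  · refine (hc 1).congr (hfun 1).symm ?_
    exact (map_zero _).symm
  · refine (hc 2).congr (hfun 2).symm ?_
    exact (map_zero _).symm
  · refine (hc 3).congr (hfun 3).symm ?_
    exact (map_zero _).symm
  · refine ((hc 4).add (.smul_const (hp 0) (ε 1))).congr (hfun 4).symm ?_
    simp [structureForm, h0, h1, hε]
  · change HasExtDerivAt _ (pullForm (coframe α y) (structureForm α 5)) y
    refine ((((hc 5).add (.smul_const (hp 0) (ε 4))).add (.smul_const (hsq 0) (ε 1))).add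
      (.smul_const ((hp 1).const_mul (1 - α)) (ε 3))).congr (hfun 5).symm ?_
    simp only [structureForm, Matrix.cons_val, map_add, map_smul, map_mul, h0, h1, h3, h4, hε,
      toComplex_smul, oneForm_smul, mul_add, smul_mul_assoc, mul_smul_comm]
    push_cast
    module
  · change HasExtDerivAt _ (pullForm (coframe α y) (structureForm α 6)) y
    refine ((((hc 6).add (hneg (.smul_const ((hp 0).const_mul (1 + α)) (ε 3)))).add
      (hneg (.smul_const (hp 1) (ε 2)))).add
      (.smul_const ((hp 1).const_mul (1 + α)) (ε 4))).congr
      ((funext fun z => ?_).trans (hfun 6).symm) ?_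
    · simp [sub_eq_add_neg]
    · simp only [structureForm, Matrix.cons_val, map_add, map_sub, map_neg, map_smul, map_mul, h0, h1, h2, h3,
        h4, h5, h6, hε, toComplex_smul, toComplex_add, hsub, oneForm_smul, oneForm_add, oneForm_sub,
        mul_add, mul_sub, add_mul, sub_mul, smul_mul_assoc, mul_smul_comm, ε_sq, ε_swap_of_lt, Fin.reduceLT]
      push_cast
      module
  · change HasExtDerivAt _ (pullForm (coframe α y) (structureForm α 7)) y
    refine (((((((hc 7).add (.smul_const (hp 0) (ε 5))).add (.smul_const (hp 1) (ε 6))).add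
      (.smul_const hq (ε 4))).add (.smul_const hcube (ε 1))).add
      (hneg (.smul_const (hsq 1) (ε 2)))).add (.smul_const hr (ε 3))).congr
      ((funext fun z => ?_).trans (hfun 7).symm) ?_
    · simp [sub_eq_add_neg]
    · simp only [structureForm, Matrix.cons_val, map_add, map_sub, map_neg, map_smul, map_mul, h0, h1, h2, h3,
        h4, h5, h6, hε, toComplex_smul, toComplex_add, hsub, oneForm_smul, oneForm_add, oneForm_sub,
        mul_add, mul_sub, add_mul, sub_mul, smul_mul_assoc, mul_smul_comm, ε_sq, ε_swap_of_lt, Fin.reduceLT]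
      push_cast
      module

variable {Γ : Subgroup (NilGroup α)} [DiscreteTopology Γ]

lemma oneForm_coframeForm (i : Fin 8) (x : Nilmanifold α Γ) :
    oneForm (toComplex (coframeForm Γ i x)) = invariantForm Γ (ε i) x :=
  (pullForm_oneForm (frame x) (toComplex (ContinuousLinearMap.proj i))).symm

lemma structureEquations_coframeForm : StructureEquations (coframeForm Γ) := by
  have hd : ∀ i x, extDerivM (fun x : Nilmanifold α Γ => oneForm (toComplex (coframeForm Γ i x))) x =
      invariantForm Γ (structureForm α i) x := fun i x =>
    (congrArg (fun ρ => extDerivM ρ x) (funext fun x => oneForm_coframeForm i x)).trans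
      (extDerivM_invariantForm x (hasInvDeriv_ε i))
  intro x
  refine ⟨(hd 0 x).trans (map_zero _), (hd 1 x).trans (map_zero _), (hd 2 x).trans (map_zero _),
    (hd 3 x).trans (map_zero _), (hd 4 x).trans ?_, (hd 5 x).trans ?_, (hd 6 x).trans ?_,
    (hd 7 x).trans ?_⟩ <;>
  simp only [oneForm_coframeForm, invariantForm, structureForm, Matrix.cons_val, map_add, map_sub,
    map_neg, map_mul, map_smul]

end Nilmanifold

/-! ### The differentials of θ¹, …, θ⁴ -/

namespace Nilmanifold

open GCGeom NilGroup

variable {α : ℝ}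

section Naturality

variable {V W : Type*} [AddCommGroup V] [Module ℝ V] [TopologicalSpace V]
  [AddCommGroup W] [Module ℝ W] [TopologicalSpace W]

lemma theta_comp (e : Fin 8 → W →L[ℝ] ℝ) (D : V →L[ℝ] W) (i : Fin 4) :
    theta α (fun j => (e j).comp D) i = (theta α e i).comp D := by
  fin_cases i <;> rfl

lemma pullReal_twoForm (e : Fin 8 → W →L[ℝ] ℝ) (D : V →L[ℝ] W)
    (x12 x13 x14 x15 x16 x17 x23 x24 x25 x27 x34 x37 : ℝ) :
    pullReal D (twoForm α e x12 x13 x14 x15 x16 x17 x23 x24 x25 x27 x34 x37) =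
      twoForm α (fun j => (e j).comp D) x12 x13 x14 x15 x16 x17 x23 x24 x25 x27 x34 x37 := by
  simp only [twoForm, map_add, map_sub, map_smul, map_mul, pullReal_ι]

end Naturality

/-- The complex one-forms `θ¹, …, θ⁴` at the identity. -/
def baseTheta (α : ℝ) : Fin 4 → (Fin 8 → ℝ) →L[ℝ] ℂ :=
  theta α (fun j => ContinuousLinearMap.proj j)

/-- The one-forms `θ¹, …, θ⁴` at the identity, in the algebra of forms. -/
def ϑ (α : ℝ) (i : Fin 4) : CForms (Fin 8 → ℝ) := oneForm (baseTheta α i)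

/-- The conjugates of the one-forms `θ¹, …, θ⁴` at the identity. -/
def ϑbar (α : ℝ) (i : Fin 4) : CForms (Fin 8 → ℝ) := oneForm (conj (baseTheta α i))

/-- The number `1 / √(3 + α)`. -/
def invSqrt (α : ℝ) : ℂ := ((1 / √(3 + α) : ℝ) : ℂ)

/-- The algebraic relation needed of the square root: dθ³ falls into the ideal of θ¹, θ² with its
help. -/
lemma invSqrt_sq (hα : 0 < α) : invSqrt α ^ 2 * (3 + (α : ℂ)) = 1 := by
  have h : (1 / √(3 + α)) ^ 2 * (3 + α) = 1 := by
    rw [div_pow, Real.sq_sqrt (by linarith)]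
    field_simp
  rw [invSqrt]
  exact_mod_cast h

/-- Pulling out the constant (1 + i)/2 shows θ¹ as a multiple of a simple covector, which makes
divisibility by θ¹ visible. -/
lemma ϑ_zero : ϑ α 0 = ((1 + Complex.I) / 2) • (invSqrt α • ε 0 + Complex.I • ε 1) := by
  have hI : Complex.I ^ 2 = -1 := Complex.I_sq
  change oneForm (_ + _) = _
  simp only [oneForm_add, oneForm_sub, oneForm_smul]
  change (1 / 2 : ℂ) • (invSqrt α • ε 0 - ε 1) + (Complex.I / 2) • (invSqrt α • ε 0 + ε 1) = _
  match_scalars <;> grind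

lemma ϑ_one : ϑ α 1 =
    -((α : ℂ) • ε 3) - (Complex.I * invSqrt α) • ((1 / 2 : ℂ) • ε 2 + ε 4) := by
  change oneForm (_ - _) = _
  simp only [oneForm_add, oneForm_sub, oneForm_smul, oneForm_neg]
  rfl

lemma ϑ_two : ϑ α 2 = (α / (1 + α) ^ 2 * (1 + Complex.I) : ℂ) •
    (ε 5 + (Complex.I * invSqrt α) • ε 6) := by
  have hI : Complex.I ^ 2 = -1 := Complex.I_sq
  change oneForm (_ + _) = _
  simp only [oneForm_add, oneForm_sub, oneForm_smul]
  change ((α : ℂ) / (1 + (α : ℂ)) ^ 2) • (ε 5 - invSqrt α • ε 6) +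
    (Complex.I * (α : ℂ) / (1 + (α : ℂ)) ^ 2) • (ε 5 + invSqrt α • ε 6) = _
  match_scalars <;> grind

lemma ϑ_three : ϑ α 3 =
    invSqrt α • (ε 4 + ((1 - α : ℂ) / (2 * (1 + α) ^ 2)) • ε 2) -
      (Complex.I * α) • (ε 3 + (2 / (1 + α : ℂ) ^ 2 * invSqrt α) • ε 7) := by
  change oneForm (_ - _) = _
  simp only [oneForm_add, oneForm_sub, oneForm_smul]
  rfl

lemma ϑbar_three : ϑbar α 3 =
    (2 : ℂ) • (invSqrt α • (ε 4 + ((1 - α : ℂ) / (2 * (1 + α) ^ 2)) • ε 2)) - ϑ α 3 := by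
  have h : conj (baseTheta α 3) + baseTheta α 3 = (2 : ℂ) • (invSqrt α •
      (toComplex (ContinuousLinearMap.proj 4) + ((1 - α : ℂ) / (2 * (1 + α) ^ 2)) •
        toComplex (ContinuousLinearMap.proj 2))) := by
    ext v
    simp [baseTheta, theta, invSqrt, Complex.conj_ofNat]
    ring
  rw [eq_sub_iff_add_eq, ϑbar, ϑ, ← oneForm_add, h]
  simp only [oneForm_add, oneForm_smul]
  rfl

lemma hasInvDeriv_ϑ_zero : HasInvDeriv α (ϑ α 0) 0 := by
  refine ((((hasInvDeriv_ε 0).smul (invSqrt α)).add ((hasInvDeriv_ε 1).smul Complex.I)).smul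
    ((1 + Complex.I) / 2)).congr ϑ_zero.symm ?_
  simp [structureForm]

/-- First step of the triangular system. Only e⁵ contributes to dθ², so it is a multiple of e¹², and
so is θ¹ ∧ e²; the coefficient -(1 + i) matches the two. -/
lemma hasInvDeriv_ϑ_one : ∃ a, HasInvDeriv α (ϑ α 1) (ϑ α 0 * a) := by
  have hI : Complex.I ^ 2 = -1 := Complex.I_sq
  refine ⟨(-(1 + Complex.I)) • ε 1, ((((hasInvDeriv_ε 3).smul (α : ℂ)).neg).sub
    ((((hasInvDeriv_ε 2).smul (1 / 2)).add (hasInvDeriv_ε 4)).smul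
      (Complex.I * invSqrt α))).congr ϑ_one.symm ?_⟩
  simp only [structureForm, Matrix.cons_val, ϑ_zero, mul_add, add_mul, smul_mul_assoc, mul_smul_comm,
    ε_sq]
  match_scalars
  grind

/-- The term θ² ∧ e¹ accounts for the e¹⁵ part; the rest is divisible by s e¹ + i e², where s =
1/√(3 + α), thanks to s²(3 + α) = 1. -/
lemma hasInvDeriv_ϑ_two (hα : 0 < α) :
    ∃ a b, HasInvDeriv α (ϑ α 2) (ϑ α 0 * a + ϑ α 1 * b) := by
  have hI : Complex.I ^ 2 = -1 := Complex.I_sq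
  have hs := invSqrt_sq hα
  refine ⟨(-2 * Complex.I * (α / (1 + α) ^ 2)) • ((1 - α : ℂ) • ε 3 +
      (Complex.I * invSqrt α) • (-ε 2 + (1 + α : ℂ) • ε 4)),
    (-2 * Complex.I * invSqrt α * (α / (1 + α) ^ 2) * (1 + Complex.I)) • ε 0,
    (((hasInvDeriv_ε 5).add ((hasInvDeriv_ε 6).smul (Complex.I * invSqrt α))).smul
      (α / (1 + α) ^ 2 * (1 + Complex.I) : ℂ)).congr ϑ_two.symm ?_⟩
  simp only [structureForm, Matrix.cons_val, ϑ_zero, ϑ_one, mul_add, add_mul, mul_sub, sub_mul, mul_neg,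
    neg_mul, smul_mul_assoc, mul_smul_comm, ε_sq, ε_swap_of_lt, Fin.reduceLT]
  push_cast
  generalize (α / (1 + α) ^ 2 : ℂ) = c
  match_scalars <;> grind

lemma hasInvDeriv_ϑ_three :
    ∃ a b c, HasInvDeriv α (ϑ α 3) (ϑ α 0 * a + ϑ α 1 * b + ϑ α 2 * c) := by
  have hI : Complex.I ^ 2 = -1 := Complex.I_sq
  refine ⟨(1 - Complex.I) • ε 1 - (2 * α / (1 + α) ^ 2 * invSqrt α * (1 - Complex.I)) • ε 6,
    (-4 * Complex.I / (1 + α) ^ 2 * invSqrt α) • ((1 / 2 : ℂ) • ε 2 + ε 4),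
    (invSqrt α * (1 + Complex.I)) • ε 0,
    ((((hasInvDeriv_ε 4).add ((hasInvDeriv_ε 2).smul ((1 - α : ℂ) / (2 * (1 + α) ^ 2)))).smul
      (invSqrt α)).sub (((hasInvDeriv_ε 3).add ((hasInvDeriv_ε 7).smul
        (2 / (1 + α : ℂ) ^ 2 * invSqrt α))).smul (Complex.I * α))).congr ϑ_three.symm ?_⟩
  simp only [structureForm, Matrix.cons_val, ϑ_zero, ϑ_one, ϑ_two, mul_add, add_mul, mul_sub, sub_mul,
    mul_neg, neg_mul, smul_mul_assoc, mul_smul_comm, ε_sq, ε_swap_of_lt, Fin.reduceLT]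
  simp only [div_eq_mul_inv]
  generalize (((1 + α : ℂ) ^ 2)⁻¹) = c
  match_scalars <;> grind

/-- Triangularity for the conjugate of θ⁴, needed for type 3. The conjugate is 2 Re θ⁴ - θ⁴, and
d(Re θ⁴) is a multiple of e¹², hence divisible by θ¹. -/
lemma hasInvDeriv_ϑbar_three :
    ∃ a b c, HasInvDeriv α (ϑbar α 3) (ϑ α 0 * a + ϑ α 1 * b + ϑ α 2 * c) := by
  have hI : Complex.I ^ 2 = -1 := Complex.I_sq
  obtain ⟨a, b, c, h⟩ := hasInvDeriv_ϑ_three (α := α)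
  refine ⟨(2 * (1 - Complex.I)) • ε 1 - a, -b, -c,
    ((((hasInvDeriv_ε 4).add ((hasInvDeriv_ε 2).smul ((1 - α : ℂ) / (2 * (1 + α) ^ 2)))).smul
      (invSqrt α)).smul 2 |>.sub h).congr ϑbar_three.symm ?_⟩
  have h0 : ϑ α 0 * ((2 * (1 - Complex.I)) • ε 1) = (2 * invSqrt α) • (ε 0 * ε 1) := by
    simp only [ϑ_zero, mul_add, add_mul, smul_mul_assoc, mul_smul_comm, ε_sq]
    match_scalars
    grind
  rw [mul_sub, h0, mul_neg, mul_neg]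
  simp only [structureForm, Matrix.cons_val]
  module

end Nilmanifold

/-! ### Real two-forms built from complex covectors -/

namespace GCGeom

section RealParts

variable {V : Type*} [AddCommGroup V] [Module ℝ V] [TopologicalSpace V]

/-- The real part of a complex covector. -/
def reForm (η : V →L[ℝ] ℂ) : V →L[ℝ] ℝ := Complex.reCLM.comp η

/-- The imaginary part of a complex covector. -/
def imForm (η : V →L[ℝ] ℂ) : V →L[ℝ] ℝ := Complex.imCLM.comp η

lemma oneForm_eq_re_im (η : V →L[ℝ] ℂ) :
    oneForm η = oneForm (toComplex (reForm η)) + Complex.I • oneForm (toComplex (imForm η)) := by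
  rw [← oneForm_smul, ← oneForm_add]
  congr 1
  ext v
  simp [reForm, imForm, mul_comm Complex.I]

lemma oneForm_conj_eq_re_im (η : V →L[ℝ] ℂ) :
    oneForm (conj η) =
      oneForm (toComplex (reForm η)) - Complex.I • oneForm (toComplex (imForm η)) := by
  rw [← oneForm_smul, ← oneForm_sub]
  congr 1
  ext v
  apply Complex.ext <;> simp [reForm, imForm]

/-- The product of two real covectors. -/
def wedgeTwo (ξ η : V →L[ℝ] ℝ) : ⋀[ℝ]^2 (V →L[ℝ] ℝ) :=
  ⟨ExteriorAlgebra.ι ℝ ξ * ExteriorAlgebra.ι ℝ η,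
    mul_mem_exteriorPower (ι_mem_exteriorPower_one ξ) (ι_mem_exteriorPower_one η)⟩

lemma complexify_wedgeTwo (ξ η : V →L[ℝ] ℝ) :
    complexify (wedgeTwo ξ η : RForms V) = oneForm (toComplex ξ) * oneForm (toComplex η) := by
  rw [wedgeTwo, map_mul, complexify_ι, complexify_ι]

/-- The real two-form `i η ∧ η̄`. -/
def kahlerTwo (η : V →L[ℝ] ℂ) : ⋀[ℝ]^2 (V →L[ℝ] ℝ) := (2 : ℝ) • wedgeTwo (reForm η) (imForm η)

/-- The real part of `η ∧ ζ`. -/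
def reTwo (η ζ : V →L[ℝ] ℂ) : ⋀[ℝ]^2 (V →L[ℝ] ℝ) :=
  wedgeTwo (reForm η) (reForm ζ) - wedgeTwo (imForm η) (imForm ζ)

/-- The imaginary part of `η ∧ ζ`. -/
def imTwo (η ζ : V →L[ℝ] ℂ) : ⋀[ℝ]^2 (V →L[ℝ] ℝ) :=
  wedgeTwo (reForm η) (imForm ζ) + wedgeTwo (imForm η) (reForm ζ)

lemma complexify_kahlerTwo (η : V →L[ℝ] ℂ) :
    complexify (kahlerTwo η : RForms V) = Complex.I • (oneForm η * oneForm (conj η)) := by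
  have hI : Complex.I ^ 2 = -1 := Complex.I_sq
  rw [kahlerTwo, Submodule.coe_smul, complexify_smul, complexify_wedgeTwo, oneForm_conj_eq_re_im,
    oneForm_eq_re_im η]
  simp only [mul_add, add_mul, mul_sub, sub_mul, smul_mul_assoc, mul_smul_comm, oneForm_sq,
    oneForm_swap (toComplex (imForm η)) (toComplex (reForm η))]
  push_cast
  match_scalars
  grind

lemma complexify_reTwo (η ζ : V →L[ℝ] ℂ) :
    complexify (reTwo η ζ : RForms V) =
      (1 / 2 : ℂ) • (oneForm η * oneForm ζ + oneForm (conj η) * oneForm (conj ζ)) := by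
  have hI : Complex.I ^ 2 = -1 := Complex.I_sq
  rw [reTwo, Submodule.coe_sub, map_sub, complexify_wedgeTwo, complexify_wedgeTwo,
    oneForm_conj_eq_re_im, oneForm_conj_eq_re_im, oneForm_eq_re_im η, oneForm_eq_re_im ζ]
  simp only [mul_add, add_mul, mul_sub, sub_mul, smul_mul_assoc, mul_smul_comm]
  match_scalars <;> grind

lemma complexify_imTwo (η ζ : V →L[ℝ] ℂ) :
    complexify (imTwo η ζ : RForms V) =
      (-Complex.I / 2) • (oneForm η * oneForm ζ - oneForm (conj η) * oneForm (conj ζ)) := by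
  have hI : Complex.I ^ 2 = -1 := Complex.I_sq
  rw [imTwo, Submodule.coe_add, map_add, complexify_wedgeTwo, complexify_wedgeTwo,
    oneForm_conj_eq_re_im, oneForm_conj_eq_re_im, oneForm_eq_re_im η, oneForm_eq_re_im ζ]
  simp only [mul_add, add_mul, mul_sub, sub_mul, smul_mul_assoc, mul_smul_comm]
  match_scalars <;> grind

end RealParts

section RealPartsNormed

variable {E : Type*} [NormedAddCommGroup E] [NormedSpace ℝ E] [FiniteDimensional ℝ E]

lemma complexTwo_zero_kahlerTwo (η : E →L[ℝ] ℂ) :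
    complexTwo 0 (kahlerTwo η) = -(oneForm η * oneForm (conj η)) := by
  rw [complexTwo, complexify_kahlerTwo, smul_smul, Complex.I_mul_I, neg_one_smul, Submodule.coe_zero,
    map_zero, zero_add]

/-- The antiholomorphic parts of B and iω cancel, so the exponent for type 2 is θ³ ∧ θ⁴. -/
lemma complexTwo_reTwo_imTwo (η ζ : E →L[ℝ] ℂ) :
    complexTwo (reTwo η ζ) (imTwo η ζ) = oneForm η * oneForm ζ := by
  have hI : Complex.I ^ 2 = -1 := Complex.I_sq
  rw [complexTwo, complexify_reTwo, complexify_imTwo]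
  match_scalars <;> grind

end RealPartsNormed

end GCGeom

/-! ### Closedness in types 4, 3 and 2 -/

namespace Nilmanifold

open GCGeom NilGroup

variable {α : ℝ}

lemma ϑ_sq (i : Fin 4) : ϑ α i * ϑ α i = 0 := oneForm_sq _

lemma ϑ_sq_mul (i : Fin 4) (ρ : CForms (Fin 8 → ℝ)) : ϑ α i * (ϑ α i * ρ) = 0 := by
  rw [← mul_assoc, ϑ_sq, zero_mul]

lemma ϑ_swap_mul_of_lt {i j : Fin 4} (_ : j < i) (ρ : CForms (Fin 8 → ℝ)) :
    ϑ α i * (ϑ α j * ρ) = -(ϑ α j * (ϑ α i * ρ)) := by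
  rw [← mul_assoc, ϑ, ϑ, oneForm_swap, neg_mul, mul_assoc]

lemma invo_ϑ (i : Fin 4) : invo (ϑ α i) = -ϑ α i := invo_oneForm _

/-- Extends a closed product by one factor. In the applications below P is θ¹ ∧ ⋯ ∧ θ^{j-1} and T'
lies in the ideal of its factors, so each term repeats a factor. -/
lemma HasInvDeriv.mul_closed {P T T' : CForms (Fin 8 → ℝ)} (hP : HasInvDeriv α P 0)
    (hT : HasInvDeriv α T T') (h0 : invo P * T' = 0) : HasInvDeriv α (P * T) 0 :=
  (hP.mul hT).congr rfl (by rw [zero_mul, zero_add, h0])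

lemma closed_ϑ_two : HasInvDeriv α (ϑ α 0 * ϑ α 1) 0 := by
  obtain ⟨a, h⟩ := hasInvDeriv_ϑ_one (α := α)
  refine hasInvDeriv_ϑ_zero.mul_closed h ?_
  simp only [invo_ϑ, neg_mul, ϑ_sq_mul, neg_zero]

lemma closed_ϑ_three (hα : 0 < α) : HasInvDeriv α (ϑ α 0 * ϑ α 1 * ϑ α 2) 0 := by
  obtain ⟨a, b, h⟩ := hasInvDeriv_ϑ_two hα
  refine closed_ϑ_two.mul_closed h ?_
  simp only [map_mul, invo_ϑ, neg_mul, mul_neg, mul_assoc, mul_add, ϑ_sq_mul, ϑ_swap_mul_of_lt,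
    Fin.reduceLT, mul_zero, neg_zero, add_zero]

lemma closed_ϑ_four (hα : 0 < α) : HasInvDeriv α (ϑ α 0 * ϑ α 1 * ϑ α 2 * ϑ α 3) 0 := by
  obtain ⟨a, b, c, h⟩ := hasInvDeriv_ϑ_three (α := α)
  refine (closed_ϑ_three hα).mul_closed h ?_
  simp only [map_mul, invo_ϑ, neg_mul, mul_neg, mul_assoc, mul_add, ϑ_sq_mul, ϑ_swap_mul_of_lt,
    Fin.reduceLT, mul_zero, neg_zero, add_zero]

lemma closed_typeFour (hα : 0 < α) : HasInvDeriv α (pureSpinor 0 0 (baseTheta α)) 0 := by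
  have h0 : complexTwo (0 : ⋀[ℝ]^2 ((Fin 8 → ℝ) →L[ℝ] ℝ)) 0 = 0 := by simp [complexTwo]
  have hΩ : ExteriorAlgebra.ιMulti ℂ 4 (baseTheta α) = ϑ α 0 * ϑ α 1 * ϑ α 2 * ϑ α 3 := by
    simp [ExteriorAlgebra.ιMulti_apply, List.ofFn_succ, ϑ, mul_assoc]
    rfl
  refine HasInvDeriv.expForm_mul_closed (invo_complexTwo 0 0) (HasInvDeriv.zero.congr h0.symm rfl)
    ((closed_ϑ_four hα).congr hΩ.symm rfl) (zero_mul _)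

lemma ϑ_mul_mul_eq_zero {i : Fin 4} {Ω : CForms (Fin 8 → ℝ)} (h : ϑ α i * Ω = 0)
    (ρ : CForms (Fin 8 → ℝ)) : ϑ α i * (ρ * Ω) = 0 := by
  rw [← mul_assoc, ϑ, oneForm_mul_eq, mul_assoc, ← ϑ, h, mul_zero]

/-- The differentials of θ⁴ and of its conjugate lie in the ideal of θ¹, θ², θ³, hence so does the
differential of the exponent, and Ω kills this ideal. -/
lemma closed_typeThree (hα : 0 < α) :
    HasInvDeriv α (pureSpinor 0 (kahlerTwo (baseTheta α 3)) (fun i : Fin 3 => baseTheta α i.castSucc))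
      0 := by
  have hC : complexTwo 0 (kahlerTwo (baseTheta α 3)) = -(ϑ α 3 * ϑbar α 3) :=
    complexTwo_zero_kahlerTwo _
  have hΩ : ExteriorAlgebra.ιMulti ℂ 3 (fun i : Fin 3 => baseTheta α i.castSucc) =
      ϑ α 0 * ϑ α 1 * ϑ α 2 := by
    simp [ExteriorAlgebra.ιMulti_apply, List.ofFn_succ, ϑ, mul_assoc]
    rfl
  obtain ⟨a, b, c, h⟩ := hasInvDeriv_ϑ_three (α := α)
  obtain ⟨a', b', c', h'⟩ := hasInvDeriv_ϑbar_three (α := α)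
  refine HasInvDeriv.expForm_mul_closed (invo_complexTwo _ _) ((h.mul h').neg.congr hC.symm rfl)
    ((closed_ϑ_three hα).congr hΩ.symm rfl) ?_
  rw [hΩ]
  have key : ∀ i : Fin 4, i < 3 → ∀ ρ, ϑ α i * (ρ * (ϑ α 0 * ϑ α 1 * ϑ α 2)) = 0 := by
    intro i hi ρ
    refine ϑ_mul_mul_eq_zero ?_ ρ
    fin_cases i <;> simp only [Fin.reduceFinMk, Fin.zero_eta, Fin.mk_one, mul_assoc, ϑ_sq_mul, ϑ_sq,
      ϑ_swap_mul_of_lt, Fin.reduceLT, mul_zero, neg_zero] at hi ⊢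
  have h0 := key 0 (by decide)
  have h1 := key 1 (by decide)
  have h2 := key 2 (by decide)
  have e : ∀ a b c ρ : CForms (Fin 8 → ℝ),
      (ϑ α 0 * a + ϑ α 1 * b + ϑ α 2 * c) * (ρ * (ϑ α 0 * ϑ α 1 * ϑ α 2)) = 0 := by
    intro a b c ρ
    rw [add_mul, add_mul, mul_assoc (ϑ α 0) a, mul_assoc (ϑ α 1) b, mul_assoc (ϑ α 2) c, ← mul_assoc a,
      ← mul_assoc b, ← mul_assoc c, h0, h1, h2, add_zero, add_zero]
  rw [neg_mul, add_mul, mul_assoc _ (ϑbar α 3), e, mul_assoc, zero_add]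
  have := e a' b' c' 1
  rw [one_mul] at this
  rw [this, mul_zero, neg_zero]

/-- In d(θ³ ∧ θ⁴) ∧ θ¹ ∧ θ² every term containing θ¹ or θ² from the differentials dies. The only
other term comes from the θ³ part of dθ⁴ and carries θ³ ∧ θ³. -/
lemma closed_typeTwo (hα : 0 < α) :
    HasInvDeriv α (pureSpinor (reTwo (baseTheta α 2) (baseTheta α 3))
      (imTwo (baseTheta α 2) (baseTheta α 3)) ![baseTheta α 0, baseTheta α 1]) 0 := by
  have hC : complexTwo (reTwo (baseTheta α 2) (baseTheta α 3))
      (imTwo (baseTheta α 2) (baseTheta α 3)) = ϑ α 2 * ϑ α 3 := complexTwo_reTwo_imTwo _ _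
  have hΩ : ExteriorAlgebra.ιMulti ℂ 2 ![baseTheta α 0, baseTheta α 1] = ϑ α 0 * ϑ α 1 := by
    simp [ExteriorAlgebra.ιMulti_apply, List.ofFn_succ, ϑ]
  obtain ⟨a, b, h⟩ := hasInvDeriv_ϑ_two hα
  obtain ⟨a', b', c', h'⟩ := hasInvDeriv_ϑ_three (α := α)
  refine HasInvDeriv.expForm_mul_closed (invo_complexTwo _ _) ((h.mul h').congr hC.symm rfl)
    (closed_ϑ_two.congr hΩ.symm rfl) ?_
  rw [hΩ]
  have h0 : ∀ ρ, ϑ α 0 * (ρ * (ϑ α 0 * ϑ α 1)) = 0 := ϑ_mul_mul_eq_zero (ϑ_sq_mul 0 _)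
  have h1 : ∀ ρ, ϑ α 1 * (ρ * (ϑ α 0 * ϑ α 1)) = 0 := ϑ_mul_mul_eq_zero (by
    rw [ϑ_swap_mul_of_lt (by decide), ϑ_sq, mul_zero, neg_zero])
  have e : ∀ a b c ρ : CForms (Fin 8 → ℝ),
      (ϑ α 0 * a + ϑ α 1 * b + c) * (ρ * (ϑ α 0 * ϑ α 1)) = c * (ρ * (ϑ α 0 * ϑ α 1)) := by
    intro a b c ρ
    rw [add_mul, add_mul, mul_assoc, mul_assoc, ← mul_assoc a, ← mul_assoc b, h0, h1, add_zero,
      zero_add]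
  have e1 := e a b 0 (ϑ α 3)
  have e2 := e a' b' (ϑ α 2 * c') 1
  rw [add_zero, zero_mul] at e1
  rw [one_mul] at e2
  rw [add_mul, mul_assoc _ (ϑ α 3), e1, zero_add, mul_assoc, e2, invo_ϑ, neg_mul, mul_assoc,
    ϑ_sq_mul, neg_zero]

end Nilmanifold

/-! ### Independence of the θ's and non-degeneracy in types 4, 3 and 2 -/

namespace Nilmanifold

open GCGeom NilGroup

variable {α : ℝ}

/-- The forms `θ¹, …, θ⁴` at the identity, followed by their conjugates. -/
def allTheta (α : ℝ) : Fin 8 → (Fin 8 → ℝ) →L[ℝ] ℂ :=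
  ![baseTheta α 0, baseTheta α 1, baseTheta α 2, baseTheta α 3,
    conj (baseTheta α 0), conj (baseTheta α 1), conj (baseTheta α 2), conj (baseTheta α 3)]

lemma baseTheta_apply (i : Fin 4) (v : Fin 8 → ℝ) : baseTheta α i v =
    ![(1 / 2 : ℂ) * (invSqrt α * v 0 - v 1) + Complex.I / 2 * (invSqrt α * v 0 + v 1),
      -(α * v 3) - Complex.I * invSqrt α * (1 / 2 * v 2 + v 4),
      α / (1 + α) ^ 2 * (v 5 - invSqrt α * v 6) +
        Complex.I * α / (1 + α) ^ 2 * (v 5 + invSqrt α * v 6),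
      invSqrt α * (v 4 + (1 - α) / (2 * (1 + α) ^ 2) * v 2)
        - Complex.I * α * (v 3 + 2 / (1 + α) ^ 2 * invSqrt α * v 7)] i := by
  fin_cases i <;> simp [baseTheta, theta, invSqrt] <;> ring

lemma conj_invSqrt : (starRingEnd ℂ) (invSqrt α) = invSqrt α := Complex.conj_ofReal _

/-- Evaluation on the basis vectors splits the system into three blocks: θ¹ with its conjugate on
the directions 1, 2; θ³ with its conjugate on 6, 7; θ², θ⁴ with theirs on 3, 4, 5, 8. -/
lemma linearIndependent_allTheta (hα : 0 < α) : LinearIndependent ℂ (allTheta α) := by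
  have hI : Complex.I ^ 2 = -1 := Complex.I_sq
  have hs0 : invSqrt α ≠ 0 := fun h => by simpa [h] using invSqrt_sq hα
  have hA : (α : ℂ) ≠ 0 := by exact_mod_cast hα.ne'
  have hA1 : (1 + α : ℂ) ≠ 0 := by
    have : (1 + α : ℝ) ≠ 0 := by positivity
    exact_mod_cast this
  have hA3 : (3 + α : ℂ) ≠ 0 := by
    have : (3 + α : ℝ) ≠ 0 := by positivity
    exact_mod_cast this
  rw [Fintype.linearIndependent_iff]
  intro g hg
  have ev : ∀ j, ∑ i, g i * allTheta α i (Pi.single j 1) = 0 := by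
    intro j
    have := DFunLike.congr_fun hg (Pi.single j (1 : ℝ))
    simpa using this
  have e0 := ev 0
  have e1 := ev 1
  have e2 := ev 2
  have e3 := ev 3
  have e4 := ev 4
  have e5 := ev 5
  have e6 := ev 6
  have e7 := ev 7
  simp [Fin.sum_univ_succ, allTheta, baseTheta_apply, conj_invSqrt, Complex.conj_ofNat,
    Pi.single_apply] at e0 e1 e2 e3 e4 e5 e6 e7
  have hc : (α / (1 + α) ^ 2 : ℂ) ≠ 0 := div_ne_zero hA (pow_ne_zero 2 hA1)
  have pair : ∀ a b : ℂ, a * (1 + Complex.I) + b * (1 - Complex.I) = 0 →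
      a * (-1 + Complex.I) + b * (-1 - Complex.I) = 0 → a = 0 ∧ b = 0 := by
    intro a b h h'
    constructor <;> grind
  have h04 := pair (g 0) (g 4)
    (mul_left_cancel₀ hs0 (by rw [mul_zero]; linear_combination 2 * e0))
    (by linear_combination 2 * e1)
  have h26 := pair (g 2) (g 6)
    (mul_left_cancel₀ hc (by rw [mul_zero]; linear_combination e5))
    (mul_left_cancel₀ (mul_ne_zero hc hs0) (by rw [mul_zero]; linear_combination e6))
  have h37 : g 7 = g 3 := by
    have : (Complex.I * α * (2 / (1 + α) ^ 2) * invSqrt α : ℂ) ≠ 0 := by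
      simp [hA, hA1, hs0]
    have h : (Complex.I * α * (2 / (1 + α) ^ 2) * invSqrt α) * (g 7 - g 3) = 0 := by
      linear_combination e7
    exact sub_eq_zero.1 ((mul_eq_zero.1 h).resolve_left this)
  have h15 : g 5 = -g 1 := by
    have h : (α : ℂ) * (g 5 + g 1) = 0 := by rw [h37] at e3; linear_combination -e3
    exact eq_neg_of_add_eq_zero_left ((mul_eq_zero.1 h).resolve_left hA)
  have h4 : -Complex.I * g 1 + g 3 = 0 := by
    rw [h37, h15] at e4
    refine (mul_eq_zero.1 (?_ : invSqrt α * (-Complex.I * g 1 + g 3) = 0)).resolve_left hs0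
    linear_combination e4 / 2
  have h2 : -Complex.I / 2 * g 1 + (1 - α) / (2 * (1 + α) ^ 2) * g 3 = 0 := by
    rw [h37, h15] at e2
    refine (mul_eq_zero.1 (?_ : invSqrt α * (-Complex.I / 2 * g 1 +
      (1 - α) / (2 * (1 + α) ^ 2) * g 3) = 0)).resolve_left hs0
    linear_combination e2 / 2
  -- Eliminating g 1 from the two remaining equations leaves the factor (1 + α)² - (1 - α) = α(3 +
  -- α), nonzero for α > 0.
  have h3 : g 3 = 0 := by
    have h : (α * (3 + α) : ℂ) * g 3 = 0 := by
      field_simp at h2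
      linear_combination (1 + α : ℂ) ^ 2 * h4 - h2
    exact (mul_eq_zero.1 h).resolve_left (mul_ne_zero hA hA3)
  have h1 : g 1 = 0 := by
    rw [h3, add_zero] at h4
    exact (mul_eq_zero.1 h4).resolve_left (neg_ne_zero.2 Complex.I_ne_zero)
  rw [h1, neg_zero] at h15
  rw [h3] at h37
  simp [Fin.forall_fin_succ, h1, h3, h15, h37, h04, h26]

/-- Products of the forms `θ¹, …, θ⁴` and their conjugates, in any order, do not vanish. -/
lemma ιMulti_allTheta_ne_zero (hα : 0 < α) {f : Fin 8 → Fin 8} (hf : Function.Injective f) :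
    ExteriorAlgebra.ιMulti ℂ 8 (allTheta α ∘ f) ≠ 0 :=
  ιMulti_ne_zero_of_linearIndependent ((linearIndependent_allTheta hα).comp f hf)

lemma ιMulti_allTheta (f : Fin 8 → Fin 8) : ExteriorAlgebra.ιMulti ℂ 8 (allTheta α ∘ f) =
    oneForm (allTheta α (f 0)) * oneForm (allTheta α (f 1)) * oneForm (allTheta α (f 2)) *
      oneForm (allTheta α (f 3)) * oneForm (allTheta α (f 4)) * oneForm (allTheta α (f 5)) *
      oneForm (allTheta α (f 6)) * oneForm (allTheta α (f 7)) := by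
  simp only [ExteriorAlgebra.ιMulti_apply, List.ofFn_succ, List.ofFn_zero, List.prod_cons, List.prod_nil,
    mul_one, mul_assoc]
  rfl

lemma nondegenerate_typeFour (hα : 0 < α) : NondegenerateAt 0 (baseTheta α) 4 where
  finrank_eq := by simp
  le := le_rfl
  pos := by norm_num
  ne_zero := by
    have h := ιMulti_allTheta_ne_zero hα Function.injective_id
    rw [ιMulti_allTheta] at h
    rw [Nat.sub_self, pow_zero, one_mul]
    simp only [ExteriorAlgebra.ιMulti_apply, List.ofFn_succ, List.ofFn_zero, List.prod_cons,
      List.prod_nil, mul_one, ← mul_assoc]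
    exact h

lemma nondegenerate_typeThree (hα : 0 < α) :
    NondegenerateAt (kahlerTwo (baseTheta α 3)) (fun i : Fin 3 => baseTheta α i.castSucc) 4 where
  finrank_eq := by simp
  le := by norm_num
  pos := by norm_num
  ne_zero := by
    -- The permutation lists the factors in the order in which they occur in ω ∧ Ω ∧ Ω̄, so no sign
    -- has to be computed.
    have h := ιMulti_allTheta_ne_zero hα (f := ![3, 7, 0, 1, 2, 4, 5, 6]) (by decide)
    rw [ιMulti_allTheta] at h
    rw [complexify_kahlerTwo, pow_one, smul_mul_assoc, smul_mul_assoc]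
    refine smul_ne_zero Complex.I_ne_zero ?_
    simp only [ExteriorAlgebra.ιMulti_apply, List.ofFn_succ, List.ofFn_zero, List.prod_cons,
      List.prod_nil, mul_one, ← mul_assoc]
    exact h

lemma nondegenerate_typeTwo (hα : 0 < α) :
    NondegenerateAt (imTwo (baseTheta α 2) (baseTheta α 3)) ![baseTheta α 0, baseTheta α 1] 4 where
  finrank_eq := by simp
  le := by norm_num
  pos := by norm_num
  ne_zero := by
    have h := ιMulti_allTheta_ne_zero hα (f := ![2, 3, 6, 7, 0, 1, 4, 5]) (by decide)
    rw [ιMulti_allTheta] at h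
    have hI : Complex.I ^ 2 = -1 := Complex.I_sq
    -- With P = θ³ ∧ θ⁴ one has P² = 0 and its conjugate squares to zero; the two commute, so only
    -- the cross term of ω² survives.
    have h2 : complexify (imTwo (baseTheta α 2) (baseTheta α 3) : RForms (Fin 8 → ℝ)) ^ (4 - 2) =
        (1 / 2 : ℂ) • (ϑ α 2 * ϑ α 3 * (ϑbar α 2 * ϑbar α 3)) := by
      have hc : Commute (ϑ α 2 * ϑ α 3) (ϑbar α 2 * ϑbar α 3) :=
        commute_of_invo_eq (by rw [map_mul, invo_ϑ, invo_ϑ, neg_mul_neg]) _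
      have h3 : ϑ α 2 * ϑ α 3 * (ϑ α 2 * ϑ α 3) = 0 := by
        rw [mul_assoc, ← mul_assoc (ϑ α 3), ϑ, ϑ, oneForm_swap (baseTheta α 3), neg_mul, mul_neg, mul_assoc,
          ← mul_assoc, oneForm_sq, zero_mul, neg_zero]
      have h4 : ϑbar α 2 * ϑbar α 3 * (ϑbar α 2 * ϑbar α 3) = 0 := by
        rw [mul_assoc, ← mul_assoc (ϑbar α 3), ϑbar, ϑbar, oneForm_swap (conj (baseTheta α 3)), neg_mul,
          mul_neg, mul_assoc, ← mul_assoc, oneForm_sq, zero_mul, neg_zero]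
      rw [complexify_imTwo, show 4 - 2 = 2 from rfl, pow_two]
      change ((-Complex.I / 2) • (ϑ α 2 * ϑ α 3 - ϑbar α 2 * ϑbar α 3)) *
        ((-Complex.I / 2) • (ϑ α 2 * ϑ α 3 - ϑbar α 2 * ϑbar α 3)) = _
      rw [smul_mul_smul_comm, sub_mul, mul_sub, mul_sub, h3, h4, ← hc.eq]
      match_scalars
      grind
    rw [h2, smul_mul_assoc, smul_mul_assoc]
    refine smul_ne_zero (by norm_num) ?_
    simp only [ExteriorAlgebra.ιMulti_apply, List.ofFn_succ, List.ofFn_zero, List.prod_cons,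
      List.prod_nil, mul_one, ← mul_assoc]
    exact h

end Nilmanifold

/-! ### The two-form with twelve coefficients: types 1 and 0 -/

namespace Nilmanifold

open GCGeom NilGroup

variable {α : ℝ}

section Generic

variable {V : Type*} [AddCommGroup V] [Module ℝ V] [TopologicalSpace V]

lemma twoForm_mem (e : Fin 8 → V →L[ℝ] ℝ)
    (x12 x13 x14 x15 x16 x17 x23 x24 x25 x27 x34 x37 : ℝ) :
    twoForm α e x12 x13 x14 x15 x16 x17 x23 x24 x25 x27 x34 x37 ∈ ⋀[ℝ]^2 (V →L[ℝ] ℝ) := by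
  have h : ∀ i j, ExteriorAlgebra.ι ℝ (e i) * ExteriorAlgebra.ι ℝ (e j) ∈ ⋀[ℝ]^2 (V →L[ℝ] ℝ) :=
    fun i j => mul_mem_exteriorPower (ι_mem_exteriorPower_one _) (ι_mem_exteriorPower_one _)
  unfold twoForm
  repeat'
    first
    | exact Submodule.smul_mem _ _ (h _ _)
    | refine Submodule.add_mem _ ?_ ?_
    | refine Submodule.sub_mem _ ?_ ?_

end Generic

/-- The two-form with twelve coefficients at the identity. -/
def baseTwo (α x12 x13 x14 x15 x16 x17 x23 x24 x25 x27 x34 x37 : ℝ) :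
    ⋀[ℝ]^2 ((Fin 8 → ℝ) →L[ℝ] ℝ) :=
  ⟨twoForm α (fun j => ContinuousLinearMap.proj j) x12 x13 x14 x15 x16 x17 x23 x24 x25 x27 x34 x37,
    twoForm_mem _ _ _ _ _ _ _ _ _ _ _ _ _⟩

variable {x12 x13 x14 x15 x16 x17 x23 x24 x25 x27 x34 x37 : ℝ}

lemma complexify_baseTwo :
    complexify (baseTwo α x12 x13 x14 x15 x16 x17 x23 x24 x25 x27 x34 x37 : RForms (Fin 8 → ℝ)) =
      (x12 : ℂ) • (ε 0 * ε 1) + (x13 : ℂ) • (ε 0 * ε 2) + (x14 : ℂ) • (ε 0 * ε 3)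
      + (x15 : ℂ) • (ε 0 * ε 4) + (x16 : ℂ) • (ε 0 * ε 5) + (x17 : ℂ) • (ε 0 * ε 6)
      - (((1 + α) * x37 : ℝ) : ℂ) • (ε 0 * ε 7) + (x23 : ℂ) • (ε 1 * ε 2) + (x24 : ℂ) • (ε 1 * ε 3)
      + (x25 : ℂ) • (ε 1 * ε 4) + (((1 + α) * x17 : ℝ) : ℂ) • (ε 1 * ε 5) + (x27 : ℂ) • (ε 1 * ε 6)
      + (x34 : ℂ) • (ε 2 * ε 3) + (x17 : ℂ) • (ε 2 * ε 4) + (x37 : ℂ) • (ε 2 * ε 6)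
      - (((1 - α) * x16 + (1 + α) * x27 : ℝ) : ℂ) • (ε 3 * ε 4)
      + (((1 + α) * (3 + α) * x37 : ℝ) : ℂ) • (ε 3 * ε 5)
      - (((1 + α) * x37 : ℝ) : ℂ) • (ε 4 * ε 6) := by
  simp only [baseTwo, twoForm, map_add, map_sub, complexify_smul, map_mul, complexify_ι]
  rfl

lemma hasInvDeriv_ε_mul (i j : Fin 8) : HasInvDeriv α (ε i * ε j)
    (structureForm α i * ε j - ε i * structureForm α j) :=
  ((hasInvDeriv_ε i).mul (hasInvDeriv_ε j)).congr rfl (by rw [invo_ε, neg_mul, sub_eq_add_neg])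

/-- The dependent coefficients of ω_x are such that dω_x cancels identically in the twelve
parameters. -/
lemma closed_baseTwo : HasInvDeriv α (complexify
    (baseTwo α x12 x13 x14 x15 x16 x17 x23 x24 x25 x27 x34 x37 : RForms (Fin 8 → ℝ))) 0 := by
  have h := fun (c : ℂ) (i j : Fin 8) => (hasInvDeriv_ε_mul (α := α) i j).smul c
  refine ((h _ 0 1).add (h _ 0 2) |>.add (h _ 0 3) |>.add (h _ 0 4) |>.add (h _ 0 5)
    |>.add (h _ 0 6) |>.sub (h _ 0 7) |>.add (h _ 1 2) |>.add (h _ 1 3) |>.add (h _ 1 4)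
    |>.add (h _ 1 5) |>.add (h _ 1 6) |>.add (h _ 2 3) |>.add (h _ 2 4) |>.add (h _ 2 6)
    |>.sub (h _ 3 4) |>.add (h _ 3 5) |>.sub (h _ 4 6)).congr complexify_baseTwo.symm ?_
  simp only [structureForm, Matrix.cons_val, mul_add, add_mul, mul_sub, sub_mul,
    mul_neg, neg_mul, smul_mul_assoc, mul_smul_comm, mul_assoc, ε_sq, ε_sq_mul, ε_swap_of_lt,
    ε_swap_mul_of_lt, Fin.reduceLT, zero_mul, mul_zero, smul_neg, smul_zero, neg_neg]
  push_cast
  module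

lemma complexTwo_zero_left (w : ⋀[ℝ]^2 ((Fin 8 → ℝ) →L[ℝ] ℝ)) :
    complexTwo 0 w = Complex.I • complexify (w : RForms (Fin 8 → ℝ)) := by
  rw [complexTwo, Submodule.coe_zero, map_zero, zero_add]

lemma closed_complexTwo_baseTwo : HasInvDeriv α (complexTwo 0
    (baseTwo α x12 x13 x14 x15 x16 x17 x23 x24 x25 x27 x34 x37)) 0 :=
  (closed_baseTwo.smul Complex.I).congr (complexTwo_zero_left _).symm (smul_zero _)

/-- The complex covector `e³ + i e⁴` at the identity. -/
def baseE34 : (Fin 8 → ℝ) →L[ℝ] ℂ :=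
  toComplex (ContinuousLinearMap.proj 2) + Complex.I • toComplex (ContinuousLinearMap.proj 3)

lemma oneForm_baseE34 : oneForm baseE34 = ε 2 + Complex.I • ε 3 := by
  rw [baseE34, oneForm_add, oneForm_smul]; rfl

lemma oneForm_conj_baseE34 : oneForm (conj baseE34) = ε 2 - Complex.I • ε 3 := by
  have : conj baseE34 = toComplex (ContinuousLinearMap.proj 2) -
      Complex.I • toComplex (ContinuousLinearMap.proj 3) := by
    ext v
    simp [baseE34, sub_eq_add_neg]
  rw [this, oneForm_sub, oneForm_smul]; rfl

lemma closed_typeOne : HasInvDeriv α (pureSpinor 0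
    (baseTwo α x12 x13 x14 x15 x16 x17 x23 x24 x25 x27 x34 x37) ![baseE34]) 0 := by
  have hΩ : ExteriorAlgebra.ιMulti ℂ 1 ![baseE34] = ε 2 + Complex.I • ε 3 := by
    simp only [ExteriorAlgebra.ιMulti_apply, List.ofFn_succ, List.ofFn_zero, List.prod_cons,
      List.prod_nil, mul_one]
    exact oneForm_baseE34
  have hd : HasInvDeriv α (ε 2 + Complex.I • ε 3) 0 :=
    ((hasInvDeriv_ε 2).add ((hasInvDeriv_ε 3).smul Complex.I)).congr rfl (by simp [structureForm])
  exact HasInvDeriv.expForm_mul_closed (invo_complexTwo _ _) closed_complexTwo_baseTwo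
    (hd.congr hΩ.symm rfl) (zero_mul _)

lemma closed_typeZero (θ : Fin 0 → (Fin 8 → ℝ) →L[ℝ] ℂ) : HasInvDeriv α (pureSpinor 0
    (baseTwo α x12 x13 x14 x15 x16 x17 x23 x24 x25 x27 x34 x37) θ) 0 :=
  HasInvDeriv.expForm_mul_closed (invo_complexTwo _ _) closed_complexTwo_baseTwo
    (HasInvDeriv.one.congr (by simp [ExteriorAlgebra.ιMulti_apply]) rfl) (zero_mul _)

/-- The standard basis vectors of `ℝ⁸`. -/
def basisVec (k : Fin 8) : Fin 8 → ℝ := Pi.single k 1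

lemma interior_basisVec_ε (k i : Fin 8) :
    GCGeom.interior (basisVec k) (ε i) = (if i = k then (1 : ℂ) else 0) • 1 := by
  rw [ε, interior_oneForm, Algebra.algebraMap_eq_smul_one]
  congr 1
  simp [basisVec, Pi.single_apply, apply_ite Complex.ofReal]

lemma interior_basisVec_ε_mul (k i : Fin 8) (ρ : CForms (Fin 8 → ℝ)) :
    GCGeom.interior (basisVec k) (ε i * ρ) =
      (if i = k then (1 : ℂ) else 0) • ρ - ε i * GCGeom.interior (basisVec k) ρ := by
  rw [interior_mul, interior_basisVec_ε, invo_ε, smul_mul_assoc, one_mul, neg_mul, sub_eq_add_neg]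

lemma interior_baseTwo (k : Fin 8) : GCGeom.interior (basisVec k)
    (complexify (baseTwo α x12 x13 x14 x15 x16 x17 x23 x24 x25 x27 x34 x37 : RForms (Fin 8 → ℝ))) =
      ![(x12 : ℂ) • ε 1 + (x13 : ℂ) • ε 2 + (x14 : ℂ) • ε 3 + (x15 : ℂ) • ε 4 + (x16 : ℂ) • ε 5
          + (x17 : ℂ) • ε 6 - (((1 + α) * x37 : ℝ) : ℂ) • ε 7,
        -((x12 : ℂ) • ε 0) + (x23 : ℂ) • ε 2 + (x24 : ℂ) • ε 3 + (x25 : ℂ) • ε 4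
          + (((1 + α) * x17 : ℝ) : ℂ) • ε 5 + (x27 : ℂ) • ε 6,
        -((x13 : ℂ) • ε 0) - (x23 : ℂ) • ε 1 + (x34 : ℂ) • ε 3 + (x17 : ℂ) • ε 4 + (x37 : ℂ) • ε 6,
        -((x14 : ℂ) • ε 0) - (x24 : ℂ) • ε 1 - (x34 : ℂ) • ε 2
          - (((1 - α) * x16 + (1 + α) * x27 : ℝ) : ℂ) • ε 4
          + (((1 + α) * (3 + α) * x37 : ℝ) : ℂ) • ε 5,
        -((x15 : ℂ) • ε 0) - (x25 : ℂ) • ε 1 - (x17 : ℂ) • ε 2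
          + (((1 - α) * x16 + (1 + α) * x27 : ℝ) : ℂ) • ε 3 - (((1 + α) * x37 : ℝ) : ℂ) • ε 6,
        -((x16 : ℂ) • ε 0) - (((1 + α) * x17 : ℝ) : ℂ) • ε 1
          - (((1 + α) * (3 + α) * x37 : ℝ) : ℂ) • ε 3,
        -((x17 : ℂ) • ε 0) - (x27 : ℂ) • ε 1 - (x37 : ℂ) • ε 2 + (((1 + α) * x37 : ℝ) : ℂ) • ε 4,
        (((1 + α) * x37 : ℝ) : ℂ) • ε 0] k := by
  rw [complexify_baseTwo]
  simp only [interior_add, interior_sub, GCGeom.interior_smul, interior_basisVec_ε_mul,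
    interior_basisVec_ε]
  fin_cases k <;>
  simp only [Fin.reduceFinMk, Fin.zero_eta, Fin.mk_one, Fin.reduceEq, reduceIte, one_smul, zero_smul,
    mul_zero, mul_one, zero_sub, sub_zero, Matrix.cons_val] <;>
  module

/-- The peeling step: contracting with a vector that kills R lowers the power by one and adds the
factor ι_X C to R. It spares the expansion of the third and fourth powers of ω. -/
lemma pow_mul_interior_eq_zero {C R : CForms (Fin 8 → ℝ)} (hC : invo C = C) {X : Fin 8 → ℝ}
    (hR : GCGeom.interior X R = 0) {m : ℕ} (h : C ^ (m + 1) * R = 0) :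
    C ^ m * (GCGeom.interior X C * R) = 0 := by
  have h1 : GCGeom.interior X (C ^ (m + 1) * R) = 0 := by rw [h, interior_zero]
  rw [interior_mul, hR, mul_zero, add_zero, interior_eq, contractLeft_pow hC, smul_mul_assoc,
    smul_eq_zero, mul_assoc] at h1
  exact h1.resolve_left (by exact_mod_cast Nat.succ_ne_zero m)

lemma ιMulti_ε_ne_zero {k : ℕ} {f : Fin k → Fin 8} (hf : Function.Injective f) :
    ExteriorAlgebra.ιMulti ℂ k (fun i => toComplex
      (ContinuousLinearMap.proj (f i) : (Fin 8 → ℝ) →L[ℝ] ℝ)) ≠ 0 := by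
  refine ιMulti_ne_zero_of_linearIndependent (LinearIndependent.comp (v := fun i => toComplex
      (ContinuousLinearMap.proj i : (Fin 8 → ℝ) →L[ℝ] ℝ)) ?_ f hf)
  rw [Fintype.linearIndependent_iff]
  intro g hg j
  simpa [Pi.single_apply, apply_ite Complex.ofReal] using DFunLike.congr_fun hg (Pi.single j (1 : ℝ))

/-- Peeling ω³ ∧ e³⁴ in the directions 8 and 6 adds e¹ and then e², with coefficients (1+α)x37 and
(1+α)x17 up to sign. In the remaining ω ∧ e¹²³⁴ only the e⁵⁷ term of ω survives, again with
coefficient (1+α)x37 up to sign. -/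
lemma pow_baseTwo_mul_ne_zero (hα : 0 < α) (h17 : x17 ≠ 0) (h37 : x37 ≠ 0) :
    complexify (baseTwo α x12 x13 x14 x15 x16 x17 x23 x24 x25 x27 x34 x37 : RForms (Fin 8 → ℝ)) ^ 3 *
      (ε 2 * ε 3) ≠ 0 := by
  intro h
  have hC := invo_complexify_two (baseTwo α x12 x13 x14 x15 x16 x17 x23 x24 x25 x27 x34 x37)
  have c1 : (((1 + α) * x37 : ℝ) : ℂ) ≠ 0 := by
    exact_mod_cast mul_ne_zero (by positivity) h37
  have c2 : (((1 + α) * x17 : ℝ) : ℂ) ≠ 0 := by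
    exact_mod_cast mul_ne_zero (by positivity) h17
  have h1 := pow_mul_interior_eq_zero hC (X := basisVec 7)
    (by simp [interior_basisVec_ε_mul, interior_basisVec_ε]) h
  rw [interior_baseTwo] at h1
  simp only [Matrix.cons_val, smul_mul_assoc, mul_smul_comm, smul_eq_zero, c1, false_or] at h1
  have h2 := pow_mul_interior_eq_zero hC (X := basisVec 5)
    (by simp [interior_basisVec_ε_mul, interior_basisVec_ε]) h1
  rw [interior_baseTwo] at h2
  simp only [Matrix.cons_val, sub_mul, neg_mul, smul_mul_assoc, ε_sq, ε_sq_mul, ε_swap_mul_of_lt,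
    Fin.reduceLT, mul_zero, smul_zero, neg_zero, smul_neg, zero_sub, sub_zero, mul_neg, neg_neg,
    mul_smul_comm, smul_eq_zero, c2, false_or, pow_one] at h2
  have e : complexify (baseTwo α x12 x13 x14 x15 x16 x17 x23 x24 x25 x27 x34 x37 : RForms (Fin 8 → ℝ)) *
      (ε 0 * (ε 1 * (ε 2 * ε 3))) =
        (-(((1 + α) * x37 : ℝ) : ℂ)) • (ε 0 * (ε 1 * (ε 2 * (ε 3 * (ε 4 * ε 6))))) := by
    rw [complexify_baseTwo]
    simp only [add_mul _ _ (ε _ * _), sub_mul _ _ (ε _ * _), smul_mul_assoc, mul_assoc, ε_sq, ε_sq_mul,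
      ε_swap_of_lt, ε_swap_mul_of_lt, Fin.reduceLT, mul_zero, neg_zero, mul_neg, neg_neg]
    module
  rw [e, smul_eq_zero] at h2
  refine ιMulti_ε_ne_zero (f := ![0, 1, 2, 3, 4, 6]) (by decide)
    (Eq.trans ?_ (h2.resolve_left (neg_ne_zero.2 c1)))
  simp only [ExteriorAlgebra.ιMulti_apply, List.ofFn_succ, List.ofFn_zero, List.prod_cons,
    List.prod_nil, mul_one]
  rfl

/-- Peeling in the directions 8, 6, 3, 2 adds e¹, e⁴, e⁷, e⁵ in turn. The coefficients are, up to
sign, (1+α)x37, (1+α)(3+α)x37, x37 and x25; the vanishing of x17 and x23 leaves a single new term at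
each stage. -/
lemma pow_baseTwo_ne_zero (hα : 0 < α) (h17 : x17 = 0) (h23 : x23 = 0) (h25 : x25 ≠ 0)
    (h37 : x37 ≠ 0) : complexify (baseTwo α x12 x13 x14 x15 x16 x17 x23 x24 x25 x27 x34 x37 :
      RForms (Fin 8 → ℝ)) ^ 4 ≠ 0 := by
  subst h17 h23
  intro h
  have hC := invo_complexify_two (baseTwo α x12 x13 x14 x15 x16 0 0 x24 x25 x27 x34 x37)
  have c1 : (((1 + α) * x37 : ℝ) : ℂ) ≠ 0 := by
    exact_mod_cast mul_ne_zero (by positivity) h37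
  have c2 : (((1 + α) * (3 + α) * x37 : ℝ) : ℂ) ≠ 0 := by
    exact_mod_cast mul_ne_zero (by positivity) h37
  have c3 : (x37 : ℂ) ≠ 0 := by exact_mod_cast h37
  have c4 : (x25 : ℂ) ≠ 0 := by exact_mod_cast h25
  have h1 := pow_mul_interior_eq_zero hC (X := basisVec 7) (R := 1) (m := 3)
    (interior_one _) (by rw [mul_one, h])
  rw [interior_baseTwo] at h1
  simp only [Matrix.cons_val, mul_one, mul_smul_comm, smul_eq_zero, c1, false_or] at h1
  have h2 := pow_mul_interior_eq_zero hC (X := basisVec 5) (m := 2)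
    (by simp [interior_basisVec_ε]) h1
  rw [interior_baseTwo] at h2
  simp only [Matrix.cons_val, mul_zero, Complex.ofReal_zero, zero_smul, sub_mul, neg_mul,
    smul_mul_assoc, ε_sq, ε_sq_mul, ε_swap_of_lt, ε_swap_mul_of_lt,
    Fin.reduceLT, mul_zero, smul_zero, neg_zero, smul_neg, zero_sub, sub_zero, mul_neg, neg_neg,
    mul_smul_comm, smul_eq_zero, c2, false_or] at h2
  have h3 := pow_mul_interior_eq_zero hC (X := basisVec 2) (m := 1)
    (by simp [interior_basisVec_ε_mul, interior_basisVec_ε]) h2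
  rw [interior_baseTwo] at h3
  simp only [Matrix.cons_val, mul_zero, Complex.ofReal_zero, zero_smul, sub_mul, add_mul, neg_mul,
    smul_mul_assoc, ε_sq, ε_sq_mul, ε_swap_of_lt, ε_swap_mul_of_lt, add_zero, zero_add,
    Fin.reduceLT, mul_zero, smul_zero, neg_zero, smul_neg, zero_sub, sub_zero, mul_neg, neg_neg,
    mul_smul_comm, smul_eq_zero, c3, false_or] at h3
  have h4 := pow_mul_interior_eq_zero hC (X := basisVec 1) (m := 0)
    (by simp [interior_basisVec_ε_mul, interior_basisVec_ε]) h3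
  rw [interior_baseTwo] at h4
  simp only [Matrix.cons_val, mul_zero, Complex.ofReal_zero, zero_smul, sub_mul, add_mul, neg_mul,
    smul_mul_assoc, ε_sq, ε_sq_mul, ε_swap_of_lt, ε_swap_mul_of_lt, add_zero, zero_add,
    Fin.reduceLT, mul_zero, smul_zero, neg_zero, smul_neg, zero_sub, sub_zero, mul_neg, neg_neg,
    mul_smul_comm, smul_eq_zero, c4, false_or, pow_zero, one_mul] at h4
  refine ιMulti_ε_ne_zero (f := ![0, 3, 4, 6]) (by decide) (Eq.trans ?_ h4)
  simp only [ExteriorAlgebra.ιMulti_apply, List.ofFn_succ, List.ofFn_zero, List.prod_cons,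
    List.prod_nil, mul_one]
  rfl

lemma nondegenerate_typeOne (hα : 0 < α) (h17 : x17 ≠ 0) (h37 : x37 ≠ 0) :
    NondegenerateAt (baseTwo α x12 x13 x14 x15 x16 x17 x23 x24 x25 x27 x34 x37) ![baseE34] 4 where
  finrank_eq := by simp
  le := by norm_num
  pos := by norm_num
  ne_zero := by
    have h : ExteriorAlgebra.ιMulti ℂ 1 ![baseE34] *
        ExteriorAlgebra.ιMulti ℂ 1 (fun i => conj (![baseE34] i)) =
          (-2 * Complex.I) • (ε 2 * ε 3) := by
      simp only [ExteriorAlgebra.ιMulti_apply, List.ofFn_succ, List.ofFn_zero, List.prod_cons,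
        List.prod_nil, mul_one]
      refine (congrArg₂ (· * ·) oneForm_baseE34 oneForm_conj_baseE34).trans ?_
      simp only [mul_sub, add_mul, mul_smul_comm, smul_mul_assoc, ε_sq, ε_swap_of_lt, Fin.reduceLT]
      module
    rw [mul_assoc, h, mul_smul_comm]
    exact smul_ne_zero (by simp) (pow_baseTwo_mul_ne_zero hα h17 h37)

lemma nondegenerate_typeZero (hα : 0 < α) (h17 : x17 = 0) (h23 : x23 = 0) (h25 : x25 ≠ 0)
    (h37 : x37 ≠ 0) (θ : Fin 0 → (Fin 8 → ℝ) →L[ℝ] ℂ) :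
    NondegenerateAt (baseTwo α x12 x13 x14 x15 x16 x17 x23 x24 x25 x27 x34 x37) θ 4 where
  finrank_eq := by simp
  le := by norm_num
  pos := by norm_num
  ne_zero := by
    simpa [ExteriorAlgebra.ιMulti_apply] using pow_baseTwo_ne_zero hα h17 h23 h25 h37

end Nilmanifold

/-! ### Complex structures: Nijenhuis tensor and holomorphic volume form -/

namespace GCGeom

section Courant

variable {E : Type*} [NormedAddCommGroup E] [NormedSpace ℝ E] [FiniteDimensional ℝ E]
  {M : Type*} [TopologicalSpace M] [ChartedSpace E M]

lemma courant_fst (u v : GenField E M) (x : M) :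
    (courant u v x).1 =
      VectorField.mlieBracket 𝓘(ℝ, E) (fun y => (u y).1) (fun y => (v y).1) x := by
  simp only [VectorField.mlieBracket, VectorField.mlieBracketWithin, VectorField.mpullback_apply,
    modelWithCornersSelf_coe, Set.range_id, Set.preimage_univ, Set.univ_inter,
    VectorField.mpullbackWithin_univ]
  have h := congrFun (VectorField.lieBracketWithin_univ (𝕜 := ℝ) (V := fun z => (genRep u x z).1)
    (W := fun z => (genRep v x z).1)) (chartAt E x x)
  exact (congrArg (mfderiv 𝓘(ℝ, E) 𝓘(ℝ, E) (chartAt E x) x).inverse h).symm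

lemma SmoothGenAt.neg {u : GenField E M} {x : M} (h : SmoothGenAt u x) :
    SmoothGenAt (fun y => -u y) x := by
  have : genRep (fun y => -u y) x = fun y => -genRep u x y := by
    funext y
    exact map_neg (pullGenL (chartDeriv x y)) (u ((chartAt E x).symm y))
  rw [SmoothGenAt, this]
  exact ContDiffAt.neg h

/-- The complex structure underlying a generalized complex structure of the form `(-J, 0; 0, J*)`. -/
lemma GCStructure.isOfComplex (𝒥 : GCStructure E M)
    (J : ∀ x : M, TangentSpace 𝓘(ℝ, E) x →L[ℝ] TangentSpace 𝓘(ℝ, E) x)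
    (hJ : ∀ (x : M) (a : Gen (TangentSpace 𝓘(ℝ, E) x)), 𝒥.J x a = (-(J x a.1), a.2.comp (J x))) :
    𝒥.IsOfComplex J := by
  have hfst : ∀ (x : M) (v : TangentSpace 𝓘(ℝ, E) x), 𝒥.J x (v, 0) = -(J x v, 0) := fun x v => by
    rw [hJ]
    exact Prod.ext rfl ((ContinuousLinearMap.zero_comp _).trans neg_zero.symm)
  have hsq : ∀ (x : M) (v : TangentSpace 𝓘(ℝ, E) x), J x (J x v) = -v := fun x v => by
    have h := 𝒥.sq x (v, 0)
    rw [hfst, map_neg, hfst, neg_neg] at h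
    exact congrArg Prod.fst h
  have hsm : ∀ (X : ∀ x : M, TangentSpace 𝓘(ℝ, E) x) (x : M),
      SmoothGenAt (fun y => (X y, 0)) x → SmoothGenAt (fun y => (J y (X y), 0)) x := by
    intro X x h
    have h1 := (𝒥.smooth _ x h).neg
    have h2 : (fun y => -𝒥.J y (X y, 0)) =
        (fun y => ((J y (X y), 0) : Gen (TangentSpace 𝓘(ℝ, E) y))) :=
      funext fun y => by rw [hfst, neg_neg]
    rwa [h2] at h1
  refine ⟨⟨hsm, hsq, ?_⟩, hJ⟩
  intro X Y x hX hY
  -- The sections X + iJX and Y + iJY lie in the i-eigenbundle. The vector part of their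
  -- involutivity, after J is applied once more, is the vanishing of the Nijenhuis tensor.
  have h := congrArg Prod.fst (𝒥.involutive (fun y => (X y, 0)) (fun y => (J y (X y), 0))
    (fun y => (Y y, 0)) (fun y => (J y (Y y), 0)) x hX (hsm X x hX) hY (hsm Y x hY)
    (Filter.Eventually.of_forall fun y => hfst y _) (Filter.Eventually.of_forall fun y => hfst y _))
  rw [hJ, Prod.fst_neg, Prod.fst_add, Prod.fst_sub, courant_fst, courant_fst, courant_fst, courant_fst,
    neg_inj] at h
  have h2 := congrArg (J x) h
  rw [hsq, map_add] at h2
  have key : ∀ a b p q : TangentSpace 𝓘(ℝ, E) x, -(a - b) = p + q → b - q - p - a = 0 := by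
    intro a b p q h
    rw [neg_sub] at h
    rw [sub_sub, sub_sub, sub_eq_zero, eq_add_of_sub_eq h]
    abel
  exact key _ _ _ _ h2

end Courant

section HolomorphicVolume

variable {E : Type*} [NormedAddCommGroup E] [NormedSpace ℝ E] [FiniteDimensional ℝ E]

/-- The real linear endomorphism which becomes multiplication by `i` in the complex coordinates
`θ¹, …, θᵏ`. -/
lemma exists_complexStructure {k : ℕ} {θ : Fin k → E →L[ℝ] ℂ}
    (hdim : Module.finrank ℝ E = 2 * k) (hinj : ∀ v, (∀ i, θ i v = 0) → v = 0) :
    ∃ J : E →L[ℝ] E, (∀ i v, θ i (J v) = Complex.I * θ i v) ∧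
      ∀ ξ : E →L[ℝ] ℝ, toComplex ξ - Complex.I • toComplex (ξ.comp J) ∈
        Submodule.span ℂ (Set.range θ) := by
  let Θ : E →ₗ[ℝ] (Fin k → ℂ) := LinearMap.pi fun i => (θ i).toLinearMap
  have hΘ : Function.Injective Θ := by
    rw [injective_iff_map_eq_zero]
    exact fun v hv => hinj v fun i => congrFun hv i
  let e : E ≃ₗ[ℝ] (Fin k → ℂ) := LinearMap.linearEquivOfInjective Θ hΘ (by
    rw [hdim, Module.finrank_pi_fintype]
    simp [mul_comm])
  have he : ∀ i v, e v i = θ i v := fun i v => rfl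
  let J₀ : E →ₗ[ℝ] E := e.symm.toLinearMap ∘ₗ
    ((LinearMap.lsmul ℂ (Fin k → ℂ) Complex.I).restrictScalars ℝ) ∘ₗ e.toLinearMap
  have hJ : ∀ v, e (J₀ v) = Complex.I • e v := fun v => e.apply_symm_apply _
  refine ⟨LinearMap.toContinuousLinearMap J₀, fun i v => ?_, fun ξ => ?_⟩
  · exact congrFun (hJ v) i
  · have hJ' : ∀ z, J₀ (e.symm z) = e.symm (Complex.I • z) := fun z => by
      apply e.injective; rw [hJ, e.apply_symm_apply, e.apply_symm_apply]
    -- This is the complex-linear functional with real part ξ in the coordinates θ; its expansion in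
    -- these coordinates exhibits ξ - i ξ∘J as a combination of the θ^i.
    let F : (Fin k → ℂ) →ₗ[ℂ] ℂ :=
      { toFun := fun z => (ξ (e.symm z) : ℂ) - Complex.I * (ξ (e.symm (Complex.I • z)) : ℂ)
        map_add' := fun z w => by
          simp only [smul_add, map_add, Complex.ofReal_add]; ring
        map_smul' := fun c z => by
          have h1 : ∀ w : Fin k → ℂ, c • w = c.re • w + c.im • (Complex.I • w) := fun w => by
            ext i
            have h := Complex.re_add_im c
            simp only [Pi.smul_apply, Pi.add_apply, smul_eq_mul, Complex.real_smul]
            linear_combination (-(w i)) * h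
          have h2 : Complex.I • (c • z) = c.re • (Complex.I • z) - c.im • z := by
            rw [smul_comm, h1, smul_smul Complex.I Complex.I, Complex.I_mul_I]
            simp [sub_eq_add_neg]
          rw [h2, h1]
          simp only [map_add, map_sub, map_smul, smul_eq_mul, Complex.ofReal_add, Complex.ofReal_sub,
            Complex.ofReal_mul, RingHom.id_apply]
          conv_rhs => rw [← Complex.re_add_im c]
          have hI : Complex.I ^ 2 = -1 := Complex.I_sq
          linear_combination (c.im * (ξ (e.symm (Complex.I • z)) : ℂ)) * hI }
    have hF : toComplex ξ - Complex.I • toComplex (ξ.comp (LinearMap.toContinuousLinearMap J₀)) =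
        ∑ i, F (fun j => if i = j then 1 else 0) • θ i := by
      ext v
      have h := LinearMap.pi_apply_eq_sum_univ F (e v)
      have h3 : F (e v) = (ξ v : ℂ) - Complex.I * (ξ (J₀ v) : ℂ) := by
        change (ξ (e.symm (e v)) : ℂ) - Complex.I * (ξ (e.symm (Complex.I • e v)) : ℂ) = _
        rw [← hJ', e.symm_apply_apply]
      rw [h3] at h
      simpa [mul_comm, he] using h
    rw [hF]
    exact Submodule.sum_mem _ fun i _ => Submodule.smul_mem _ _ (Submodule.subset_span ⟨i, rfl⟩)

/-- The vector X + iJX is of type (0,1) and the covector ξ - i ξ∘J of type (1,0), so both kill θ¹ ∧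
⋯ ∧ θᵏ. -/
lemma actC_ιMulti_eq_zero {k : ℕ} {θ : Fin k → E →L[ℝ] ℂ} {J : E →L[ℝ] E}
    (hJ : ∀ i v, θ i (J v) = Complex.I * θ i v)
    (hspan : ∀ ξ : E →L[ℝ] ℝ, toComplex ξ - Complex.I • toComplex (ξ.comp J) ∈
        Submodule.span ℂ (Set.range θ)) (a : Gen E) :
    actC a (J a.1, -(a.2.comp J)) (ExteriorAlgebra.ιMulti ℂ k θ) = 0 := by
  have h1 := oneForm_mul_ιMulti_eq_zero (hspan a.2)
  have h2 : CliffordAlgebra.contractLeft (evalC a.1 + Complex.I • evalC (J a.1))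
      (ExteriorAlgebra.ιMulti ℂ k θ) = 0 := by
    refine contractLeft_ιMulti_eq_zero fun i => ?_
    change θ i a.1 + Complex.I * θ i (J a.1) = 0
    rw [hJ, ← mul_assoc, Complex.I_mul_I]
    ring
  have h3 : toComplex (-(a.2.comp J)) = -toComplex (a.2.comp J) := by ext v; simp
  rw [map_add, map_smul, LinearMap.add_apply, LinearMap.smul_apply, ← interior_eq, ← interior_eq] at h2
  rw [oneForm_sub, oneForm_smul, sub_mul, smul_mul_assoc] at h1
  rw [actC, act, act, h3, oneForm_neg, neg_mul, smul_add, smul_neg]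
  refine Eq.trans ?_ ((congrArg₂ (· + ·) h1 h2).trans (add_zero 0))
  abel

end HolomorphicVolume

end GCGeom

/-! ### The five types on the nilmanifold -/

namespace Nilmanifold

open GCGeom NilGroup

variable {α : ℝ} {Γ : Subgroup (NilGroup α)} [DiscreteTopology Γ]

lemma θ_invariantPure_baseTheta {k : ℕ} {B w : ⋀[ℝ]^2 ((Fin 8 → ℝ) →L[ℝ] ℝ)}
    {θ : Fin k → (Fin 8 → ℝ) →L[ℝ] ℂ} {i : Fin k} {j : Fin 4} (h : θ i = baseTheta α j)
    (x : Nilmanifold α Γ) :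
    (invariantPure Γ B w θ).θ i x = theta α (fun j => coframeForm Γ j x) j :=
  (congrArg (fun η : (Fin 8 → ℝ) →L[ℝ] ℂ => η.comp (frame x)) h).trans
    (theta_comp (fun j => ContinuousLinearMap.proj j) (frame x) j).symm

lemma pullForm_frame_baseTheta (x : Nilmanifold α Γ) (i : Fin 4) :
    pullForm (frame x) (oneForm (baseTheta α i)) =
      oneForm (theta α (fun j => coframeForm Γ j x) i) :=
  (pullForm_oneForm (frame x) (baseTheta α i)).trans
    (congrArg oneForm (theta_comp (fun j => ContinuousLinearMap.proj j) (frame x) i).symm)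

lemma pullForm_frame_conj_baseTheta (x : Nilmanifold α Γ) (i : Fin 4) :
    pullForm (frame x) (oneForm (conj (baseTheta α i))) =
      oneForm (conj (theta α (fun j => coframeForm Γ j x) i)) :=
  (pullForm_oneForm (frame x) (conj (baseTheta α i))).trans
    (congrArg (fun η => oneForm (conj η))
      (theta_comp (fun j => ContinuousLinearMap.proj j) (frame x) i).symm)

lemma BForm_invariantPure_zero {k : ℕ} {w : ⋀[ℝ]^2 ((Fin 8 → ℝ) →L[ℝ] ℝ)}
    {θ : Fin k → (Fin 8 → ℝ) →L[ℝ] ℂ} (x : Nilmanifold α Γ) :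
    (invariantPure Γ 0 w θ).BForm x = 0 := by
  rw [BForm_invariantPure, Submodule.coe_zero, map_zero]
  exact map_zero _

/-- The endomorphism of the tangent space at `x` which is `J` in the invariant frame. -/
def transportEnd (J : (Fin 8 → ℝ) →L[ℝ] (Fin 8 → ℝ)) (x : Nilmanifold α Γ) :
    TangentSpace 𝓘(ℝ, Fin 8 → ℝ) x →L[ℝ] TangentSpace 𝓘(ℝ, Fin 8 → ℝ) x :=
  (frame x).inverse.comp (J.comp (frame x))

lemma frame_transportEnd (J : (Fin 8 → ℝ) →L[ℝ] (Fin 8 → ℝ)) (x : Nilmanifold α Γ)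
    (v : TangentSpace 𝓘(ℝ, Fin 8 → ℝ) x) : frame x (transportEnd J x v) = J (frame x v) :=
  DFunLike.congr_fun (frame_isInvertible x).self_comp_inverse (J (frame x v))

/-- A real vector killed by the θ^i is killed by their conjugates, hence by all covectors, because
these eight forms are a basis. -/
lemma eq_zero_of_baseTheta (hα : 0 < α) {v : Fin 8 → ℝ} (hv : ∀ i, baseTheta α i v = 0) : v = 0 := by
  have hli := linearIndependent_allTheta hα
  have hspan : Submodule.span ℂ (Set.range (allTheta α)) = ⊤ :=
    hli.span_eq_top_of_card_eq_finrank' (by rw [finrank_covectors]; simp)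
  have hall : ∀ i, allTheta α i v = 0 := by
    intro i
    fin_cases i <;> simp [allTheta, hv]
  have hle : Submodule.span ℂ (Set.range (allTheta α)) ≤ LinearMap.ker (evalC v) := by
    rw [Submodule.span_le]
    rintro _ ⟨i, rfl⟩
    exact hall i
  funext j
  have h : toComplex (ContinuousLinearMap.proj j : (Fin 8 → ℝ) →L[ℝ] ℝ) ∈
      LinearMap.ker (evalC v) := hle (hspan ▸ Submodule.mem_top)
  exact Complex.ofReal_eq_zero.1 h

lemma exists_typeFour (hα : 0 < α) :
    ∃ (𝒥 : GCStructure (Fin 8 → ℝ) (Nilmanifold α Γ))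
        (D : PureForm (Fin 8 → ℝ) (Nilmanifold α Γ) 4),
      InvariantGivenBy 𝒥 D ∧
      (∀ x, D.BForm x = 0 ∧ D.omegaForm x = 0 ∧
        ∀ i, D.θ i x = theta α (fun j => coframeForm Γ j x) i) ∧
      ∃ J : ∀ x : Nilmanifold α Γ,
          TangentSpace 𝓘(ℝ, Fin 8 → ℝ) x →L[ℝ] TangentSpace 𝓘(ℝ, Fin 8 → ℝ) x,
        𝒥.IsOfComplex J ∧ ∀ x i v, D.θ i x (J x v) = Complex.I * D.θ i x v := by
  obtain ⟨J, 𝒥, hann, hJ, hinv⟩ :=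
    exists_invariantGivenBy Γ (nondegenerate_typeFour hα) (closed_typeFour hα)
  obtain ⟨J₀, hJ₀, hspan⟩ := exists_complexStructure (θ := baseTheta α) (by simp)
    (fun v hv => eq_zero_of_baseTheta hα hv)
  have hρ : pureSpinor 0 0 (baseTheta α) = ExteriorAlgebra.ιMulti ℂ 4 (baseTheta α) := by
    have h0 : expForm (0 : CForms (Fin 8 → ℝ)) = 1 := by
      rw [expForm, Finset.sum_eq_single 0] <;> simp +contextual
    rw [pureSpinor, complexTwo_zero_left, Submodule.coe_zero, map_zero, smul_zero, h0, one_mul]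
  -- The annihilator determines J, so it suffices to exhibit, for each a, the partner that completes
  -- it to an annihilating element.
  have hJJ : ∀ a, J a = (-(J₀ a.1), a.2.comp J₀) := fun a => by
    rw [(hann a (J₀ a.1, -(a.2.comp J₀))).1 (by rw [hρ]; exact actC_ιMulti_eq_zero hJ₀ hspan a)]
    exact Prod.ext rfl (neg_neg _)
  refine ⟨𝒥, _, hinv, fun x => ⟨BForm_invariantPure_zero x, ?_, fun i =>
    θ_invariantPure_baseTheta rfl x⟩, transportEnd J₀, 𝒥.isOfComplex _ fun x a => ?_, fun x i v => ?_⟩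
  · rw [omegaForm_invariantPure, Submodule.coe_zero, map_zero]
    exact map_zero _
  · rw [hJ, transportJ_apply, hJJ]
    exact Prod.ext (map_neg (frame x).inverse _) rfl
  · exact (congrArg (baseTheta α i) (frame_transportEnd J₀ x v)).trans (hJ₀ i _)

lemma exists_typeThree (hα : 0 < α) :
    ∃ (𝒥 : GCStructure (Fin 8 → ℝ) (Nilmanifold α Γ))
        (D : PureForm (Fin 8 → ℝ) (Nilmanifold α Γ) 3),
      InvariantGivenBy 𝒥 D ∧
      ∀ x, D.BForm x = 0 ∧
        D.omegaForm x = Complex.I •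
          (oneForm (theta α (fun j => coframeForm Γ j x) 3) *
            oneForm (conj (theta α (fun j => coframeForm Γ j x) 3))) ∧
        ∀ i, D.θ i x = theta α (fun j => coframeForm Γ j x) i.castSucc := by
  obtain ⟨J, 𝒥, hann, hJ, hinv⟩ :=
    exists_invariantGivenBy Γ (nondegenerate_typeThree hα) (closed_typeThree hα)
  refine ⟨𝒥, _, hinv, fun x => ⟨BForm_invariantPure_zero x, ?_, fun i =>
    θ_invariantPure_baseTheta (θ := fun i : Fin 3 => baseTheta α i.castSucc) rfl x⟩⟩
  rw [omegaForm_invariantPure, complexify_kahlerTwo, invariantForm, map_smul, map_mul,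
    pullForm_frame_baseTheta, pullForm_frame_conj_baseTheta]

lemma exists_typeTwo (hα : 0 < α) :
    ∃ (𝒥 : GCStructure (Fin 8 → ℝ) (Nilmanifold α Γ))
        (D : PureForm (Fin 8 → ℝ) (Nilmanifold α Γ) 2),
      InvariantGivenBy 𝒥 D ∧
      ∀ x, D.BForm x = (1 / 2 : ℂ) •
          (oneForm (theta α (fun j => coframeForm Γ j x) 2) *
              oneForm (theta α (fun j => coframeForm Γ j x) 3)
            + oneForm (conj (theta α (fun j => coframeForm Γ j x) 2)) *
              oneForm (conj (theta α (fun j => coframeForm Γ j x) 3))) ∧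
        D.omegaForm x = (-Complex.I / 2) •
          (oneForm (theta α (fun j => coframeForm Γ j x) 2) *
              oneForm (theta α (fun j => coframeForm Γ j x) 3)
            - oneForm (conj (theta α (fun j => coframeForm Γ j x) 2)) *
              oneForm (conj (theta α (fun j => coframeForm Γ j x) 3))) ∧
        D.θ 0 x = theta α (fun j => coframeForm Γ j x) 0 ∧
        D.θ 1 x = theta α (fun j => coframeForm Γ j x) 1 := by
  obtain ⟨J, 𝒥, hann, hJ, hinv⟩ :=
    exists_invariantGivenBy Γ (nondegenerate_typeTwo hα) (closed_typeTwo hα)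
  refine ⟨𝒥, _, hinv, fun x => ⟨?_, ?_, θ_invariantPure_baseTheta (θ := ![baseTheta α 0, baseTheta α 1]) (i := 0) (j := 0) rfl x,
    θ_invariantPure_baseTheta (θ := ![baseTheta α 0, baseTheta α 1]) (i := 1) (j := 1) rfl x⟩⟩
  · rw [BForm_invariantPure, complexify_reTwo, invariantForm, map_smul, map_add, map_mul, map_mul,
      pullForm_frame_baseTheta, pullForm_frame_baseTheta, pullForm_frame_conj_baseTheta,
      pullForm_frame_conj_baseTheta]
  · rw [omegaForm_invariantPure, complexify_imTwo, invariantForm, map_smul, map_sub, map_mul, map_mul,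
      pullForm_frame_baseTheta, pullForm_frame_baseTheta, pullForm_frame_conj_baseTheta,
      pullForm_frame_conj_baseTheta]

lemma omega_invariantPure_baseTwo {k : ℕ} {B : ⋀[ℝ]^2 ((Fin 8 → ℝ) →L[ℝ] ℝ)}
    {θ : Fin k → (Fin 8 → ℝ) →L[ℝ] ℂ}
    (x12 x13 x14 x15 x16 x17 x23 x24 x25 x27 x34 x37 : ℝ) (x : Nilmanifold α Γ) :
    ((invariantPure Γ B (baseTwo α x12 x13 x14 x15 x16 x17 x23 x24 x25 x27 x34 x37) θ).omega x :
        RForms (TangentSpace 𝓘(ℝ, Fin 8 → ℝ) x)) =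
      twoForm α (fun j => coframeForm Γ j x) x12 x13 x14 x15 x16 x17 x23 x24 x25 x27 x34 x37 :=
  pullReal_twoForm (fun j => ContinuousLinearMap.proj j) (frame x) _ _ _ _ _ _ _ _ _ _ _ _

lemma exists_typeOne (hα : 0 < α) (x12 x13 x14 x15 x16 x17 x23 x24 x25 x27 x34 x37 : ℝ)
    (h17 : x17 ≠ 0) (h37 : x37 ≠ 0) :
    ∃ (𝒥 : GCStructure (Fin 8 → ℝ) (Nilmanifold α Γ))
        (D : PureForm (Fin 8 → ℝ) (Nilmanifold α Γ) 1),
      InvariantGivenBy 𝒥 D ∧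
      ∀ x, D.BForm x = 0 ∧
        (D.omega x : RForms (TangentSpace 𝓘(ℝ, Fin 8 → ℝ) x)) =
          twoForm α (fun j => coframeForm Γ j x)
            x12 x13 x14 x15 x16 x17 x23 x24 x25 x27 x34 x37 ∧
        D.θ 0 x = toComplex (coframeForm Γ 2 x) + Complex.I • toComplex (coframeForm Γ 3 x) := by
  obtain ⟨J, 𝒥, hann, hJ, hinv⟩ := exists_invariantGivenBy Γ (B := 0)
    (nondegenerate_typeOne (x12 := x12) (x13 := x13) (x14 := x14) (x15 := x15) (x16 := x16)
      (x23 := x23) (x24 := x24) (x25 := x25) (x27 := x27) (x34 := x34) hα h17 h37) closed_typeOne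
  exact ⟨𝒥, _, hinv, fun x => ⟨BForm_invariantPure_zero x, omega_invariantPure_baseTwo _ _ _ _ _ _ _ _
    _ _ _ _ x, rfl⟩⟩

/-- The generalized complex structure given by `e^{i ω}` is the one of the symplectic form `ω`. -/
lemma isOfSymplectic_invariantPure {w : ⋀[ℝ]^2 ((Fin 8 → ℝ) →L[ℝ] ℝ)}
    {θ : Fin 0 → (Fin 8 → ℝ) →L[ℝ] ℂ} (h : NondegenerateAt w θ 4)
    (hw : HasInvDeriv α (complexify (w : RForms (Fin 8 → ℝ))) 0)
    {J : Gen (Fin 8 → ℝ) →ₗ[ℝ] Gen (Fin 8 → ℝ)} {𝒥 : GCStructure (Fin 8 → ℝ) (Nilmanifold α Γ)}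
    (hann : ∀ a b, actC a b (pureSpinor 0 w θ) = 0 ↔ J a = -b)
    (hJ : ∀ x, 𝒥.J x = transportJ J x) :
    𝒥.IsOfSymplectic (invariantPure Γ 0 w θ).omega := by
  obtain ⟨f, hf⟩ := exists_contraction w
  -- Since ι_X e^{iω} = i ι_Xω ∧ e^{iω}, the element X - i ι_Xω annihilates e^{iω}.
  have hJX : ∀ X, J (X, 0) = (0, f X) := fun X => by
    rw [(hann (X, 0) (0, -f X)).1 ?_, Prod.neg_mk, neg_zero, neg_neg]
    have h1 := contractLeft_pureSpinor (B := 0) (w := w) (θ := θ) h.finrank_pos (d := evalC X)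
      (fun i => i.elim0)
    rw [← interior_eq, ← interior_eq, complexTwo_zero_left, GCGeom.interior_smul, hf] at h1
    have h2 : toComplex (-f X) = -toComplex (f X) := by ext v; simp
    have h3 : GCGeom.interior (0 : Fin 8 → ℝ) (pureSpinor 0 w θ) = 0 := by
      simpa using interior_smul_left 0 (0 : Fin 8 → ℝ) (pureSpinor 0 w θ)
    rw [actC, act, act, h1, h2, h3, toComplex_zero, oneForm_neg, neg_mul, zero_add, smul_neg,
      smul_mul_assoc]
    simp
  have hcoe : (invariantPure Γ 0 w θ).omegaForm =
      invariantForm Γ (complexify (w : RForms (Fin 8 → ℝ))) := omegaForm_invariantPure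
  have hint : ∀ (x : Nilmanifold α Γ) (X : TangentSpace 𝓘(ℝ, Fin 8 → ℝ) x),
      GCGeom.interior X ((invariantPure Γ 0 w θ).omegaForm x) =
        pullForm (frame x) (GCGeom.interior (frame x X) (complexify (w : RForms (Fin 8 → ℝ)))) := by
    intro x X
    rw [hcoe]
    exact interior_pullForm (frame x) X _
  refine ⟨?_, fun x => ?_, fun x X hX => ?_, fun x X => ?_⟩
  · change SmoothForm (invariantPure Γ 0 w θ).omegaForm
    rw [hcoe]
    exact smoothForm_invariantForm _
  · change extDerivM (invariantPure Γ 0 w θ).omegaForm x = 0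
    rw [hcoe, extDerivM_invariantForm x hw]
    exact map_zero _
  · have h1 := pullForm_injective (frame_isInvertible x)
      (((hint x X).symm.trans hX).trans (map_zero _).symm)
    -- A vector in the kernel of ω contracts to zero with the top form ω⁴, which is nonzero.
    have h2 : GCGeom.interior (frame x X) (complexify (w : RForms (Fin 8 → ℝ)) ^ 4) = 0 := by
      rw [interior_eq, contractLeft_pow (invo_complexify_two w), ← interior_eq, h1, mul_zero, smul_zero]
    have h3 : complexify (w : RForms (Fin 8 → ℝ)) ^ 4 ≠ 0 := fun h0 => h.ne_zero (by
      rw [Nat.sub_zero, h0, zero_mul, zero_mul])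
    have h4 : frame x X = 0 := eq_zero_of_interior_top
      (pow_mem_exteriorPower (complexify_two_mem w) 4) (by simp) h3 h2
    have h5 := DFunLike.congr_fun (frame_isInvertible x).inverse_comp_self X
    exact h5.symm.trans ((congrArg (frame x).inverse h4).trans (map_zero _))
  · have h1 : 𝒥.J x (X, 0) = pullGen (frame x) (0, f (frame x X)) := by
      rw [hJ, transportJ_apply, ← hJX]
      exact congrArg (fun a => pullGen (frame x) (J a))
        (Prod.ext rfl (ContinuousLinearMap.zero_comp _))
    rw [h1]
    refine ⟨map_zero (frame x).inverse, Eq.trans ?_ (hint x X).symm⟩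
    rw [hf]
    exact (pullForm_oneForm (frame x) (toComplex (f (frame x X)))).symm

lemma exists_typeZero (hα : 0 < α) (x12 x13 x14 x15 x16 x17 x23 x24 x25 x27 x34 x37 : ℝ)
    (h17 : x17 = 0) (h23 : x23 = 0) (h25 : x25 ≠ 0) (h37 : x37 ≠ 0) :
    ∃ (𝒥 : GCStructure (Fin 8 → ℝ) (Nilmanifold α Γ))
        (D : PureForm (Fin 8 → ℝ) (Nilmanifold α Γ) 0),
      InvariantGivenBy 𝒥 D ∧ 𝒥.IsOfSymplectic D.omega ∧
      ∀ x, D.BForm x = 0 ∧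
        (D.omega x : RForms (TangentSpace 𝓘(ℝ, Fin 8 → ℝ) x)) =
          twoForm α (fun j => coframeForm Γ j x)
            x12 x13 x14 x15 x16 x17 x23 x24 x25 x27 x34 x37 := by
  have hnd := nondegenerate_typeZero (x12 := x12) (x13 := x13) (x14 := x14) (x15 := x15)
    (x16 := x16) (x24 := x24) (x27 := x27) (x34 := x34) hα h17 h23 h25 h37 Fin.elim0
  obtain ⟨J, 𝒥, hann, hJ, hinv⟩ := exists_invariantGivenBy Γ (B := 0) hnd (closed_typeZero _)
  exact ⟨𝒥, _, hinv, isOfSymplectic_invariantPure hnd closed_baseTwo hann hJ,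
    fun x => ⟨BForm_invariantPure_zero x, omega_invariantPure_baseTwo _ _ _ _ _ _ _ _ _ _ _ _ x⟩⟩

end Nilmanifold

/-! ### The lattice -/

namespace NilGroup

/-- The lattice `(6 d ℤ)⁸` in `G_α`, where `d` is a positive integer such that `d (1 + α)` is an
integer `q`. -/
def lattice {α : ℝ} {d q : ℤ} (hd : 0 < d) (hq : (1 + α) * d = q) : Subgroup (NilGroup α) where
  carrier := {g | ∃ a : Fin 8 → ℤ, ∀ i, (g : Fin 8 → ℝ) i = 6 * d * a i}
  one_mem' := ⟨0, fun i => by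
    change (0 : ℝ) = _
    simp⟩
  mul_mem' := by
    rintro g h ⟨a, ha⟩ ⟨b, hb⟩
    have hd' : (d : ℝ) ≠ 0 := by exact_mod_cast hd.ne'
    have hα : α = q / d - 1 := by rw [← hq]; field_simp; ring
    -- These are the coordinates of the product divided by 6d, with α = q/d - 1. One d clears each 1
    -- + α or 1 - α, and the factor 6 clears the denominators 2 and 6.
    refine ⟨![a 0 + b 0, a 1 + b 1, a 2 + b 2, a 3 + b 3, a 4 + b 4 - 6 * d * a 0 * b 1,
      a 5 + b 5 - 6 * d * a 0 * b 4 + 18 * d ^ 2 * a 0 ^ 2 * b 1 - 6 * (2 * d - q) * a 1 * b 3,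
      a 6 + b 6 + 6 * q * a 0 * b 3 + 6 * d * a 1 * b 2 - 6 * q * a 1 * b 4
        + 36 * d * q * a 0 * a 1 * b 1 + 18 * d * q * a 0 * b 1 ^ 2,
      a 7 + b 7 - 6 * d * a 0 * b 5 - 6 * d * a 1 * b 6
        + (18 * d ^ 2 * a 0 ^ 2 + 18 * d * q * a 1 ^ 2 + 12 * d * a 3) * b 4
        - 18 * d ^ 2 * a 1 ^ 2 * b 2 - (6 * d * a 2 + 36 * d * q * a 0 * a 1) * b 3
        - 72 * d ^ 2 * a 0 * b 1 * b 3 - 36 * d ^ 3 * a 0 ^ 3 * b 1 - 72 * d ^ 2 * a 0 * a 3 * b 1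
        - 36 * d ^ 2 * q * a 0 * (3 * a 1 ^ 2 * b 1 + 3 * a 1 * b 1 ^ 2 + b 1 ^ 3)], fun i => ?_⟩
    change mulVec α g h i = _
    fin_cases i <;> simp [mulVec, ha, hb, hα] <;> field_simp <;> ring
  inv_mem' := by
    rintro g ⟨a, ha⟩
    have hd' : (d : ℝ) ≠ 0 := by exact_mod_cast hd.ne'
    have hα : α = q / d - 1 := by rw [← hq]; field_simp; ring
    refine ⟨![-a 0, -a 1, -a 2, -a 3, -a 4 - 6 * d * a 0 * a 1,
      -a 5 - 6 * d * a 0 * a 4 - 18 * d ^ 2 * a 0 ^ 2 * a 1 - 6 * (2 * d - q) * a 1 * a 3,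
      -a 6 + 6 * q * a 0 * a 3 + 6 * d * a 1 * a 2 - 6 * q * a 1 * a 4 - 18 * d * q * a 0 * a 1 ^ 2,
      -a 7 - 6 * d * a 0 * a 5 - 6 * d * a 1 * a 6 - 18 * d ^ 2 * a 0 ^ 2 * a 4
        - 18 * d * q * a 1 ^ 2 * a 4 + 12 * d * a 3 * a 4 - 6 * d * a 2 * a 3
        + 18 * d ^ 2 * a 1 ^ 2 * a 2 + 36 * d * q * a 0 * a 1 * a 3 - 36 * d ^ 3 * a 0 ^ 3 * a 1
        - 36 * d ^ 2 * q * a 0 * a 1 ^ 3], fun i => ?_⟩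
    change invVec α g i = _
    fin_cases i <;> simp [invVec, ha, hα] <;> field_simp <;> ring

variable {α : ℝ} {d q : ℤ} (hd : 0 < d) (hq : (1 + α) * d = q)

/-- Coordinates of lattice points are multiples of 6d ≥ 6, so the identity is the only one in the
open unit cube. -/
lemma discreteTopology_lattice : DiscreteTopology (lattice hd hq) := by
  refine discreteTopology_of_isOpen_singleton_one ?_
  have hopen : IsOpen {g : NilGroup α | ∀ i, |(g : Fin 8 → ℝ) i| < 1} := by
    have h : {g : Fin 8 → ℝ | ∀ i, |g i| < 1} = ⋂ i, {g : Fin 8 → ℝ | |g i| < 1} := by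
      ext g
      simp
    refine (congrArg IsOpen h).mpr (isOpen_iInter_of_finite fun i =>
      isOpen_lt (continuous_abs.comp (continuous_apply i)) continuous_const)
  have heq : ({1} : Set (lattice hd hq)) =
      Subtype.val ⁻¹' {g : NilGroup α | ∀ i, |(g : Fin 8 → ℝ) i| < 1} := by
    ext ⟨g, a, ha⟩
    constructor
    · intro h i
      have hg : g = 1 := congrArg Subtype.val h
      subst hg
      change |(0 : ℝ)| < 1
      simp
    · intro h
      refine Subtype.ext (funext fun i => ?_)
      have h1 : |(g : Fin 8 → ℝ) i| < 1 := h i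
      have hd1 : (1 : ℝ) ≤ d := by exact_mod_cast hd
      have hai : a i = 0 := by
        by_contra hne
        have h2 : (1 : ℝ) ≤ |(a i : ℝ)| := by exact_mod_cast Int.one_le_abs hne
        rw [ha, abs_mul, abs_of_pos (by positivity : (0 : ℝ) < 6 * d)] at h1
        nlinarith
      change (g : Fin 8 → ℝ) i = 0
      rw [ha, hai]
      simp
  rw [heq]
  exact hopen.preimage continuous_subtype_val

/-- Every point can be moved by the lattice into a given cube. -/
lemma exists_lattice_mem_cube {d : ℤ} (hd : 0 < d) (g : Fin 8 → ℝ) :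
    ∃ a : Fin 8 → ℤ, ∀ i, mulVec α (fun j => 6 * d * a j) g i ∈ Set.Icc (0 : ℝ) (6 * d) := by
  have hd0 : (0 : ℝ) < 6 * d := by
    have : (0 : ℝ) < d := by exact_mod_cast hd
    linarith
  have key : ∀ r : ℝ, ∃ n : ℤ, 6 * d * n + r ∈ Set.Icc (0 : ℝ) (6 * d) := by
    intro r
    refine ⟨-⌊r / (6 * d)⌋, ?_⟩
    have h1 := Int.floor_le (r / (6 * d))
    have h2 := (Int.lt_floor_add_one (r / (6 * d))).le
    rw [le_div_iff₀ hd0] at h1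
    rw [div_le_iff₀ hd0] at h2
    push_cast
    constructor <;> linarith
  obtain ⟨n0, h0⟩ := key (g 0)
  obtain ⟨n1, h1⟩ := key (g 1)
  obtain ⟨n2, h2⟩ := key (g 2)
  obtain ⟨n3, h3⟩ := key (g 3)
  -- The i-th coordinate of γg is γ_i plus a function of g and earlier coordinates of γ, so the
  -- integers are chosen successively. The displayed vectors contain just the coordinates of γ that
  -- enter.
  obtain ⟨n4, h4⟩ := key (mulVec α ![6 * d * n0, 0, 0, 0, 0, 0, 0, 0] g 4)
  obtain ⟨n5, h5⟩ := key (mulVec α ![6 * d * n0, 6 * d * n1, 0, 0, 0, 0, 0, 0] g 5)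
  obtain ⟨n6, h6⟩ := key (mulVec α ![6 * d * n0, 6 * d * n1, 0, 0, 0, 0, 0, 0] g 6)
  obtain ⟨n7, h7⟩ := key (mulVec α ![6 * d * n0, 6 * d * n1, 6 * d * n2, 6 * d * n3, 0, 0, 0, 0] g 7)
  refine ⟨![n0, n1, n2, n3, n4, n5, n6, n7], fun i => ?_⟩
  fin_cases i
  · convert h0 using 1; simp [mulVec]
  · convert h1 using 1; simp [mulVec]
  · convert h2 using 1; simp [mulVec]
  · convert h3 using 1; simp [mulVec]
  · convert h4 using 1; simp [mulVec]; ring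
  · convert h5 using 1; simp [mulVec]; ring
  · convert h6 using 1; simp [mulVec]; ring
  · convert h7 using 1; simp [mulVec]; ring

lemma compactSpace_lattice : CompactSpace (Nilmanifold α (lattice hd hq)) := by
  have hK : IsCompact (Set.univ.pi fun _ : Fin 8 => Set.Icc (0 : ℝ) (6 * d)) :=
    isCompact_univ_pi fun _ => isCompact_Icc
  have hcont : Continuous (fun y : Fin 8 → ℝ => Nilmanifold.proj (lattice hd hq) (ofVec y)) :=
    continuous_quotient_mk'
  have himage := hK.image hcont
  rw [← isCompact_univ_iff]
  convert himage
  refine (Set.eq_univ_of_forall fun x => ?_).symm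
  obtain ⟨g, rfl⟩ := Quotient.exists_rep x
  obtain ⟨a, ha⟩ := exists_lattice_mem_cube (α := α) hd g
  exact ⟨_, fun i _ => ha i, Nilmanifold.proj_smul
    (⟨ofVec fun j => 6 * d * a j, a, fun _ => rfl⟩ : lattice hd hq) g⟩

/-- For rational `α` the group `G_α` has a lattice. -/
lemma exists_lattice (α : ℚ) : ∃ Γ : Subgroup (NilGroup (α : ℝ)),
    DiscreteTopology Γ ∧ CompactSpace (Nilmanifold (α : ℝ) Γ) := by
  have hd : (0 : ℤ) < α.den := by exact_mod_cast α.den_pos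
  have hq : (1 + (α : ℝ)) * (α.den : ℤ) = ((α.den + α.num : ℤ) : ℝ) := by
    have h : (α : ℝ) * α.den = α.num := by exact_mod_cast Rat.mul_den_eq_num α
    push_cast
    linear_combination h
  exact ⟨lattice hd hq, discreteTopology_lattice hd hq, compactSpace_lattice hd hq⟩

end NilGroup

end

open GCGeom Nilmanifold in
theorem proposition1p2 (α : ℚ) (hα : 0 < α) :
    -- the group has a lattice
    (∃ Γ : Subgroup (NilGroup (α : ℝ)), DiscreteTopology Γ ∧ CompactSpace (Nilmanifold (α : ℝ) Γ)) ∧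
    -- for every lattice, with `e¹, …, e⁸` the invariant coframe on the quotient:
    ∀ (Γ : Subgroup (NilGroup (α : ℝ))) [DiscreteTopology Γ] [CompactSpace (Nilmanifold (α : ℝ) Γ)],
    ∃ e : Fin 8 → ∀ x : Nilmanifold (α : ℝ) Γ, TangentSpace 𝓘(ℝ, Fin 8 → ℝ) x →L[ℝ] ℝ,
      IsInvariantCoframe e ∧ StructureEquations e ∧
      -- type 4: a complex structure, with `θ¹, …, θ⁴` of bidegree `(1,0)`
      (∃ (𝒥 : GCStructure (Fin 8 → ℝ) (Nilmanifold (α : ℝ) Γ))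
          (D : PureForm (Fin 8 → ℝ) (Nilmanifold (α : ℝ) Γ) 4),
        InvariantGivenBy 𝒥 D ∧
        (∀ x, D.BForm x = 0 ∧ D.omegaForm x = 0 ∧
          ∀ i, D.θ i x = theta (α : ℝ) (fun j => e j x) i) ∧
        ∃ J : ∀ x : Nilmanifold (α : ℝ) Γ,
            TangentSpace 𝓘(ℝ, Fin 8 → ℝ) x →L[ℝ] TangentSpace 𝓘(ℝ, Fin 8 → ℝ) x,
          𝒥.IsOfComplex J ∧ ∀ x i v, D.θ i x (J x v) = Complex.I * D.θ i x v) ∧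
      -- type 3
      (∃ (𝒥 : GCStructure (Fin 8 → ℝ) (Nilmanifold (α : ℝ) Γ))
          (D : PureForm (Fin 8 → ℝ) (Nilmanifold (α : ℝ) Γ) 3),
        InvariantGivenBy 𝒥 D ∧
        ∀ x, D.BForm x = 0 ∧
          D.omegaForm x = Complex.I •
            (oneForm (theta (α : ℝ) (fun j => e j x) 3) *
              oneForm (conj (theta (α : ℝ) (fun j => e j x) 3))) ∧
          ∀ i, D.θ i x = theta (α : ℝ) (fun j => e j x) i.castSucc) ∧
      -- type 2: `e^{θ³ ∧ θ⁴} θ¹ ∧ θ²`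
      (∃ (𝒥 : GCStructure (Fin 8 → ℝ) (Nilmanifold (α : ℝ) Γ))
          (D : PureForm (Fin 8 → ℝ) (Nilmanifold (α : ℝ) Γ) 2),
        InvariantGivenBy 𝒥 D ∧
        ∀ x, D.BForm x = (1 / 2 : ℂ) •
            (oneForm (theta (α : ℝ) (fun j => e j x) 2) *
                oneForm (theta (α : ℝ) (fun j => e j x) 3)
              + oneForm (conj (theta (α : ℝ) (fun j => e j x) 2)) *
                oneForm (conj (theta (α : ℝ) (fun j => e j x) 3))) ∧
          D.omegaForm x = (-Complex.I / 2) •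
            (oneForm (theta (α : ℝ) (fun j => e j x) 2) *
                oneForm (theta (α : ℝ) (fun j => e j x) 3)
              - oneForm (conj (theta (α : ℝ) (fun j => e j x) 2)) *
                oneForm (conj (theta (α : ℝ) (fun j => e j x) 3))) ∧
          D.θ 0 x = theta (α : ℝ) (fun j => e j x) 0 ∧
          D.θ 1 x = theta (α : ℝ) (fun j => e j x) 1) ∧
      -- type 1: `e^{i ω} (e³ + i e⁴)`
      (∀ x12 x13 x14 x15 x16 x17 x23 x24 x25 x27 x34 x37 : ℝ, x17 ≠ 0 → x37 ≠ 0 →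
        ∃ (𝒥 : GCStructure (Fin 8 → ℝ) (Nilmanifold (α : ℝ) Γ))
          (D : PureForm (Fin 8 → ℝ) (Nilmanifold (α : ℝ) Γ) 1),
        InvariantGivenBy 𝒥 D ∧
        ∀ x, D.BForm x = 0 ∧
          (D.omega x : RForms (TangentSpace 𝓘(ℝ, Fin 8 → ℝ) x)) =
            twoForm (α : ℝ) (fun j => e j x)
              x12 x13 x14 x15 x16 x17 x23 x24 x25 x27 x34 x37 ∧
          D.θ 0 x = toComplex (e 2 x) + Complex.I • toComplex (e 3 x)) ∧
      -- type 0: a symplectic form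
      (∀ x12 x13 x14 x15 x16 x17 x23 x24 x25 x27 x34 x37 : ℝ,
        x17 = 0 → x23 = 0 → x25 ≠ 0 → x37 ≠ 0 →
        ∃ (𝒥 : GCStructure (Fin 8 → ℝ) (Nilmanifold (α : ℝ) Γ))
          (D : PureForm (Fin 8 → ℝ) (Nilmanifold (α : ℝ) Γ) 0),
        InvariantGivenBy 𝒥 D ∧ 𝒥.IsOfSymplectic D.omega ∧
        ∀ x, D.BForm x = 0 ∧
          (D.omega x : RForms (TangentSpace 𝓘(ℝ, Fin 8 → ℝ) x)) =
            twoForm (α : ℝ) (fun j => e j x)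
              x12 x13 x14 x15 x16 x17 x23 x24 x25 x27 x34 x37) := by
  have hα' : (0 : ℝ) < α := by exact_mod_cast hα
  refine ⟨NilGroup.exists_lattice α, fun Γ _ _ => ⟨coframeForm Γ, isInvariantCoframe_coframeForm,
    structureEquations_coframeForm, exists_typeFour hα', exists_typeThree hα', exists_typeTwo hα',
    exists_typeOne hα', exists_typeZero hα'⟩⟩
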